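/- **Machine model.** A deterministic random access machine in the addition-comparison model. It has words (natural numbers of $O(\log n)$ bits, i.e. below $(n+2)^c$ for a constant $c$), which can be added, compared and used as array indices, and weights in $[0,+\infty]$, which can be added and compared. The input points and the radius are inspected only by comparing the distance of two input points with the radius or with the distance of two other input points. There is no multiplication, subtraction, division, rounding or randomness, and each instruction or test takes one unit of time. ("Combinatorial" is understood as: running on this machine.) **Definitions.** Let $p_1,\dots,p_n$ be distinct points of the unit square $[0,1]^2$, let $0<r\le 1$, and let $w_1,\dots,w_n\ge 0$ be real vertex weights. The uniform disk graph $G$ of radius $r$ induced by the points has the points as vertices, two distinct points being adjacent iff their Euclidean distance is at most $r$. For $b:\mathbb N\to\mathbb N$, the point set is $b(n)$-dense if each cell of the regular $\sqrt n\times\sqrt n$ grid (half-open square cells of side $1/\sqrt n$) contains at most $b(n)$ of the points. The distance $D_G(v,u)$ is $0$ if $v=u$; otherwise it is the minimum total weight of the vertices (both ends included) on a path from $v$ to $u$ in $G$, and $+\infty$ if there is no such path. To solve the all-pairs shortest paths problem for $G$ is to compute the $n\times n$ matrix $D_G$ together with a successor matrix $S$ representing shortest paths: for all distinct $v,u$ in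 the same connected component there is a shortest path from $v$ to $u$ on which each vertex $x\neq u$ is followed by $S(x,u)$. **Theorem.** There are a single program for this machine and constants $c,C,k$ such that for all $b:\mathbb N\to\mathbb N$, all $n$, all $r\in(0,1]$, every $b(n)$-dense set of $n$ points in the unit square and all nonnegative real vertex weights, the program, given $n$, the points, $r$ and the weights, halts and solves the all-pairs shortest paths problem for the uniform disk graph $G$ of radius $r$ induced by the points; and if $r\ge 1/\sqrt n$ (for constant $r$: for all sufficiently large $n$), it does so in at most $$C\,\sqrt r\;n^{2.75}\,\sqrt{b(n)}\,\log^k(n+2)$$ steps, that is, in time $\widetilde O(\sqrt r\,n^{2.75}\sqrt{b(n)})$. -/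

import Mathlib

open scoped NNReal ENNReal

noncomputable section

namespace DiskAPSP

/-! ### Uniform disk graphs and dense point sets -/

/-- The Euclidean plane. -/
abbrev Plane : Type := EuclideanSpace ℝ (Fin 2)

/-- All the points lie in the unit square `[0,1] × [0,1]`. -/
def InUnitSquare {n : ℕ} (p : Fin n → Plane) : Prop :=
  ∀ v : Fin n, ∀ i : Fin 2, 0 ≤ p v i ∧ p v i ≤ 1

/-- The cell of the regular `√n × √n` grid (cells of side `1/√n`, half-open, so that they form a
partition) that contains the point `x`. -/
def gridCell (n : ℕ) (x : Plane) : ℤ × ℤ :=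
  (⌊x 0 * √(n : ℝ)⌋, ⌊x 1 * √(n : ℝ)⌋)

/-- `β`-density of an `n`-point set: each cell of the `√n × √n` grid contains at most `β` points. -/
def IsDense {n : ℕ} (β : ℕ) (p : Fin n → Plane) : Prop :=
  ∀ cell : ℤ × ℤ, Set.ncard {v : Fin n | gridCell n (p v) = cell} ≤ β

/-- The uniform disk graph of radius `r` induced by the points `p`: two distinct vertices are
adjacent iff their Euclidean distance is at most `r`. -/
def diskGraph {n : ℕ} (p : Fin n → Plane) (r : ℝ) : SimpleGraph (Fin n) where
  Adj v u := v ≠ u ∧ dist (p v) (p u) ≤ r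
  symm := ⟨fun _ _ h => ⟨h.1.symm, by rw [dist_comm]; exact h.2⟩⟩
  loopless := ⟨fun _ h => h.1 rfl⟩

/-! ### Vertex-weighted distances -/

/-- Total weight of the vertices of a walk, both end vertices included. -/
def walkWeight {n : ℕ} {G : SimpleGraph (Fin n)} (w : Fin n → ℝ≥0) {v u : Fin n}
    (q : G.Walk v u) : ℝ≥0 :=
  (q.support.map w).sum

/-- Entry of the distance matrix: `0` on the diagonal; otherwise the minimum total weight of the
vertices on a path from `v` to `u`, and `+∞` if there is no such path. -/
def vdist {n : ℕ} (G : SimpleGraph (Fin n)) (w : Fin n → ℝ≥0) (v u : Fin n) : ℝ≥0∞ :=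
  if v = u then 0 else ⨅ q : G.Path v u, (walkWeight w q.1 : ℝ≥0∞)

/-! ### The machine: a deterministic RAM in the addition-comparison model

Two kinds of data, kept apart:
* words (natural numbers below a bound `W`, polynomial in `n`, i.e. `O(log n)` bits), in word
  registers and word arrays, used for indices and counters; they can be added and compared;
* weights (elements of `[0, +∞]`), in weight registers and weight arrays; they can be added and
  compared, and never converted to words.

The input points and the radius can only be inspected by comparing a distance between two input
points with the radius or with another such distance.  There is no subtraction, multiplication,
division, rounding or randomness.  Programs are finite and independent of the input; every
instruction and every evaluation of a test costs one unit of time. -/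

/-- Tests. Arguments are names of registers. -/
inductive Test : Type
  /-- word register `x` is smaller than word register `y` -/
  | less (x y : ℕ)
  /-- weight register `a` is at most weight register `b` -/
  | weightLe (a b : ℕ)
  /-- the points with the indices in `x`, `y` are at distance at most the radius -/
  | near (x y : ℕ)
  /-- the points with the indices in `x`, `y` are at most as far apart as those with the indices
  in `x'`, `y'` -/
  | closer (x y x' y' : ℕ)

/-- Programs. `x y z i` name word registers, `a b c` weight registers, `A` an array. -/
inductive Prog : Type
  /-- `x := m` -/
  | const (x m : ℕ)
  /-- `x := y` -/
  | copy (x y : ℕ)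
  /-- `x := y + z` -/
  | plus (x y z : ℕ)
  /-- `x := A[i]` -/
  | load (x A i : ℕ)
  /-- `A[i] := x` -/
  | store (A i x : ℕ)
  /-- `a := 0` -/
  | wzero (a : ℕ)
  /-- `a := +∞` -/
  | winfty (a : ℕ)
  /-- `a := b` -/
  | wcopy (a b : ℕ)
  /-- `a := b + c` -/
  | wplus (a b c : ℕ)
  /-- `a := A[i]` for a weight array `A` -/
  | wload (a A i : ℕ)
  /-- `A[i] := a` for a weight array `A` -/
  | wstore (A i a : ℕ)
  /-- `P; Q` -/
  | seq (P Q : Prog)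
  /-- `if t then P else Q` -/
  | cond (t : Test) (P Q : Prog)
  /-- `while t do P` -/
  | loop (t : Test) (P : Prog)

/-- Memory contents. -/
structure State : Type where
  /-- word registers -/
  reg : ℕ → ℕ
  /-- word arrays: array name, index -/
  arr : ℕ → ℕ → ℕ
  /-- weight registers -/
  wreg : ℕ → ℝ≥0∞
  /-- weight arrays: array name, index -/
  warr : ℕ → ℕ → ℝ≥0∞

/-- Truth of a test; a geometric test with an index out of range is false. -/
def Test.Holds {n : ℕ} (p : Fin n → Plane) (r : ℝ) (s : State) : Test → Prop
  | less x y => s.reg x < s.reg y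
  | weightLe a b => s.wreg a ≤ s.wreg b
  | near x y => ∃ v u : Fin n, s.reg x = v ∧ s.reg y = u ∧ dist (p v) (p u) ≤ r
  | closer x y x' y' => ∃ v u v' u' : Fin n, s.reg x = v ∧ s.reg y = u ∧
      s.reg x' = v' ∧ s.reg y' = u' ∧ dist (p v) (p u) ≤ dist (p v') (p u')

/-- `s` with word register `x` set to `m`. -/
def State.setReg (s : State) (x m : ℕ) : State :=
  { s with reg := Function.update s.reg x m }

/-- `s` with cell `i` of word array `A` set to `m`. -/
def State.setArr (s : State) (A i m : ℕ) : State :=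
  { s with arr := Function.update s.arr A (Function.update (s.arr A) i m) }

/-- `s` with weight register `a` set to `d`. -/
def State.setWReg (s : State) (a : ℕ) (d : ℝ≥0∞) : State :=
  { s with wreg := Function.update s.wreg a d }

/-- `s` with cell `i` of weight array `A` set to `d`. -/
def State.setWArr (s : State) (A i : ℕ) (d : ℝ≥0∞) : State :=
  { s with warr := Function.update s.warr A (Function.update (s.warr A) i d) }

/-- `Exec p r W P s T s'`: with words below `W`, on the input points `p` and radius `r`, the
program `P` started in the memory state `s` halts after exactly `T` steps in the state `s'`.
A word operation whose result is not below `W` has no execution. -/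
inductive Exec {n : ℕ} (p : Fin n → Plane) (r : ℝ) (W : ℕ) :
    Prog → State → ℕ → State → Prop
  | const (s : State) (x m : ℕ) (h : m < W) :
      Exec p r W (.const x m) s 1 (s.setReg x m)
  | copy (s : State) (x y : ℕ) :
      Exec p r W (.copy x y) s 1 (s.setReg x (s.reg y))
  | plus (s : State) (x y z : ℕ) (h : s.reg y + s.reg z < W) :
      Exec p r W (.plus x y z) s 1 (s.setReg x (s.reg y + s.reg z))
  | load (s : State) (x A i : ℕ) :
      Exec p r W (.load x A i) s 1 (s.setReg x (s.arr A (s.reg i)))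
  | store (s : State) (A i x : ℕ) :
      Exec p r W (.store A i x) s 1 (s.setArr A (s.reg i) (s.reg x))
  | wzero (s : State) (a : ℕ) :
      Exec p r W (.wzero a) s 1 (s.setWReg a 0)
  | winfty (s : State) (a : ℕ) :
      Exec p r W (.winfty a) s 1 (s.setWReg a ⊤)
  | wcopy (s : State) (a b : ℕ) :
      Exec p r W (.wcopy a b) s 1 (s.setWReg a (s.wreg b))
  | wplus (s : State) (a b c : ℕ) :
      Exec p r W (.wplus a b c) s 1 (s.setWReg a (s.wreg b + s.wreg c))
  | wload (s : State) (a A i : ℕ) :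
      Exec p r W (.wload a A i) s 1 (s.setWReg a (s.warr A (s.reg i)))
  | wstore (s : State) (A i a : ℕ) :
      Exec p r W (.wstore A i a) s 1 (s.setWArr A (s.reg i) (s.wreg a))
  | seq {P Q : Prog} {s s₁ s₂ : State} {T₁ T₂ : ℕ}
      (h₁ : Exec p r W P s T₁ s₁) (h₂ : Exec p r W Q s₁ T₂ s₂) :
      Exec p r W (.seq P Q) s (T₁ + T₂) s₂
  | condTrue {t : Test} {P Q : Prog} {s s₁ : State} {T : ℕ}
      (ht : t.Holds p r s) (h : Exec p r W P s T s₁) :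
      Exec p r W (.cond t P Q) s (T + 1) s₁
  | condFalse {t : Test} {P Q : Prog} {s s₁ : State} {T : ℕ}
      (ht : ¬ t.Holds p r s) (h : Exec p r W Q s T s₁) :
      Exec p r W (.cond t P Q) s (T + 1) s₁
  | loopDone {t : Test} {P : Prog} {s : State} (ht : ¬ t.Holds p r s) :
      Exec p r W (.loop t P) s 1 s
  | loopStep {t : Test} {P : Prog} {s s₁ s₂ : State} {T₁ T₂ : ℕ}
      (ht : t.Holds p r s) (h₁ : Exec p r W P s T₁ s₁)
      (h₂ : Exec p r W (.loop t P) s₁ T₂ s₂) :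
      Exec p r W (.loop t P) s (T₁ + T₂ + 1) s₂

/-- Initial memory: `n` in word register `0`, the vertex weights in weight array `0`, and zeros
everywhere else. -/
def initState {n : ℕ} (w : Fin n → ℝ≥0) : State where
  reg x := if x = 0 then n else 0
  arr _ _ := 0
  wreg _ := 0
  warr A i := if h : A = 0 ∧ i < n then (w ⟨i, h.2⟩ : ℝ≥0∞) else 0

/-- The memory state `s` holds a solution of the all-pairs shortest paths problem for `G`, `w`:
weight array `1` is the distance matrix (row by row), and word array `1` is a successor matrix
representing shortest paths, i.e. for distinct `v`, `u` with a path between them, going from each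
vertex `x` to the vertex stored in entry `(x, u)` leads from `v` to `u` along a shortest path. -/
def SolvesAPSP {n : ℕ} (G : SimpleGraph (Fin n)) (w : Fin n → ℝ≥0) (s : State) : Prop :=
  (∀ v u : Fin n, s.warr 1 ((v : ℕ) * n + u) = vdist G w v u) ∧
  ∀ v u : Fin n, v ≠ u → G.Reachable v u →
    ∃ q : G.Path v u, (walkWeight w q.1 : ℝ≥0∞) = vdist G w v u ∧
      ∀ d ∈ q.1.darts, s.arr 1 ((d.fst : ℕ) * n + u) = d.snd

end DiskAPSP

end

/-! The graph has a sparse representation, and with vertex weights a search in it is cheap.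

Arrange the points in a greedy order π, each followed by the nearest of those not yet listed, and
put a complete binary tree over the positions. Read along π, the closed neighbourhood of a vertex is
a union of runs, hence the union of the leaf sets of the topmost tree nodes that it fills. Their
number is logarithmic per end of a run (`canonCount_le_crossings`). Each leaf gets an arc to each of
its topmost nodes; internal nodes have weight zero and arcs to their children. Shortest paths
between leaves of input points then cost the same as in the disk graph.

Summed over all vertices, the ends of runs are counted by the points close to exactly one of π m and
π (m + 1), for all m (`NearestOrder.sum_crossings_le`). If these two points are at distance d, such
points lie near the circle of radius r, in an area O(r (d + 1/√n)), so by density there are O(b n r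
(d + 1/√n)) of them (`IsDense.card_flips_le`). The distances d add up to O(√n): steps of length at
least j/√n start at points that are pairwise that far apart, so there are O(n/j²) of them, and the
sum of 1/j² converges (`NearestOrder.card_long_steps_le`, `NearestOrder.sum_stepLength_le`). Hence
the total Y of these counts is O(b r n^(3/2)), and Y ≤ n² trivially.

Entering a node costs its weight whatever the tail of the arc. Since tails are processed by
nondecreasing distance, the first distance given to a node is final (`SearchInv.skip`,
`SearchInv.discover`): every node enters the priority queue once and every arc takes constant time
otherwise. Searches from all points cost O(n (n + Y) log n), and Y is at most the geometric mean of
its two bounds (`geometric_mean_bound`), which gives n^2.75 √(r b) up to a logarithm.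

The programs are verified by a weakest-precondition calculus. Loop rules carry an invariant and pay
for the running time out of a potential or round by round; frames take care of all memory that a
program does not write. -/

namespace DiskAPSP

/-! ### Symbolic execution of programs -/

section Machine

variable {n : ℕ} {p : Fin n → Plane} {r : ℝ} {W : ℕ}

/-- `P`, started in `s`, halts after some number `T` of steps in some state `s'` with `Q T s'`. -/
def WP (p : Fin n → Plane) (r : ℝ) (W : ℕ) (P : Prog) (s : State) (Q : ℕ → State → Prop) : Prop :=
  ∃ T s', Exec p r W P s T s' ∧ Q T s'

variable {s : State} {Q : ℕ → State → Prop}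

theorem WP.mono {P : Prog} {Q' : ℕ → State → Prop} (h : WP p r W P s Q)
    (hQ : ∀ T s', Q T s' → Q' T s') : WP p r W P s Q' := by
  obtain ⟨T, s', h₁, h₂⟩ := h
  exact ⟨T, s', h₁, hQ _ _ h₂⟩

/-- Inversion of `Exec` leaves a single case per instruction, so the rules are equivalences and can
serve as rewrite rules that execute straight-line code. Only constants and sums carry a side
condition, namely that the word does not overflow. -/
theorem wp_const {x m : ℕ} :
    WP p r W (.const x m) s Q ↔ m < W ∧ Q 1 (s.setReg x m) := by
  constructor
  · rintro ⟨T, s', h, hQ⟩; cases h; exact ⟨by assumption, hQ⟩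
  · rintro ⟨h, hQ⟩; exact ⟨_, _, .const _ _ _ h, hQ⟩

theorem wp_copy {x y : ℕ} :
    WP p r W (.copy x y) s Q ↔ Q 1 (s.setReg x (s.reg y)) := by
  constructor
  · rintro ⟨T, s', h, hQ⟩; cases h; exact hQ
  · intro hQ; exact ⟨_, _, .copy _ _ _, hQ⟩

theorem wp_plus {x y z : ℕ} :
    WP p r W (.plus x y z) s Q ↔
      s.reg y + s.reg z < W ∧ Q 1 (s.setReg x (s.reg y + s.reg z)) := by
  constructor
  · rintro ⟨T, s', h, hQ⟩; cases h; exact ⟨by assumption, hQ⟩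
  · rintro ⟨h, hQ⟩; exact ⟨_, _, .plus _ _ _ _ h, hQ⟩

theorem wp_load {x A i : ℕ} :
    WP p r W (.load x A i) s Q ↔ Q 1 (s.setReg x (s.arr A (s.reg i))) := by
  constructor
  · rintro ⟨T, s', h, hQ⟩; cases h; exact hQ
  · intro hQ; exact ⟨_, _, .load _ _ _ _, hQ⟩

theorem wp_store {A i x : ℕ} :
    WP p r W (.store A i x) s Q ↔ Q 1 (s.setArr A (s.reg i) (s.reg x)) := by
  constructor
  · rintro ⟨T, s', h, hQ⟩; cases h; exact hQ
  · intro hQ; exact ⟨_, _, .store _ _ _ _, hQ⟩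

theorem wp_wzero {a : ℕ} : WP p r W (.wzero a) s Q ↔ Q 1 (s.setWReg a 0) := by
  constructor
  · rintro ⟨T, s', h, hQ⟩; cases h; exact hQ
  · intro hQ; exact ⟨_, _, .wzero _ _, hQ⟩

theorem wp_winfty {a : ℕ} : WP p r W (.winfty a) s Q ↔ Q 1 (s.setWReg a ⊤) := by
  constructor
  · rintro ⟨T, s', h, hQ⟩; cases h; exact hQ
  · intro hQ; exact ⟨_, _, .winfty _ _, hQ⟩

theorem wp_wplus {a b c : ℕ} :
    WP p r W (.wplus a b c) s Q ↔ Q 1 (s.setWReg a (s.wreg b + s.wreg c)) := by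
  constructor
  · rintro ⟨T, s', h, hQ⟩; cases h; exact hQ
  · intro hQ; exact ⟨_, _, .wplus _ _ _ _, hQ⟩

theorem wp_wload {a A i : ℕ} :
    WP p r W (.wload a A i) s Q ↔ Q 1 (s.setWReg a (s.warr A (s.reg i))) := by
  constructor
  · rintro ⟨T, s', h, hQ⟩; cases h; exact hQ
  · intro hQ; exact ⟨_, _, .wload _ _ _ _, hQ⟩

theorem wp_wstore {A i a : ℕ} :
    WP p r W (.wstore A i a) s Q ↔ Q 1 (s.setWArr A (s.reg i) (s.wreg a)) := by
  constructor
  · rintro ⟨T, s', h, hQ⟩; cases h; exact hQ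
  · intro hQ; exact ⟨_, _, .wstore _ _ _ _, hQ⟩

theorem wp_seq {P P' : Prog} :
    WP p r W (.seq P P') s Q ↔
      WP p r W P s fun T s₁ => WP p r W P' s₁ fun T' s₂ => Q (T + T') s₂ := by
  constructor
  · rintro ⟨T, s', h, hQ⟩
    cases h with
    | seq h₁ h₂ => exact ⟨_, _, h₁, _, _, h₂, hQ⟩
  · rintro ⟨T, s', h₁, T', s₂, h₂, hQ⟩; exact ⟨_, _, .seq h₁ h₂, hQ⟩

theorem wp_cond {t : Test} {P P' : Prog} :
    WP p r W (.cond t P P') s Q ↔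
      (t.Holds p r s → WP p r W P s fun T s' => Q (T + 1) s') ∧
      (¬ t.Holds p r s → WP p r W P' s fun T s' => Q (T + 1) s') := by
  constructor
  · rintro ⟨T, s', h, hQ⟩
    cases h with
    | condTrue ht h => exact ⟨fun _ => ⟨_, _, h, hQ⟩, fun h' => absurd ht h'⟩
    | condFalse ht h => exact ⟨fun h' => absurd h' ht, fun _ => ⟨_, _, h, hQ⟩⟩
  · rintro ⟨h₁, h₂⟩
    by_cases ht : t.Holds p r s
    · obtain ⟨T, s', h, hQ⟩ := h₁ ht
      exact ⟨_, _, .condTrue ht h, hQ⟩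
    · obtain ⟨T, s', h, hQ⟩ := h₂ ht
      exact ⟨_, _, .condFalse ht h, hQ⟩

/-! ### Reading updated states -/

variable (s)

@[simp] theorem setReg_reg (x m y : ℕ) :
    (s.setReg x m).reg y = if y = x then m else s.reg y := by
  simp [State.setReg, Function.update_apply]
@[simp] theorem setReg_arr (x m : ℕ) : (s.setReg x m).arr = s.arr := rfl
@[simp] theorem setReg_wreg (x m : ℕ) : (s.setReg x m).wreg = s.wreg := rfl
@[simp] theorem setReg_warr (x m : ℕ) : (s.setReg x m).warr = s.warr := rfl
@[simp] theorem setArr_reg (A i m : ℕ) : (s.setArr A i m).reg = s.reg := rfl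
@[simp] theorem setArr_arr (A i m B : ℕ) :
    (s.setArr A i m).arr B = if B = A then Function.update (s.arr A) i m else s.arr B := by
  simp [State.setArr, Function.update_apply]
@[simp] theorem setArr_wreg (A i m : ℕ) : (s.setArr A i m).wreg = s.wreg := rfl
@[simp] theorem setArr_warr (A i m : ℕ) : (s.setArr A i m).warr = s.warr := rfl
@[simp] theorem setWReg_reg (a : ℕ) (d : ℝ≥0∞) : (s.setWReg a d).reg = s.reg := rfl
@[simp] theorem setWReg_arr (a : ℕ) (d : ℝ≥0∞) : (s.setWReg a d).arr = s.arr := rfl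
@[simp] theorem setWReg_wreg (a : ℕ) (d : ℝ≥0∞) (b : ℕ) :
    (s.setWReg a d).wreg b = if b = a then d else s.wreg b := by
  simp [State.setWReg, Function.update_apply]
@[simp] theorem setWReg_warr (a : ℕ) (d : ℝ≥0∞) : (s.setWReg a d).warr = s.warr := rfl
@[simp] theorem setWArr_reg (A i : ℕ) (d : ℝ≥0∞) : (s.setWArr A i d).reg = s.reg := rfl
@[simp] theorem setWArr_arr (A i : ℕ) (d : ℝ≥0∞) : (s.setWArr A i d).arr = s.arr := rfl
@[simp] theorem setWArr_wreg (A i : ℕ) (d : ℝ≥0∞) : (s.setWArr A i d).wreg = s.wreg := rfl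
@[simp] theorem setWArr_warr (A i : ℕ) (d : ℝ≥0∞) (B : ℕ) :
    (s.setWArr A i d).warr B = if B = A then Function.update (s.warr A) i d else s.warr B := by
  simp [State.setWArr, Function.update_apply]

variable {s}

/-! ### Frames: what a program does not write stays as it is -/

/-- Does `P` write word register `x`? -/
def Prog.writesReg (x : ℕ) : Prog → Bool
  | const y _ | copy y _ | plus y _ _ | load y _ _ => x == y
  | seq P Q | cond _ P Q => P.writesReg x || Q.writesReg x
  | loop _ P => P.writesReg x
  | _ => false

/-- Does `P` write word array `A`? -/
def Prog.writesArr (A : ℕ) : Prog → Bool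
  | store B _ _ => A == B
  | seq P Q | cond _ P Q => P.writesArr A || Q.writesArr A
  | loop _ P => P.writesArr A
  | _ => false

/-- Does `P` write weight register `a`? -/
def Prog.writesWReg (a : ℕ) : Prog → Bool
  | wzero b | winfty b | wcopy b _ | wplus b _ _ | wload b _ _ => a == b
  | seq P Q | cond _ P Q => P.writesWReg a || Q.writesWReg a
  | loop _ P => P.writesWReg a
  | _ => false

/-- Does `P` write weight array `A`? -/
def Prog.writesWArr (A : ℕ) : Prog → Bool
  | wstore B _ _ => A == B
  | seq P Q | cond _ P Q => P.writesWArr A || Q.writesWArr A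
  | loop _ P => P.writesWArr A
  | _ => false

/-- `s'` agrees with `s` on everything that `P` does not write. -/
structure Frame (P : Prog) (s s' : State) : Prop where
  reg : ∀ x, P.writesReg x = false → s'.reg x = s.reg x
  arr : ∀ A, P.writesArr A = false → s'.arr A = s.arr A
  wreg : ∀ a, P.writesWReg a = false → s'.wreg a = s.wreg a
  warr : ∀ A, P.writesWArr A = false → s'.warr A = s.warr A

theorem Frame.refl (P : Prog) (s : State) : Frame P s s :=
  ⟨fun _ _ => rfl, fun _ _ => rfl, fun _ _ => rfl, fun _ _ => rfl⟩

theorem Frame.trans {P : Prog} {s s₁ s₂ : State} (h : Frame P s s₁) (h' : Frame P s₁ s₂) :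
    Frame P s s₂ :=
  ⟨fun x hx => (h'.reg x hx).trans (h.reg x hx), fun x hx => (h'.arr x hx).trans (h.arr x hx),
    fun x hx => (h'.wreg x hx).trans (h.wreg x hx), fun x hx => (h'.warr x hx).trans (h.warr x hx)⟩

/-- The write check is syntactic, so its instances are settled by `decide`, and loop invariants need
to mention only what the body changes. -/
theorem Exec.frame {P : Prog} {s s' : State} {T : ℕ} (h : Exec p r W P s T s') :
    Frame P s s' := by
  induction h with
  | seq _ _ ih₁ ih₂ =>
    constructor <;> intro x hx <;>
      simp only [Prog.writesReg, Prog.writesArr, Prog.writesWReg, Prog.writesWArr,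
        Bool.or_eq_false_iff] at hx
    · rw [ih₂.reg x hx.2, ih₁.reg x hx.1]
    · rw [ih₂.arr x hx.2, ih₁.arr x hx.1]
    · rw [ih₂.wreg x hx.2, ih₁.wreg x hx.1]
    · rw [ih₂.warr x hx.2, ih₁.warr x hx.1]
  | condTrue _ _ ih =>
    constructor <;> intro x hx <;>
      simp only [Prog.writesReg, Prog.writesArr, Prog.writesWReg, Prog.writesWArr,
        Bool.or_eq_false_iff] at hx
    exacts [ih.reg x hx.1, ih.arr x hx.1, ih.wreg x hx.1, ih.warr x hx.1]
  | condFalse _ _ ih =>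
    constructor <;> intro x hx <;>
      simp only [Prog.writesReg, Prog.writesArr, Prog.writesWReg, Prog.writesWArr,
        Bool.or_eq_false_iff] at hx
    exacts [ih.reg x hx.2, ih.arr x hx.2, ih.wreg x hx.2, ih.warr x hx.2]
  | loopDone => exact Frame.refl _ _
  | loopStep _ _ _ ih₁ ih₂ =>
    exact Frame.trans ⟨ih₁.reg, ih₁.arr, ih₁.wreg, ih₁.warr⟩ ih₂
  | _ =>
    constructor <;> intro x hx <;>
      simp_all [Prog.writesReg, Prog.writesArr, Prog.writesWReg, Prog.writesWArr]

theorem WP.frame {P : Prog} (h : WP p r W P s Q) :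
    WP p r W P s fun T s' => Q T s' ∧ Frame P s s' := by
  obtain ⟨T, s', h₁, h₂⟩ := h
  exact ⟨T, s', h₁, h₂, h₁.frame⟩

/-- Total correctness of loops, with a ghost state `a` and a potential `Φ` that pays for the time. -/
theorem wp_loop {α : Type*} (I : α → State → Prop) (Φ : α → ℕ) {t : Test} {P : Prog}
    {s₀ : State}
    (step : ∀ a s, I a s → Frame P s₀ s → t.Holds p r s →
      WP p r W P s fun T s' => ∃ a', I a' s' ∧ T + 1 + Φ a' ≤ Φ a)
    (a : α) (h₀ : I a s₀) :
    WP p r W (.loop t P) s₀ fun T s' =>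
      ∃ a', I a' s' ∧ ¬ t.Holds p r s' ∧ T + Φ a' ≤ Φ a + 1 ∧ Frame P s₀ s' := by
  -- Strong induction on the potential: the `+ 1` for the test makes it drop strictly in every
  -- round.
  suffices H : ∀ m a s, I a s → Frame P s₀ s → Φ a = m →
      WP p r W (.loop t P) s fun T s' =>
        ∃ a', I a' s' ∧ ¬ t.Holds p r s' ∧ T + Φ a' ≤ Φ a + 1 ∧ Frame P s₀ s' from
    H _ a s₀ h₀ (Frame.refl _ _) rfl
  intro m
  induction m using Nat.strong_induction_on with
  | _ m ih =>
    intro a s hI hf hm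
    by_cases ht : t.Holds p r s
    · obtain ⟨T, s', he, a', hI', hT⟩ := step a s hI hf ht
      obtain ⟨T', s'', he', a'', hI'', ht'', hT'', hf''⟩ :=
        ih (Φ a') (by omega) a' s' hI' (hf.trans he.frame) rfl
      exact ⟨_, _, .loopStep ht he he', a'', hI'', ht'', by omega, hf''⟩
    · exact ⟨_, _, .loopDone ht, a, hI, ht, by omega, hf⟩

/-- Counting loops: register `x` runs from `i₀` up to the content `m` of register `y`, and each round
costs at most `B` steps. -/
theorem wp_for {x y m i₀ B : ℕ} (I : ℕ → State → Prop) {P : Prog} {s₀ : State}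
    (hy : P.writesReg y = false) (hm : s₀.reg y = m) (hx : s₀.reg x = i₀) (hi : i₀ ≤ m)
    (step : ∀ i s, i₀ ≤ i → i < m → I i s → s.reg x = i → Frame P s₀ s →
      WP p r W P s fun T s' => I (i + 1) s' ∧ s'.reg x = i + 1 ∧ T ≤ B)
    (h₀ : I i₀ s₀) :
    WP p r W (.loop (.less x y) P) s₀ fun T s' =>
      I m s' ∧ s'.reg x = m ∧ T ≤ (m - i₀) * (B + 1) + 1 ∧ Frame P s₀ s' := by
  refine (wp_loop (fun i s => I i s ∧ s.reg x = i ∧ i₀ ≤ i ∧ i ≤ m)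
    (fun i => (m - i) * (B + 1)) ?_ i₀ ⟨h₀, hx, le_rfl, hi⟩).mono ?_
  · rintro i s ⟨hI, hxi, h₁, h₂⟩ hf ht
    have ht' : i < m := by
      simpa [Test.Holds, hxi, hf.reg y hy, hm] using ht
    refine (step i s h₁ ht' hI hxi hf).mono ?_
    rintro T s' ⟨hI', hx', hT⟩
    refine ⟨i + 1, ⟨hI', hx', by omega, ht'⟩, ?_⟩
    obtain ⟨d, rfl⟩ : ∃ d, m = i + 1 + d := ⟨m - (i + 1), by omega⟩
    have e₁ : i + 1 + d - i = d + 1 := by omega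
    have e₂ : i + 1 + d - (i + 1) = d := by omega
    rw [e₁, e₂, add_mul]
    omega
  · rintro T s' ⟨i, ⟨hI, hxi, h₁, h₂⟩, ht, hT, hf⟩
    have : i = m := by
      simp only [Test.Holds, hxi, hf.reg y hy, hm, not_lt] at ht
      omega
    subst this
    exact ⟨hI, hxi, by omega, hf⟩

attribute [simp] wp_const wp_copy wp_plus wp_load wp_store wp_wzero wp_winfty wp_wplus wp_wload wp_wstore
  wp_seq wp_cond Test.Holds

end Machine

/-! ### Sizes and tables -/

section Setup

variable {n : ℕ} {p : Fin n → Plane} {r : ℝ} {W : ℕ}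

/-- The registers `0`-`3` hold `n`, `1`, `N`, `2 N`. -/
structure Sized (n N : ℕ) (s : State) : Prop where
  reg0 : s.reg 0 = n
  reg1 : s.reg 1 = 1
  reg2 : s.reg 2 = N
  reg3 : s.reg 3 = 2 * N

theorem Sized.frame {N : ℕ} {s s' : State} {P : Prog} (h : Sized n N s) (hf : Frame P s s')
    (hP : ∀ x < 4, P.writesReg x = false) : Sized n N s' :=
  ⟨by rw [hf.reg 0 (hP 0 (by decide)), h.reg0], by rw [hf.reg 1 (hP 1 (by decide)), h.reg1],
    by rw [hf.reg 2 (hP 2 (by decide)), h.reg2], by rw [hf.reg 3 (hP 3 (by decide)), h.reg3]⟩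

/-- Computes the least power of two `N ≥ n`, and `2 N`. -/
def sizeProg : Prog :=
  .seq (.const 1 1) <| .seq (.copy 2 1) <|
  .seq (.loop (.less 2 0) (.plus 2 2 2)) (.plus 3 2 2)

theorem sizeProg_spec {s : State} (hn : 1 ≤ n) (hs : s.reg 0 = n) (hW : 4 * n + 4 ≤ W) :
    WP p r W sizeProg s fun T s' =>
      (∃ h, n ≤ 2 ^ h ∧ 2 ^ h < 2 * n ∧ Sized n (2 ^ h) s') ∧ T ≤ 4 * n + 4 := by
  unfold sizeProg
  simp only [wp_seq, wp_const, wp_copy]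
  refine ⟨by omega, ?_⟩
  -- A linear time bound is enough here, so the potential is the distance of 2 ^ i from 2 n rather
  -- than a logarithm.
  refine (wp_loop (fun i s => s.reg 2 = 2 ^ i ∧ 2 ^ i < 2 * n) (fun i => 2 * (2 * n - 2 ^ i))
    ?_ 0 ?_).mono ?_
  · rintro i s' ⟨h₁, h₂⟩ hf ht
    have h0 : s'.reg 0 = n := by rw [hf.reg 0 (by decide)]; simpa using hs
    simp only [Test.Holds, h0, h₁] at ht
    have := Nat.one_le_two_pow (n := i)
    simp only [wp_plus, h₁]
    refine ⟨by omega, i + 1, ?_, ?_⟩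
    · simp [pow_succ]; omega
    · rw [pow_succ]; omega
  · simp; omega
  · rintro T s' ⟨i, ⟨h₁, h₂⟩, ht, hT, hf⟩
    have h0 : s'.reg 0 = n := by rw [hf.reg 0 (by decide)]; simpa using hs
    have h1 : s'.reg 1 = 1 := by rw [hf.reg 1 (by decide)]; simp
    simp only [Test.Holds, h0, h₁, not_lt] at ht
    simp only [wp_plus, h₁]
    refine ⟨by omega, ⟨i, ht, h₂, ?_⟩, ?_⟩
    · constructor <;> simp [h0, h1, h₁]; omega
    · simp at hT; omega

/-- Tables of halves, predecessors, heap leaf labels and multiples of `n`, and the identity order. -/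
def tableProg : Prog :=
  .seq (.const 5 0) <| .seq (.const 6 0) <| .seq (.copy 7 3) <| .seq (.const 9 0) <|
  .loop (.less 5 3) <|
    .seq (.store 2 6 5) <| .seq (.plus 6 6 1) <| .seq (.store 2 6 5) <| .seq (.plus 6 6 1) <|
    .seq (.store 4 7 5) <| .seq (.plus 7 7 1) <| .seq (.store 5 5 5) <|
    .seq (.store 6 5 9) <| .seq (.plus 9 9 0) <|
    .seq (.copy 8 5) <| .seq (.plus 5 5 1) (.store 3 5 8)

/-- The content of the tables for halves, predecessors, heap leaf labels and multiples of `n`. -/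
structure Tables (n N : ℕ) (s : State) : Prop where
  half : ∀ k < 4 * N, s.arr 2 k = k / 2
  pred : ∀ k < 2 * N, s.arr 3 (k + 1) = k
  label : ∀ k < 2 * N, s.arr 4 (2 * N + k) = k
  mul : ∀ k < 2 * N, s.arr 6 k = k * n

theorem Tables.frame {N : ℕ} {s s' : State} {P : Prog} (h : Tables n N s) (hf : Frame P s s')
    (hP : P.writesArr 2 = false ∧ P.writesArr 3 = false ∧ P.writesArr 4 = false ∧
      P.writesArr 6 = false) : Tables n N s' :=
  ⟨by rw [hf.arr 2 hP.1]; exact h.half, by rw [hf.arr 3 hP.2.1]; exact h.pred,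
    by rw [hf.arr 4 hP.2.2.1]; exact h.label, by rw [hf.arr 6 hP.2.2.2]; exact h.mul⟩

/-- The machine cannot halve, decrement or multiply. One counting pass tabulates these maps, and
every later use is a single load. -/
theorem tableProg_spec {s : State} {N : ℕ} (hs : Sized n N s) (hN : N < 2 * n)
    (hW : 16 * (n * n) + 64 * n + 64 ≤ W) :
    WP p r W tableProg s fun T s' =>
      Tables n N s' ∧ (∀ k < 2 * N, s'.arr 5 k = k) ∧ T ≤ 26 * N + 5 := by
  unfold tableProg
  simp only [wp_seq, wp_const, wp_copy]
  refine ⟨by omega, by omega, by omega, ?_⟩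
  refine (wp_for (m := 2 * N) (i₀ := 0) (B := 12) (fun i s =>
    s.reg 6 = 2 * i ∧ s.reg 7 = 2 * N + i ∧ s.reg 9 = i * n ∧
    (∀ k < 2 * i, s.arr 2 k = k / 2) ∧ (∀ k < i, s.arr 3 (k + 1) = k) ∧
    (∀ k < i, s.arr 4 (2 * N + k) = k) ∧ (∀ k < i, s.arr 5 k = k) ∧
    (∀ k < i, s.arr 6 k = k * n)) (by decide) ?_ ?_ (by omega) ?_ ?_).mono ?_
  · simp [hs.reg3]
  · simp
  · rintro i s' - hi ⟨h6, h7, h9, a2, a3, a4, a5, a6⟩ h5 hf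
    have h0 : s'.reg 0 = n := by rw [hf.reg 0 (by decide)]; simpa using hs.reg0
    have h1 : s'.reg 1 = 1 := by rw [hf.reg 1 (by decide)]; simpa using hs.reg1
    -- The multiples of n are the largest words that occur in the tables.
    have : (i + 1) * n ≤ 4 * (n * n) := by nlinarith
    rw [add_mul] at this
    simp only [wp_seq, wp_store, wp_plus, wp_copy, h0, h1, h5, h6, h7, h9, setReg_reg, setReg_arr,
      setArr_reg, setArr_arr]
    norm_num [h0, h1, h5, h6, h7, h9]
    refine ⟨by omega, by omega, by omega, by omega, by omega, by omega, by omega, by ring, ?_, ?_,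
      ?_, ?_, ?_⟩
    · intro k hk
      simp only [Function.update_apply]
      split_ifs
      · omega
      · omega
      · exact a2 k (by omega)
    · intro k hk
      simp only [Function.update_apply]
      split_ifs
      · omega
      · exact a3 k (by omega)
    · intro k hk
      simp only [Function.update_apply]
      split_ifs
      · omega
      · exact a4 k (by omega)
    · intro k hk
      simp only [Function.update_apply]
      split_ifs
      · omega
      · exact a5 k (by omega)
    · intro k hk
      simp only [Function.update_apply]
      split_ifs with h
      · rw [h]
      · exact a6 k (by omega)
  · simp [hs.reg3]
  · rintro T s' ⟨⟨-, -, -, a2, a3, a4, a5, a6⟩, -, hT, -⟩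
    exact ⟨⟨fun k hk => a2 k (by omega), a3, a4, a6⟩, a5, by omega⟩

end Setup

/-! ### Nearest neighbour order -/

section Order

variable {n : ℕ} {p : Fin n → Plane} {r : ℝ} {W : ℕ}

/-- Distance between the input points with indices `a` and `b` (zero when out of range). -/
noncomputable def idist (p : Fin n → Plane) (a b : ℕ) : ℝ :=
  if h : a < n ∧ b < n then dist (p ⟨a, h.1⟩) (p ⟨b, h.2⟩) else 0

theorem holds_closer {s : State} {x y x' y' : ℕ} (hx : s.reg x < n) (hy : s.reg y < n)
    (hx' : s.reg x' < n) (hy' : s.reg y' < n) :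
    (Test.closer x y x' y').Holds p r s ↔
      idist p (s.reg x) (s.reg y) ≤ idist p (s.reg x') (s.reg y') := by
  simp only [Test.Holds, idist, hx, hy, hx', hy', and_self, dite_true]
  constructor
  · rintro ⟨v, u, v', u', h₁, h₂, h₃, h₄, h⟩
    simpa only [h₁, h₂, h₃, h₄] using h
  · intro h
    exact ⟨_, _, _, _, rfl, rfl, rfl, rfl, h⟩

/-- `π` lists `0, …, n - 1` so that each entry is followed by the nearest of the later ones; beyond
`n` it is the identity. -/
structure NearestOrder (p : Fin n → Plane) (N : ℕ) (π : ℕ → ℕ) : Prop where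
  lt : ∀ k < n, π k < n
  inj : ∀ j < n, ∀ k < n, π j = π k → j = k
  nearest : ∀ i j, i < j → j < n → idist p (π i) (π (i + 1)) ≤ idist p (π i) (π j)
  pad : ∀ k, n ≤ k → k < 2 * N → π k = k

/-- The nearest neighbour order during its computation: positions up to `i` are final, and position
`i + 1` holds the nearest of the entries in positions `i + 1, …, j - 1`. -/
structure PartialOrderUpTo (p : Fin n → Plane) (N i j : ℕ) (π : ℕ → ℕ) : Prop where
  lt : ∀ k < n, π k < n
  inj : ∀ j < n, ∀ k < n, π j = π k → j = k
  pad : ∀ k, n ≤ k → k < 2 * N → π k = k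
  nearest : ∀ a < i, ∀ b, a < b → b < n → idist p (π a) (π (a + 1)) ≤ idist p (π a) (π b)
  best : ∀ b, i < b → b < j → idist p (π i) (π (i + 1)) ≤ idist p (π i) (π b)

/-- What is known of a final position concerns the later entries only as a set, and exchanging two
positions beyond i permutes that set. The entry moved to i + 1 is nearer than the old minimum, hence
nearer than all entries examined before. -/
theorem PartialOrderUpTo.swap {N i j : ℕ} {π π' : ℕ → ℕ} (h : PartialOrderUpTo p N i j π)
    (hi : i + 1 ≤ j) (hj : j < n)
    (hlt : ¬ idist p (π i) (π (i + 1)) ≤ idist p (π i) (π j))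
    (hπ' : ∀ k, π' k = π (Equiv.swap (i + 1) j k)) : PartialOrderUpTo p N i (j + 1) π' := by
  have low : ∀ k ≤ i, π' k = π k := fun k hk => by
    rw [hπ', Equiv.swap_apply_of_ne_of_ne (by omega) (by omega)]
  have hsw : ∀ k, i < k → k < n → i < Equiv.swap (i + 1) j k ∧ Equiv.swap (i + 1) j k < n := by
    intro k hk hk'
    rw [Equiv.swap_apply_def]
    split_ifs <;> omega
  have hswlt : ∀ k < n, Equiv.swap (i + 1) j k < n := by
    intro k hk'
    rw [Equiv.swap_apply_def]
    split_ifs <;> omega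
  refine ⟨fun k hk => ?_, fun a ha b hb hab => ?_, fun k hk hk' => ?_, fun a ha b hab hb => ?_,
    fun b hb hb' => ?_⟩
  · rw [hπ']; exact h.lt _ (hswlt k hk)
  · rw [hπ', hπ'] at hab
    exact (Equiv.swap (i + 1) j).injective (h.inj _ (hswlt a ha) _ (hswlt b hb) hab)
  · rw [hπ', Equiv.swap_apply_of_ne_of_ne (by omega) (by omega)]
    exact h.pad k hk hk'
  · rw [low a (by omega), low (a + 1) (by omega)]
    by_cases hbi : b ≤ i
    · rw [low b hbi]; exact h.nearest a ha b hab hb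
    · rw [hπ']
      have := hsw b (by omega) hb
      exact h.nearest a ha _ (by omega) this.2
  · rw [low i le_rfl, hπ' (i + 1), hπ' b, Equiv.swap_apply_left]
    rw [not_le] at hlt
    rcases eq_or_ne b (i + 1) with rfl | hb1
    · rw [Equiv.swap_apply_left]
    rcases eq_or_ne b j with rfl | hbj
    · rw [Equiv.swap_apply_right]; exact hlt.le
    · rw [Equiv.swap_apply_of_ne_of_ne hb1 hbj]
      exact hlt.le.trans (h.best b hb (by omega))

/-- Rearranges word array `5`, initially the identity, into a nearest neighbour order. -/
def orderProg : Prog :=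
  .seq (.const 5 0) <| .loop (.less 5 0) <|
    .seq (.load 6 5 5) <| .seq (.plus 7 5 1) <| .seq (.copy 8 7) <|
    .seq (.loop (.less 8 0) <|
      .seq (.load 9 5 7) <| .seq (.load 10 5 8) <|
      .seq (.cond (.closer 6 9 6 10) (.copy 8 8) (.seq (.store 5 7 10) (.store 5 8 9)))
        (.plus 8 8 1))
    (.copy 5 7)

/-- Selecting each successor by a scan takes quadratic time, which is dominated by the searches. -/
theorem orderProg_spec {s : State} {N : ℕ} (hs : Sized n N s) (hid : ∀ k < 2 * N, s.arr 5 k = k)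
    (hnN : n ≤ N) (hW : 4 * n + 4 ≤ W) :
    WP p r W orderProg s fun T s' =>
      NearestOrder p N (s'.arr 5) ∧ T ≤ n * (8 * n + 6) + 2 := by
  unfold orderProg
  simp only [wp_seq, wp_const]
  refine ⟨by omega, ?_⟩
  refine (wp_for (m := n) (i₀ := 0) (B := 8 * n + 5) (fun i s =>
    PartialOrderUpTo p N i 0 (s.arr 5)) (by decide) ?_ ?_ (by omega) ?_ ?_).mono ?_
  · simp [hs.reg0]
  · simp
  · rintro i s' - hi hI h5 hf
    have h0 : s'.reg 0 = n := by rw [hf.reg 0 (by decide)]; simpa using hs.reg0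
    have h1 : s'.reg 1 = 1 := by rw [hf.reg 1 (by decide)]; simpa using hs.reg1
    simp only [wp_seq, wp_load, wp_plus, wp_copy]
    norm_num [h1, h5]
    refine ⟨by omega, ?_⟩
    refine (wp_for (m := n) (i₀ := i + 1) (B := 6) (fun j s =>
      PartialOrderUpTo p N i j (s.arr 5) ∧ s.reg 6 = s.arr 5 i) (by decide) ?_ ?_ (by omega)
      ?_ ?_).mono ?_
    · simp [h0]
    · simp
    · rintro j s₂ hj₁ hj ⟨hJ, h6⟩ h8 hf₂
      have h1' : s₂.reg 1 = 1 := by rw [hf₂.reg 1 (by decide)]; simpa using h1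
      have h7' : s₂.reg 7 = i + 1 := by rw [hf₂.reg 7 (by decide)]; simp
      simp only [wp_seq, wp_load, wp_cond]
      rw [holds_closer]
      rotate_left
      · simpa [h6] using hJ.lt i hi
      · simpa [h7'] using hJ.lt (i + 1) (by omega)
      · simpa [h6] using hJ.lt i hi
      · simpa [h8] using hJ.lt j (by omega)
      norm_num [h1', h8, h7', h6]
      refine ⟨fun hle => ⟨by omega, ?_⟩, fun hlt => ⟨by omega, ?_, ?_⟩⟩
      · refine ⟨hJ.lt, hJ.inj, hJ.pad, hJ.nearest, fun b hb hb' => ?_⟩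
        rcases Nat.lt_succ_iff_lt_or_eq.1 hb' with h | rfl
        · exact hJ.best b hb h
        · exact hle
      · refine hJ.swap hj₁ hj (not_le.2 hlt) fun k => ?_
        simp only [Function.update_apply, Equiv.swap_apply_def]
        split_ifs <;> simp_all
      · rw [Function.update_of_ne (by omega), Function.update_of_ne (by omega)]
    · refine ⟨?_, by simp⟩
      simp only [setReg_arr]
      exact ⟨hI.lt, hI.inj, hI.pad, hI.nearest, fun b hb hb' => by omega⟩
    · rintro T s₃ ⟨⟨hJ, -⟩, -, hT, hf₃⟩
      have h7' : s₃.reg 7 = i + 1 := by rw [hf₃.reg 7 (by decide)]; simp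
      refine ⟨⟨hJ.lt, hJ.inj, hJ.pad, fun a ha b hab hb => ?_, fun b _ hb => by omega⟩, h7', ?_⟩
      · rcases Nat.lt_succ_iff_lt_or_eq.1 ha with h | rfl
        · exact hJ.nearest a h b hab hb
        · exact hJ.best b hab hb
      · have : (n - (i + 1)) * (6 + 1) ≤ n * 7 := by gcongr <;> omega
        omega
  · refine ⟨fun k hk => ?_, fun j hj k hk h => ?_, fun k _ hk => ?_, fun a ha => by omega,
      fun b _ hb => by omega⟩
    · simp only [setReg_arr]; rw [hid k (by omega)]; exact hk
    · simp only [setReg_arr] at h; rwa [hid j (by omega), hid k (by omega)] at h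
    · simp only [setReg_arr]; exact hid k hk
  · rintro T s' ⟨hI, -, hT, -⟩
    refine ⟨⟨hI.lt, hI.inj, fun i j hij hj => hI.nearest i (by omega) j hij hj, hI.pad⟩, ?_⟩
    have : (n - 0) * (8 * n + 5 + 1) = n * (8 * n + 6) := by simp
    omega

end Order

/-! ### Canonical nodes of a complete binary tree

The nodes of the tree with `N` leaves are `1, …, 2 N - 1`; the children of `j < N` are `2 j` and
`2 j + 1`, and the leaves are `N + k`, `k < N`. -/

section Tree

/-- All leaves below the node `j` satisfy `f`. -/
def Full (N : ℕ) (f : ℕ → Prop) (j : ℕ) : Prop :=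
  j ≠ 0 ∧ ∀ i k, k < N → (N + k) / 2 ^ i = j → f k

/-- `j` is a topmost node all of whose leaves satisfy `f`. -/
def Canon (N : ℕ) (f : ℕ → Prop) (j : ℕ) : Prop :=
  Full N f j ∧ ¬ Full N f (j / 2)

open Classical in
/-- The number of canonical nodes below `j`. -/
noncomputable def canonCount (N : ℕ) (f : ℕ → Prop) (j : ℕ) : ℕ :=
  ((Finset.range j).filter (Canon N f)).card

variable {N : ℕ} {f : ℕ → Prop}

/-- Node 0 plays the parent of the root. As it is never full, the root is canonical whenever it is
full, without a special case. -/
theorem not_full_zero : ¬ Full N f 0 := fun h => h.1 rfl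

theorem full_leaf {k : ℕ} (hk : k < N) : Full N f (N + k) ↔ f k := by
  constructor
  · intro h
    exact h.2 0 k hk (by simp)
  · intro h
    refine ⟨by omega, fun i k' hk' he => ?_⟩
    rcases i with _ | i
    · have : k' = k := by simpa using he
      exact this ▸ h
    · have : (N + k') / 2 ^ (i + 1) ≤ (N + k') / 2 := by
        rw [pow_succ']
        exact Nat.div_le_div_left (Nat.le_mul_of_pos_right _ (by positivity)) (by omega)
      omega

/-- A leaf below an internal node passes through one of its children, because ancestors arise by
repeated halving. This is what allows marks to be computed upwards. -/
theorem full_node {j : ℕ} (hj : 1 ≤ j) (hjN : j < N) :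
    Full N f j ↔ Full N f (2 * j) ∧ Full N f (2 * j + 1) := by
  constructor
  · intro h
    refine ⟨⟨by omega, fun i k hk he => h.2 (i + 1) k hk ?_⟩,
      ⟨by omega, fun i k hk he => h.2 (i + 1) k hk ?_⟩⟩ <;>
    · rw [pow_succ, ← Nat.div_div_eq_div_mul, he]
      omega
  · rintro ⟨h₁, h₂⟩
    refine ⟨by omega, fun i k hk he => ?_⟩
    rcases i with _ | i
    · simp at he; omega
    · rw [pow_succ, ← Nat.div_div_eq_div_mul] at he
      have : (N + k) / 2 ^ i = 2 * j ∨ (N + k) / 2 ^ i = 2 * j + 1 := by omega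
      exact this.elim (h₁.2 i k hk) (h₂.2 i k hk)

open Classical in
theorem canonCount_succ_of_canon {j : ℕ} (h : Canon N f j) :
    canonCount N f (j + 1) = canonCount N f j + 1 := by
  rw [canonCount, Finset.range_add_one, Finset.filter_insert, if_pos h, Finset.card_insert_of_notMem]
  · rfl
  · simp

open Classical in
theorem canonCount_succ_of_not_canon {j : ℕ} (h : ¬ Canon N f j) :
    canonCount N f (j + 1) = canonCount N f j := by
  rw [canonCount, Finset.range_add_one, Finset.filter_insert, if_neg h]
  rfl

open Classical in
theorem canonCount_le (j : ℕ) : canonCount N f j ≤ j := by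
  rw [canonCount]
  exact (Finset.card_filter_le _ _).trans (by simp)

theorem canonCount_one : canonCount N f 1 = 0 := by
  rw [canonCount_succ_of_not_canon (fun h => not_full_zero h.1)]
  simp [canonCount]

end Tree

/-! ### Building the sparse graph -/

section Graph

variable {n : ℕ} {p : Fin n → Plane} {r : ℝ} {W : ℕ}

/-- `a` and `b` are indices of input points at distance at most `r`. -/
def nearIdx (p : Fin n → Plane) (r : ℝ) (a b : ℕ) : Prop :=
  ∃ v u : Fin n, a = v ∧ b = u ∧ dist (p v) (p u) ≤ r

/-- Vertices and weights of the leaves of the tree. -/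
def leafProg : Prog :=
  .seq (.const 5 0) <| .loop (.less 5 2) <|
    .seq (.plus 6 2 5) <| .seq (.load 7 5 5) <| .seq (.store 7 6 7) <| .seq (.wload 3 0 7) <|
    .seq (.wstore 2 6 3) (.plus 5 5 1)

/-- Word array `7` holds the vertices of the leaves and weight array `2` the weights of the nodes,
internal nodes having weight zero; `ω` is the weight of the vertices. -/
structure Leaves (N : ℕ) (ω : ℕ → ℝ≥0∞) (π : ℕ → ℕ) (s : State) : Prop where
  vertex : ∀ k < N, s.arr 7 (N + k) = π k
  weight : ∀ k < N, s.warr 2 (N + k) = ω (π k)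
  weight_internal : ∀ x < N, s.warr 2 x = 0

theorem Leaves.frame {N : ℕ} {ω : ℕ → ℝ≥0∞} {π : ℕ → ℕ} {s s' : State} {P : Prog}
    (h : Leaves N ω π s) (hf : Frame P s s') (hP : P.writesArr 7 = false ∧ P.writesWArr 2 = false) :
    Leaves N ω π s' :=
  ⟨by rw [hf.arr 7 hP.1]; exact h.vertex, by rw [hf.warr 2 hP.2]; exact h.weight,
    by rw [hf.warr 2 hP.2]; exact h.weight_internal⟩

theorem leafProg_spec {s : State} {N : ℕ} (hs : Sized n N s) (hN : N < 2 * n)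
    (h2 : ∀ x, s.warr 2 x = 0) (hW : 8 * n + 8 ≤ W) :
    WP p r W leafProg s fun T s' => Leaves N (s.warr 0) (s.arr 5) s' ∧ T ≤ 7 * N + 2 := by
  unfold leafProg
  simp only [wp_seq, wp_const]
  refine ⟨by omega, ?_⟩
  refine (wp_for (m := N) (i₀ := 0) (B := 6) (fun i s' =>
    (∀ k < i, s'.arr 7 (N + k) = s.arr 5 k) ∧ (∀ k < i, s'.warr 2 (N + k) = s.warr 0 (s.arr 5 k)) ∧
    (∀ x < N, s'.warr 2 x = 0)) (by decide) ?_ ?_ (by omega) ?_ ?_).mono ?_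
  · simp [hs.reg2]
  · simp
  · rintro i s' - hi ⟨a7, w2, w2'⟩ h5 hf
    have h1 : s'.reg 1 = 1 := by rw [hf.reg 1 (by decide)]; simpa using hs.reg1
    have h2 : s'.reg 2 = N := by rw [hf.reg 2 (by decide)]; simpa using hs.reg2
    have a5 : s'.arr 5 = s.arr 5 := by rw [hf.arr 5 (by decide)]; simp
    have w0 : s'.warr 0 = s.warr 0 := by rw [hf.warr 0 (by decide)]; simp
    norm_num [h1, h2, h5, a5, w0]
    refine ⟨by omega, by omega, ?_, ?_, ?_⟩
    · intro k hk
      simp only [Function.update_apply]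
      split_ifs with h
      · rw [show k = i by omega]
      · exact a7 k (by omega)
    · intro k hk
      simp only [Function.update_apply]
      split_ifs with h
      · rw [show k = i by omega]
      · exact w2 k (by omega)
    · intro x hx
      rw [Function.update_of_ne (by omega)]
      exact w2' x hx
  · simp [h2]
  · rintro T s' ⟨⟨a7, w2, w2'⟩, -, hT, -⟩
    exact ⟨⟨a7, w2, w2'⟩, by omega⟩

/-- Marks in word array `10` the leaves near to the vertex in register `6`. -/
def markLeavesProg : Prog :=
  .seq (.copy 7 2) <| .loop (.less 7 3) <|
    .seq (.load 8 7 7) <| .seq (.cond (.near 6 8) (.store 10 7 1) (.store 10 7 20)) (.plus 7 7 1)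

/-- Marks in word array `10` the internal nodes all of whose leaves are marked. -/
def markNodesProg : Prog :=
  .seq (.copy 7 2) <| .loop (.less 1 7) <|
    .seq (.load 7 3 7) <| .seq (.plus 8 7 7) <| .seq (.load 9 10 8) <| .seq (.plus 8 8 1) <|
    .seq (.load 11 10 8) (.cond (.less 9 1) (.store 10 7 9) (.store 10 7 11))

/-- Appends the topmost marked nodes to word array `9`. -/
def appendProg : Prog :=
  .seq (.copy 7 1) <| .loop (.less 7 3) <|
    .seq (.load 9 10 7) <| .seq (.load 8 2 7) <| .seq (.load 11 10 8) <|
    .seq (.cond (.less 11 9) (.seq (.store 9 10 7) (.plus 10 10 1)) (.copy 9 9)) (.plus 7 7 1)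

open Classical in
theorem markLeavesProg_spec {s : State} {N : ℕ} {ω : ℕ → ℝ≥0∞} {π : ℕ → ℕ} (hs : Sized n N s)
    (hl : Leaves N ω π s) (h20 : s.reg 20 = 0) (hN : N < 2 * n) (h10 : s.arr 10 0 = 0)
    (hN1 : 1 ≤ N) (hW : 8 * n + 8 ≤ W) :
    WP p r W markLeavesProg s fun T s' =>
      (s'.arr 10 0 = 0 ∧ ∀ k < N, s'.arr 10 (N + k) =
        if nearIdx p r (s.reg 6) (π k) then 1 else 0) ∧ T ≤ 5 * N + 2 := by
  unfold markLeavesProg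
  simp only [wp_seq, wp_copy]
  refine (wp_for (m := 2 * N) (i₀ := N) (B := 4) (fun i s' =>
    s'.arr 10 0 = 0 ∧ ∀ k, N + k < i → s'.arr 10 (N + k) =
      if nearIdx p r (s.reg 6) (π k) then 1 else 0) (by decide) ?_ ?_ (by omega) ?_ ?_).mono ?_
  · simp [hs.reg3]
  · simp [hs.reg2]
  · rintro i s' hi hi' ⟨b0, hI⟩ h7 hf
    have h1 : s'.reg 1 = 1 := by rw [hf.reg 1 (by decide)]; simpa using hs.reg1
    have h6 : s'.reg 6 = s.reg 6 := by rw [hf.reg 6 (by decide)]; simp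
    have h20 : s'.reg 20 = 0 := by rw [hf.reg 20 (by decide)]; simpa using h20
    obtain ⟨k, rfl⟩ : ∃ k, i = N + k := ⟨i - N, by omega⟩
    have a7 : s'.arr 7 (N + k) = π k := by
      rw [hf.arr 7 (by decide)]; simpa using hl.vertex k (by omega)
    simp only [wp_seq, wp_load, wp_cond]
    have hnear : (Test.near 6 8).Holds p r (s'.setReg 8 (s'.arr 7 (s'.reg 7))) ↔
        nearIdx p r (s.reg 6) (π k) := by
      simp [nearIdx, h6, h7, a7]
    rw [hnear]
    norm_num [h1, h7, h20]
    refine ⟨fun hf => ⟨by omega, ?_, ?_⟩, fun hf => ⟨by omega, ?_, ?_⟩⟩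
    · rw [Function.update_of_ne (by omega), b0]
    · intro k' hk'
      simp only [Function.update_apply]
      split_ifs with h₁ h₂ h₂
      · rfl
      · rw [show k' = k by omega] at h₂; exact absurd hf h₂
      · rw [hI k' (by omega), if_pos h₂]
      · rw [hI k' (by omega), if_neg h₂]
    · rw [Function.update_of_ne (by omega), b0]
    · intro k' hk'
      simp only [Function.update_apply]
      split_ifs with h₁ h₂ h₂
      · rw [show k' = k by omega] at h₂; exact absurd h₂ hf
      · rfl
      · rw [hI k' (by omega), if_pos h₂]
      · rw [hI k' (by omega), if_neg h₂]
  · refine ⟨by simpa using h10, fun k hk => by omega⟩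
  · rintro T s' ⟨⟨b0, hI⟩, -, hT, -⟩
    exact ⟨⟨b0, fun k hk => hI k (by omega)⟩, by omega⟩

open Classical in
theorem markNodesProg_spec {s : State} {N : ℕ} {f : ℕ → Prop} (hs : Sized n N s)
    (ht : Tables n N s) (hN : N < 2 * n) (hN1 : 1 ≤ N) (h10 : s.arr 10 0 = 0)
    (hl : ∀ k < N, s.arr 10 (N + k) = if f k then 1 else 0) (hW : 8 * n + 8 ≤ W) :
    WP p r W markNodesProg s fun T s' =>
      (∀ j < 2 * N, s'.arr 10 j = if Full N f j then 1 else 0) ∧ T ≤ 8 * N + 2 := by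
  unfold markNodesProg
  simp only [wp_seq, wp_copy]
  -- The nodes are visited in decreasing order, so both children of a node are marked before it; i
  -- is the last node done.
  refine (wp_loop (fun i s' => s'.reg 7 = i ∧ 1 ≤ i ∧ i ≤ N ∧ s'.arr 10 0 = 0 ∧
    ∀ j, i ≤ j → j < 2 * N → s'.arr 10 j = if Full N f j then 1 else 0)
    (fun i => 8 * i) ?_ N ?_).mono ?_
  · rintro i s' ⟨h7, hi, hi', h0, hI⟩ hf hlt
    have h1 : s'.reg 1 = 1 := by rw [hf.reg 1 (by decide)]; simpa using hs.reg1
    simp only [Test.Holds, h1, h7] at hlt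
    obtain ⟨i, rfl⟩ : ∃ m, i = m + 1 := ⟨i - 1, by omega⟩
    have a3 : s'.arr 3 (i + 1) = i := by
      rw [hf.arr 3 (by decide)]; simpa using ht.pred i (by omega)
    have e₁ := hI (2 * i) (by omega) (by omega)
    have e₂ := hI (2 * i + 1) (by omega) (by omega)
    have hnode := full_node (N := N) (f := f) (j := i) (by omega) (by omega)
    rw [two_mul] at e₁ e₂ hnode
    norm_num [h1, h7, a3, e₁, e₂]
    refine ⟨by omega, by omega, fun hc => ⟨i, ⟨rfl, by omega, by omega, ?_, ?_⟩, by omega⟩,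
      fun hc => ⟨i, ⟨rfl, by omega, by omega, ?_, ?_⟩, by omega⟩⟩
    · rw [Function.update_of_ne (by omega), h0]
    · intro j hj hj'
      rcases eq_or_ne j i with rfl | hne
      · simp [hnode, hc]
      · rw [Function.update_of_ne hne]; exact hI j (by omega) hj'
    · rw [Function.update_of_ne (by omega), h0]
    · intro j hj hj'
      rcases eq_or_ne j i with rfl | hne
      · rw [Function.update_self]
        have hc' : Full N f (j + j) := by
          by_contra h
          simp [h] at hc
        simp [hnode, hc']
      · rw [Function.update_of_ne hne]; exact hI j (by omega) hj'
  · refine ⟨by simp [hs.reg2], hN1, le_rfl, by simpa using h10, fun j hj hj' => ?_⟩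
    obtain ⟨k, rfl⟩ : ∃ k, j = N + k := ⟨j - N, by omega⟩
    simp only [setReg_arr]
    rw [hl k (by omega)]
    congr 1
    rw [full_leaf (by omega)]
  · rintro T s' ⟨i, ⟨h7, hi, hi', h0, hI⟩, hlt, hT, hf⟩
    have h1 : s'.reg 1 = 1 := by rw [hf.reg 1 (by decide)]; simpa using hs.reg1
    simp only [Test.Holds, h1, h7] at hlt
    refine ⟨fun j hj => ?_, by omega⟩
    rcases Nat.eq_zero_or_pos j with rfl | hj0
    · rw [h0, if_neg not_full_zero]
    · exact hI j (by omega) hj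

open Classical in
theorem appendProg_spec {s : State} {N : ℕ} {f : ℕ → Prop} (hs : Sized n N s)
    (ht : Tables n N s) (hN : N < 2 * n) (hN1 : 1 ≤ N)
    (hl : ∀ j < 2 * N, s.arr 10 j = if Full N f j then 1 else 0)
    (hW : s.reg 10 + 8 * n + 8 ≤ W) :
    WP p r W appendProg s fun T s' =>
      s'.reg 10 = s.reg 10 + canonCount N f (2 * N) ∧ (∀ e < s.reg 10, s'.arr 9 e = s.arr 9 e) ∧
      (∀ y, (∃ e, s.reg 10 ≤ e ∧ e < s'.reg 10 ∧ s'.arr 9 e = y) ↔ y < 2 * N ∧ Canon N f y) ∧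
      T ≤ 16 * N + 2 := by
  unfold appendProg
  simp only [wp_seq, wp_copy]
  refine (wp_for (m := 2 * N) (i₀ := 1) (B := 7) (fun i s' =>
    s'.reg 10 = s.reg 10 + canonCount N f i ∧ (∀ e < s.reg 10, s'.arr 9 e = s.arr 9 e) ∧
      (∀ y, (∃ e, s.reg 10 ≤ e ∧ e < s'.reg 10 ∧ s'.arr 9 e = y) ↔ y < i ∧ Canon N f y))
    (by decide) ?_ ?_ (by omega) ?_ ?_).mono ?_
  · simp [hs.reg3]
  · simp [hs.reg1]
  · rintro i s' hi hi' ⟨r10, hold, hI⟩ h7 hf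
    have h1 : s'.reg 1 = 1 := by rw [hf.reg 1 (by decide)]; simpa using hs.reg1
    have a2 : s'.arr 2 i = i / 2 := by
      rw [hf.arr 2 (by decide)]; simpa using ht.half i (by omega)
    have a10 : s'.arr 10 = s.arr 10 := by rw [hf.arr 10 (by decide)]; simp
    have e₁ := hl i (by omega)
    have e₂ := hl (i / 2) (by omega)
    have hcc := canonCount_le (N := N) (f := f) i
    -- With marks 0 and 1, being topmost is one comparison with the parent; cell 0 holds mark 0 and
    -- serves as the parent of the root.
    have htest : (s.arr 10 (i / 2) < s.arr 10 i) ↔ Canon N f i := by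
      rw [e₁, e₂, Canon]; split_ifs <;> simp_all
    norm_num [h1, h7, a2, a10, htest]
    refine ⟨fun hc => ⟨by omega, by omega, ?_, ?_, ?_⟩, fun hc => ⟨by omega, ?_, hold, ?_⟩⟩
    · rw [canonCount_succ_of_canon hc, r10]; ring
    · intro e he
      rw [Function.update_of_ne (by omega)]; exact hold e he
    · intro y
      constructor
      · rintro ⟨e, he, he', hy⟩
        rcases Nat.lt_or_eq_of_le he' with h | rfl
        · rw [Function.update_of_ne (by omega)] at hy
          have := (hI y).1 ⟨e, he, h, hy⟩
          exact ⟨by omega, this.2⟩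
        · rw [Function.update_self] at hy
          subst hy
          exact ⟨by omega, hc⟩
      · rintro ⟨hy, hcy⟩
        rcases Nat.lt_or_eq_of_le hy with h | rfl
        · obtain ⟨e, he, he', hy⟩ := (hI y).2 ⟨h, hcy⟩
          exact ⟨e, he, by omega, by rw [Function.update_of_ne (by omega)]; exact hy⟩
        · exact ⟨s'.reg 10, by omega, by omega, by rw [Function.update_self]⟩
    · rw [canonCount_succ_of_not_canon (by rwa [← htest, not_lt]), r10]
    · intro y
      rw [hI y]
      constructor
      · rintro ⟨h, h'⟩; exact ⟨by omega, h'⟩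
      · rintro ⟨h, h'⟩
        refine ⟨?_, h'⟩
        rcases Nat.lt_or_eq_of_le h with h | rfl
        · exact h
        · exact absurd (htest.2 h') (not_lt.2 hc)
  · refine ⟨by simp [canonCount_one], by simp, fun y => ?_⟩
    constructor
    · rintro ⟨e, he, he', -⟩
      simp at he'; omega
    · rintro ⟨hy, h⟩
      rw [show y = 0 by omega] at h
      exact absurd h.1 not_full_zero
  · rintro T s' ⟨⟨r10, hold, hI⟩, -, hT, -⟩
    exact ⟨r10, hold, hI, by omega⟩

end Graph

/-! ### Adjacency lists of the sparse graph -/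

section SparseGraph

variable {n : ℕ} {p : Fin n → Plane} {r : ℝ} {W : ℕ}

/-- Position of the first arc of node `x`, when internal nodes have two arcs and the leaf `N + k` has
`cnt k` arcs. -/
def firstArc (N : ℕ) (cnt : ℕ → ℕ) (x : ℕ) : ℕ :=
  2 * min x N + ∑ k ∈ Finset.range (x - N), cnt k

theorem firstArc_internal {N : ℕ} {cnt : ℕ → ℕ} {x : ℕ} (hx : x ≤ N) :
    firstArc N cnt x = 2 * x := by
  simp [firstArc, hx, Nat.sub_eq_zero_of_le hx]

theorem firstArc_leaf (N : ℕ) (cnt : ℕ → ℕ) (k : ℕ) :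
    firstArc N cnt (N + k) = 2 * N + ∑ k ∈ Finset.range k, cnt k := by
  simp [firstArc]

theorem firstArc_mono (N : ℕ) (cnt : ℕ → ℕ) : Monotone (firstArc N cnt) := by
  intro x y h
  unfold firstArc
  gcongr

/-- The property of being close to the `k`-th point of the order `π`, in terms of positions. -/
def closeTo (p : Fin n → Plane) (r : ℝ) (π : ℕ → ℕ) (k m : ℕ) : Prop :=
  nearIdx p r (π k) (π m)

/-- The number of arcs of the `k`-th leaf. -/
noncomputable def leafArcs (p : Fin n → Plane) (r : ℝ) (N : ℕ) (π : ℕ → ℕ) (k : ℕ) : ℕ :=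
  canonCount N (closeTo p r π k) (2 * N)

/-- Word arrays `8` and `9` hold the arcs of the sparse graph: from every node to its children, and
from every leaf to the topmost nodes all of whose leaves are close to it. -/
structure SparseGraph (p : Fin n → Plane) (r : ℝ) (N : ℕ) (π : ℕ → ℕ) (s : State) : Prop where
  first : ∀ x ≤ 2 * N, s.arr 8 x = firstArc N (leafArcs p r N π) x
  internal : ∀ e < 2 * N, s.arr 9 e = e
  leaf : ∀ k < N, ∀ y, (∃ e, firstArc N (leafArcs p r N π) (N + k) ≤ e ∧
    e < firstArc N (leafArcs p r N π) (N + k + 1) ∧ s.arr 9 e = y) ↔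
      y < 2 * N ∧ Canon N (closeTo p r π k) y

theorem SparseGraph.frame {N : ℕ} {π : ℕ → ℕ} {s s' : State} {P : Prog}
    (h : SparseGraph p r N π s) (hf : Frame P s s')
    (hP : P.writesArr 8 = false ∧ P.writesArr 9 = false) : SparseGraph p r N π s' :=
  ⟨by rw [hf.arr 8 hP.1]; exact h.first, by rw [hf.arr 9 hP.2]; exact h.internal,
    by rw [hf.arr 9 hP.2]; exact h.leaf⟩

/-- The arcs of the internal nodes. -/
def internalArcsProg : Prog :=
  .loop (.less 5 2) <|
    .seq (.store 8 5 10) <| .seq (.store 9 10 10) <| .seq (.plus 10 10 1) <|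
    .seq (.store 9 10 10) <| .seq (.plus 10 10 1) (.plus 5 5 1)

/-- The arcs of the leaves. -/
def leafArcsProg : Prog :=
  .loop (.less 5 3) <|
    .seq (.store 8 5 10) <| .seq (.load 6 7 5) <| .seq markLeavesProg <| .seq markNodesProg <|
    .seq appendProg (.plus 5 5 1)

/-- Builds the sparse graph. -/
def graphProg : Prog :=
  .seq (.const 5 0) <| .seq (.const 10 0) <| .seq (.const 20 0) <|
  .seq internalArcsProg <| .seq leafArcsProg (.store 8 5 10)

theorem internalArcsProg_spec {s : State} {N : ℕ} (hs : Sized n N s) (hN : N < 2 * n)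
    (h5 : s.reg 5 = 0) (h10 : s.reg 10 = 0) (hW : 8 * n + 8 ≤ W) :
    WP p r W internalArcsProg s fun T s' =>
      (∀ x < N, s'.arr 8 x = 2 * x) ∧ (∀ e < 2 * N, s'.arr 9 e = e) ∧ s'.reg 5 = N ∧
        s'.reg 10 = 2 * N ∧ T ≤ 7 * N + 1 := by
  unfold internalArcsProg
  refine (wp_for (m := N) (i₀ := 0) (B := 6) (fun i s' =>
    (∀ x < i, s'.arr 8 x = 2 * x) ∧ (∀ e < 2 * i, s'.arr 9 e = e) ∧ s'.reg 10 = 2 * i)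
    (by decide) hs.reg2 h5 (by omega) ?_ ?_).mono ?_
  · rintro i s' - hi ⟨a8, a9, r10⟩ h5 hf
    have h1 : s'.reg 1 = 1 := by rw [hf.reg 1 (by decide)]; simpa using hs.reg1
    norm_num [h1, h5, r10]
    refine ⟨by omega, by omega, by omega, ?_, ?_, by ring⟩
    · intro x hx
      simp only [Function.update_apply]
      split_ifs with h
      · rw [h]
      · exact a8 x (by omega)
    · intro e he
      simp only [Function.update_apply]
      split_ifs
      all_goals first | omega | exact a9 e (by omega)
  · simp [h10]
  · rintro T s' ⟨⟨a8, a9, r10⟩, h5, hT, -⟩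
    exact ⟨a8, a9, h5, r10, by omega⟩

theorem leafArcsProg_spec {s : State} {N : ℕ} {ω : ℕ → ℝ≥0∞} {π : ℕ → ℕ} (hs : Sized n N s)
    (ht : Tables n N s) (hl : Leaves N ω π s) (hN : N < 2 * n) (hN1 : 1 ≤ N)
    (h5 : s.reg 5 = N) (h10 : s.reg 10 = 2 * N) (h20 : s.reg 20 = 0) (ha10 : s.arr 10 0 = 0)
    (a8 : ∀ x < N, s.arr 8 x = 2 * x) (a9 : ∀ e < 2 * N, s.arr 9 e = e)
    (hW : 16 * (n * n) + 64 * n + 64 ≤ W) :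
    WP p r W leafArcsProg s fun T s' =>
      (∀ x < 2 * N, s'.arr 8 x = firstArc N (leafArcs p r N π) x) ∧
      (∀ e < 2 * N, s'.arr 9 e = e) ∧
      (∀ k < N, ∀ y, (∃ e, firstArc N (leafArcs p r N π) (N + k) ≤ e ∧
        e < firstArc N (leafArcs p r N π) (N + k + 1) ∧ s'.arr 9 e = y) ↔
          y < 2 * N ∧ Canon N (closeTo p r π k) y) ∧
      s'.reg 5 = 2 * N ∧ s'.reg 10 = firstArc N (leafArcs p r N π) (2 * N) ∧
      T ≤ N * (29 * N + 10) + 1 := by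
  unfold leafArcsProg
  refine (wp_for (m := 2 * N) (i₀ := N) (B := 29 * N + 9) (fun i s' =>
    (∀ x < i, s'.arr 8 x = firstArc N (leafArcs p r N π) x) ∧
    (∀ e < 2 * N, s'.arr 9 e = e) ∧
    (∀ k, N + k < i → ∀ y, (∃ e, firstArc N (leafArcs p r N π) (N + k) ≤ e ∧
      e < firstArc N (leafArcs p r N π) (N + k + 1) ∧ s'.arr 9 e = y) ↔
        y < 2 * N ∧ Canon N (closeTo p r π k) y) ∧
    s'.reg 10 = firstArc N (leafArcs p r N π) i ∧ s'.arr 10 0 = 0)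
    (by decide) hs.reg3 h5 (by omega) ?_ ?_).mono ?_
  · rintro i s₁ hi hi' ⟨b8, b9, bl, r10, b10⟩ h5 hf
    have hs₁ : Sized n N s₁ := hs.frame hf (by decide)
    have ht₁ : Tables n N s₁ := ht.frame hf (by decide)
    have hl₁ : Leaves N ω π s₁ := hl.frame hf (by decide)
    have h20₁ : s₁.reg 20 = 0 := by rw [hf.reg 20 (by decide)]; exact h20
    obtain ⟨k, rfl⟩ : ∃ k, i = N + k := ⟨i - N, by omega⟩
    have hk : k < N := by omega
    -- A leaf has at most 2 N arcs; this crude bound keeps arc positions within the range of words.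
    have hfirst : firstArc N (leafArcs p r N π) (N + k) ≤ 8 * (n * n) + 4 * n := by
      rw [firstArc_leaf]
      have : ∑ k ∈ Finset.range k, leafArcs p r N π k ≤ ∑ k ∈ Finset.range k, 2 * N :=
        Finset.sum_le_sum fun k _ => canonCount_le _
      rw [Finset.sum_const, Finset.card_range, smul_eq_mul] at this
      have : k * (2 * N) ≤ (2 * n) * (2 * (2 * n)) := by gcongr; omega
      nlinarith
    have hsucc : firstArc N (leafArcs p r N π) (N + k + 1) =
        firstArc N (leafArcs p r N π) (N + k) + leafArcs p r N π k := by
      rw [add_assoc, firstArc_leaf, firstArc_leaf, Finset.sum_range_succ, add_assoc]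
    simp only [wp_seq, wp_store, wp_load]
    set s₂ := (s₁.setArr 8 (s₁.reg 5) (s₁.reg 10)).setReg 6
      ((s₁.setArr 8 (s₁.reg 5) (s₁.reg 10)).arr 7 ((s₁.setArr 8 (s₁.reg 5) (s₁.reg 10)).reg 5))
      with hs₂
    have h6 : s₂.reg 6 = π k := by simp [hs₂, h5, hl₁.vertex k hk]
    refine (markLeavesProg_spec (s := s₂) (N := N) (ω := ω) (π := π) ?_ ?_ ?_ hN ?_ hN1
      (by omega)).frame.mono ?_
    · constructor <;> simp [hs₂, hs₁.reg0, hs₁.reg1, hs₁.reg2, hs₁.reg3]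
    · refine ⟨?_, ?_, ?_⟩
      · simpa [hs₂] using hl₁.vertex
      · simpa [hs₂] using hl₁.weight
      · simpa [hs₂] using hl₁.weight_internal
    · simp [hs₂, h20₁]
    · simp [hs₂, b10]
    rintro T₃ s₃ ⟨⟨⟨c0, c10⟩, hT₃⟩, hf₃⟩
    rw [h6] at c10
    have hs₃ : Sized n N s₃ := by
      refine Sized.frame ?_ hf₃ (by decide)
      constructor <;> simp [hs₂, hs₁.reg0, hs₁.reg1, hs₁.reg2, hs₁.reg3]
    have ht₃ : Tables n N s₃ := by
      refine Tables.frame ?_ hf₃ (by decide)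
      exact ⟨by simpa [hs₂] using ht₁.half, by simpa [hs₂] using ht₁.pred,
        by simpa [hs₂] using ht₁.label, by simpa [hs₂] using ht₁.mul⟩
    refine (markNodesProg_spec (s := s₃) (N := N) (f := closeTo p r π k) hs₃ ht₃ hN hN1 c0 c10
      (by omega)).frame.mono ?_
    rintro T₄ s₄ ⟨⟨d10, hT₄⟩, hf₄⟩
    have hs₄ := hs₃.frame hf₄ (by decide)
    have ht₄ := ht₃.frame hf₄ (by decide)
    have r10₄ : s₄.reg 10 = firstArc N (leafArcs p r N π) (N + k) := by
      rw [hf₄.reg 10 (by decide), hf₃.reg 10 (by decide)]; simpa [hs₂] using r10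
    refine (appendProg_spec (s := s₄) (N := N) (f := closeTo p r π k) hs₄ ht₄ hN hN1 d10
      (by omega)).frame.mono ?_
    rintro T₅ s₅ ⟨⟨r10₅, hold, hnew, hT₅⟩, hf₅⟩
    have hs₅ := hs₄.frame hf₅ (by decide)
    have a9₄ : s₄.arr 9 = s₁.arr 9 := by
      rw [hf₄.arr 9 (by decide), hf₃.arr 9 (by decide)]; simp [hs₂]
    have a8₅ : s₅.arr 8 = Function.update (s₁.arr 8) (N + k) (s₁.reg 10) := by
      rw [hf₅.arr 8 (by decide), hf₄.arr 8 (by decide), hf₃.arr 8 (by decide)]; simp [hs₂, h5]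
    have r5₅ : s₅.reg 5 = N + k := by
      rw [hf₅.reg 5 (by decide), hf₄.reg 5 (by decide), hf₃.reg 5 (by decide)]; simp [hs₂, h5]
    have a10₅ : s₅.arr 10 0 = 0 := by
      rw [hf₅.arr 10 (by decide), d10 0 (by omega), if_neg not_full_zero]
    rw [r10₄] at r10₅ hold hnew
    rw [a9₄] at hold
    have r10₅' : s₅.reg 10 = firstArc N (leafArcs p r N π) (N + k + 1) := by
      rw [r10₅, hsucc]; rfl
    have hge : 2 * N ≤ firstArc N (leafArcs p r N π) (N + k) := by
      rw [firstArc_leaf]; omega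
    simp only [wp_plus, r5₅, hs₅.reg1]
    refine ⟨by omega, ⟨?_, ?_, ?_, ?_, ?_⟩, ?_, ?_⟩
    · intro x hx
      simp only [setReg_arr, a8₅, Function.update_apply]
      split_ifs with h
      · rw [h, r10]
      · exact b8 x (by omega)
    · intro e he
      simp only [setReg_arr]
      rw [hold e (by omega)]
      exact b9 e he
    · intro k' hk' y
      simp only [setReg_arr]
      rcases Nat.lt_or_eq_of_le (Nat.le_of_lt_succ (show k' < k + 1 by omega)) with h | rfl
      -- The list of an earlier leaf ends before the position at which the new list starts, so
      -- appending leaves it alone.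
      · rw [← bl k' (by omega) y]
        have hle : firstArc N (leafArcs p r N π) (N + k' + 1) ≤
          firstArc N (leafArcs p r N π) (N + k) := firstArc_mono _ _ (by omega)
        constructor
        · rintro ⟨e, he, he', hy⟩
          exact ⟨e, he, he', by rw [← hold e (by omega)]; exact hy⟩
        · rintro ⟨e, he, he', hy⟩
          exact ⟨e, he, he', by rw [hold e (by omega)]; exact hy⟩
      · rw [← hnew y, r10₅']
    · simpa using r10₅'
    · simpa using a10₅
    · simp
    · omega
  · exact ⟨fun x hx => by rw [a8 x hx, firstArc_internal hx.le], a9, fun k hk => by omega,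
      by rw [h10, firstArc_internal le_rfl], ha10⟩
  · rintro T s' ⟨⟨b8, b9, bl, r10, -⟩, h5, hT, -⟩
    refine ⟨b8, b9, fun k hk => bl k (by omega), h5, r10, ?_⟩
    have : 2 * N - N = N := by omega
    rwa [this] at hT

theorem graphProg_spec {s : State} {N : ℕ} {ω : ℕ → ℝ≥0∞} {π : ℕ → ℕ} (hs : Sized n N s)
    (ht : Tables n N s) (hl : Leaves N ω π s) (hN : N < 2 * n) (hN1 : 1 ≤ N)
    (ha10 : s.arr 10 0 = 0) (hW : 16 * (n * n) + 64 * n + 64 ≤ W) :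
    WP p r W graphProg s fun T s' =>
      SparseGraph p r N π s' ∧ T ≤ N * (29 * N + 17) + 6 := by
  unfold graphProg
  simp only [wp_seq, wp_const]
  refine ⟨by omega, by omega, by omega, ?_⟩
  set s₁ := ((s.setReg 5 0).setReg 10 0).setReg 20 0 with hs₁
  have hz₁ : Sized n N s₁ := by
    constructor <;> simp [hs₁, hs.reg0, hs.reg1, hs.reg2, hs.reg3]
  refine (internalArcsProg_spec (s := s₁) hz₁ hN (by simp [hs₁]) (by simp [hs₁])
    (by omega)).frame.mono ?_
  rintro T₂ s₂ ⟨⟨a8, a9, r5, r10, hT₂⟩, hf₂⟩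
  have ht₂ : Tables n N s₂ := by
    refine Tables.frame (s := s₁) ?_ hf₂ (by decide)
    exact ⟨ht.half, ht.pred, ht.label, ht.mul⟩
  have hl₂ : Leaves N ω π s₂ := by
    refine Leaves.frame (s := s₁) ?_ hf₂ (by decide)
    exact ⟨hl.vertex, hl.weight, hl.weight_internal⟩
  have ha10₂ : s₂.arr 10 0 = 0 := by
    rw [hf₂.arr 10 (by decide)]; exact ha10
  have h20₂ : s₂.reg 20 = 0 := by
    rw [hf₂.reg 20 (by decide)]; simp [hs₁]
  refine (leafArcsProg_spec (s := s₂) (hz₁.frame hf₂ (by decide)) ht₂ hl₂ hN hN1 r5 r10 h20₂ ha10₂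
    a8 a9 hW).mono ?_
  rintro T₃ s₃ ⟨b8, b9, bl, r5, r10, hT₃⟩
  -- The last store is a sentinel at index 2 N that closes the list of the last leaf.
  simp only [wp_store, r5, r10]
  refine ⟨⟨?_, ?_, ?_⟩, ?_⟩
  · intro x hx
    simp only [setArr_arr, if_true, Function.update_apply]
    split_ifs with h
    · rw [h]
    · exact b8 x (by omega)
  · simpa using b9
  · simpa using bl
  · have : N * (29 * N + 17) = N * (29 * N + 10) + 7 * N := by ring
    omega

end SparseGraph

/-! ### Tournament trees -/

section Heap

variable {n : ℕ} {p : Fin n → Plane} {r : ℝ} {W : ℕ}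

/-- Every internal node of the tree with leaves `K, …, 2 K - 1` holds the minimum of its children. -/
def IsTournament (K : ℕ) (H : ℕ → ℝ≥0∞) : Prop :=
  ∀ j, 1 ≤ j → j < K → H j = min (H (2 * j)) (H (2 * j + 1))

/-- Every internal node, except possibly the proper ancestors of `l`, holds the minimum of its
children. -/
def IsTournamentExcept (K l : ℕ) (H : ℕ → ℝ≥0∞) : Prop :=
  ∀ j, 1 ≤ j → j < K → (∀ i, l / 2 ^ (i + 1) ≠ j) → H j = min (H (2 * j)) (H (2 * j + 1))

/-- The parent of the overwritten leaf is among the excepted nodes, and no other node has that leaf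
as a child. -/
theorem IsTournament.update {K y : ℕ} {H : ℕ → ℝ≥0∞} (hH : IsTournament K H) (d : ℝ≥0∞) :
    IsTournamentExcept K (K + y) (Function.update H (K + y) d) := by
  intro j hj hjK hanc
  have := hanc 0
  rw [zero_add, pow_one] at this
  rw [Function.update_of_ne (by omega), Function.update_of_ne (by omega),
    Function.update_of_ne (by omega)]
  exact hH j hj hjK

theorem IsTournament.root_le {K : ℕ} {H : ℕ → ℝ≥0∞} (hH : IsTournament K H) :
    ∀ j, 1 ≤ j → j < 2 * K → H 1 ≤ H j := by
  intro j
  induction j using Nat.strong_induction_on with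
  | _ j ih =>
    intro hj hjK
    rcases Nat.lt_or_eq_of_le hj with h | rfl
    · refine (ih (j / 2) (by omega) (by omega) (by omega)).trans ?_
      rw [hH (j / 2) (by omega) (by omega)]
      rcases Nat.mod_two_eq_zero_or_one j with h | h
      · exact (min_le_left _ _).trans (by rw [show 2 * (j / 2) = j by omega])
      · exact (min_le_right _ _).trans (by rw [show 2 * (j / 2) + 1 = j by omega])
    · exact le_rfl

/-- Restores the minima above the node in register `9`. -/
def fixProg : Prog :=
  .loop (.less 1 9) <|
    .seq (.load 9 2 9) <| .seq (.plus 10 9 9) <| .seq (.wload 3 4 10) <| .seq (.plus 10 10 1) <|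
    .seq (.wload 4 4 10) (.cond (.weightLe 3 4) (.wstore 4 9 3) (.wstore 4 9 4))

theorem fixProg_spec {s : State} {N l : ℕ} (hs : Sized n N s) (ht : Tables n N s)
    (hl : s.reg 9 = l) (hl1 : 1 ≤ l) (hl2 : l < 4 * N)
    (hH : IsTournamentExcept (2 * N) l (s.warr 4)) (hW : 4 * N + 4 ≤ W) :
    WP p r W fixProg s fun T s' =>
      IsTournament (2 * N) (s'.warr 4) ∧ (∀ j, 2 * N ≤ j → s'.warr 4 j = s.warr 4 j) ∧
        T ≤ 8 * Nat.log 2 l + 1 := by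
  unfold fixProg
  refine (wp_loop (fun i s' => s'.reg 9 = i ∧ 1 ≤ i ∧ i < 4 * N ∧
    IsTournamentExcept (2 * N) i (s'.warr 4) ∧ (∀ j, 2 * N ≤ j → s'.warr 4 j = s.warr 4 j))
    (fun i => 8 * Nat.log 2 i) ?_ l ⟨hl, hl1, hl2, hH, fun _ _ => rfl⟩).mono ?_
  · rintro i s' ⟨h9, hi, hi', hI, hJ⟩ hf hlt
    have h1 : s'.reg 1 = 1 := by rw [hf.reg 1 (by decide)]; exact hs.reg1
    simp only [Test.Holds, h1, h9] at hlt
    have a2 : s'.arr 2 i = i / 2 := by rw [hf.arr 2 (by decide)]; exact ht.half i hi'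
    have hlog : Nat.log 2 i = Nat.log 2 (i / 2) + 1 := by
      have := Nat.log_pos one_lt_two hlt
      rw [Nat.log_div_base]; omega
    -- Recomputing the parent of i moves the exception one level up, since the ancestors of the
    -- parent are the remaining ancestors of i.
    have key : ∀ H : ℕ → ℝ≥0∞, IsTournamentExcept (2 * N) i H →
        IsTournamentExcept (2 * N) (i / 2) (Function.update H (i / 2)
          (min (H (i / 2 + i / 2)) (H (i / 2 + i / 2 + 1)))) := by
      intro H hH j hj hjN hanc
      have h0 := hanc 0
      rw [zero_add, pow_one] at h0
      rw [Function.update_of_ne (show 2 * j ≠ i / 2 by omega),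
        Function.update_of_ne (show 2 * j + 1 ≠ i / 2 by omega)]
      rcases eq_or_ne j (i / 2) with rfl | hne
      · rw [Function.update_self, two_mul]
      · rw [Function.update_of_ne hne]
        refine hH j hj hjN fun k hk => ?_
        rcases k with _ | k
        · exact hne (by rw [← hk]; simp)
        · refine hanc k ?_
          rw [← hk, Nat.div_div_eq_div_mul, pow_succ 2 (k + 1), mul_comm]
    have hN' : ∀ d, ∀ j, 2 * N ≤ j → Function.update (s'.warr 4) (i / 2) d j = s.warr 4 j := by
      intro d j hj
      rw [Function.update_of_ne (by omega)]
      exact hJ j hj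
    have hk := key _ hI
    norm_num [h1, h9, a2]
    refine ⟨by omega, by omega, fun hc => ⟨i / 2, ⟨rfl, by omega, by omega, ?_, hN' _⟩, by omega⟩,
      fun hc => ⟨i / 2, ⟨rfl, by omega, by omega, ?_, hN' _⟩, by omega⟩⟩
    · rwa [min_eq_left hc] at hk
    · rwa [min_eq_right hc.le] at hk
  · rintro T s' ⟨i, ⟨h9, hi, hi', hI, hJ⟩, hlt, hT, hf⟩
    have h1 : s'.reg 1 = 1 := by rw [hf.reg 1 (by decide)]; exact hs.reg1
    simp only [Test.Holds, h1, h9] at hlt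
    obtain rfl : i = 1 := by omega
    -- The root has no positive proper ancestor, so the exception has become empty.
    refine ⟨fun j hj hj' => hI j hj hj' fun k hk => ?_, hJ, by omega⟩
    have : 1 / 2 ^ (k + 1) = 0 := Nat.div_eq_of_lt (Nat.one_lt_two_pow (by omega))
    omega

/-- Walks from the root to a leaf holding the minimum. -/
def findMinProg : Prog :=
  .seq (.copy 9 1) <| .loop (.less 9 3) <|
    .seq (.plus 10 9 9) <| .seq (.wload 3 4 10) <| .seq (.plus 12 10 1) <|
    .seq (.wload 4 4 12) (.cond (.weightLe 3 4) (.copy 9 10) (.copy 9 12))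

theorem findMinProg_spec {s : State} {N g : ℕ} (hs : Sized n N s) (hg : 2 * N = 2 ^ g)
    (hH : IsTournament (2 * N) (s.warr 4)) (hW : 4 * N + 4 ≤ W) :
    WP p r W findMinProg s fun T s' =>
      (∃ x < 2 * N, s'.reg 9 = 2 * N + x ∧ s.warr 4 (2 * N + x) = s.warr 4 1) ∧
        T ≤ 7 * g + 2 := by
  unfold findMinProg
  simp only [wp_seq, wp_copy]
  -- The level i of the current node counts the rounds; the node always carries the value of the
  -- root, because one child of it attains its minimum.
  refine (wp_loop (fun i s' => i ≤ g ∧ 2 ^ i ≤ s'.reg 9 ∧ s'.reg 9 < 2 ^ (i + 1) ∧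
    s.warr 4 (s'.reg 9) = s.warr 4 1) (fun i => 7 * (g - i)) ?_ 0 ?_).mono ?_
  · rintro i s' ⟨hig, hi, hi', hI⟩ hf hlt
    have h1 : s'.reg 1 = 1 := by rw [hf.reg 1 (by decide)]; simpa using hs.reg1
    have h3 : s'.reg 3 = 2 * N := by rw [hf.reg 3 (by decide)]; simpa using hs.reg3
    have w4 : s'.warr 4 = s.warr 4 := by rw [hf.warr 4 (by decide)]; rfl
    simp only [Test.Holds, h3] at hlt
    have hgi : i < g := by
      by_contra hcon
      have : i = g := by omega
      subst this
      omega
    have hpos := Nat.one_le_two_pow (n := i)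
    have hmin := hH (s'.reg 9) (by omega) hlt
    rw [two_mul] at hmin
    norm_num [h1, w4]
    rw [pow_succ] at hi'
    refine ⟨by omega, by omega, fun hc => ⟨i + 1, ⟨by omega, ?_, ?_, ?_⟩, by omega⟩,
      fun hc => ⟨i + 1, ⟨by omega, ?_, ?_, ?_⟩, by omega⟩⟩
    · rw [pow_succ]; omega
    · rw [pow_succ, pow_succ]; omega
    · rw [← hI, hmin, min_eq_left hc]
    · rw [pow_succ]; omega
    · rw [pow_succ, pow_succ]; omega
    · rw [← hI, hmin, min_eq_right hc.le]
  · simp [hs.reg1]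
  · rintro T s' ⟨i, ⟨hig, hi, hi', hI⟩, hlt, hT, hf⟩
    have h3 : s'.reg 3 = 2 * N := by rw [hf.reg 3 (by decide)]; simpa using hs.reg3
    simp only [Test.Holds, h3] at hlt
    have : (2:ℕ) ^ (i + 1) ≤ 2 ^ (g + 1) := Nat.pow_le_pow_right (by omega) (by omega)
    rw [pow_succ 2 g] at this
    refine ⟨⟨s'.reg 9 - 2 * N, by omega, by omega, ?_⟩, by omega⟩
    rw [show 2 * N + (s'.reg 9 - 2 * N) = s'.reg 9 by omega, hI]

end Heap

/-! ### Dijkstra's algorithm with vertex weights: the abstract invariant -/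

section Search

/-- State of a search from `src`: the nodes in `E` are finished, those in `D` discovered; `A` are the
relaxed arcs; nodes from `N` on are the proper ones, `org` maps a discovered node to the proper one
it was discovered from, so that `P (org y) y`; `ρ` is a rank decreasing along `org`. -/
structure SearchInv (N K src : ℕ) (wt : ℕ → ℝ≥0∞) (P : ℕ → ℕ → Prop) (E D : Finset ℕ)
    (A : ℕ → ℕ → Prop) (ρ org : ℕ → ℕ) (d : ℕ → ℝ≥0∞) : Prop where
  sub : E ⊆ D
  lt : ∀ y ∈ D, y < K
  ne_top : ∀ y ∈ D, d y ≠ ⊤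
  eq_top : ∀ y < K, y ∉ D → d y = ⊤
  mono : ∀ x ∈ E, ∀ y ∈ D, y ∉ E → d x ≤ d y
  relaxed : ∀ x y, A x y → y ∈ D ∧ d y ≤ d x + wt y
  src_mem : src ∈ D
  src_eq : d src = wt src
  tree : ∀ y ∈ D, y ≠ src →
    N ≤ org y ∧ org y ∈ E ∧ P (org y) y ∧ d y = d (org y) + wt y ∧ ρ (org y) < ρ y
  rank : ∀ y ∈ D, ρ y ≤ E.card

variable {N K src : ℕ} {wt : ℕ → ℝ≥0∞} {P : ℕ → ℕ → Prop} {E D : Finset ℕ}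
  {A A' : ℕ → ℕ → Prop} {ρ org : ℕ → ℕ} {d : ℕ → ℝ≥0∞}

theorem SearchInv.start (hsrc : src < K) (hwt : wt src ≠ ⊤) (hd : ∀ y, y ≠ src → y < K → d y = ⊤)
    (hds : d src = wt src) :
    SearchInv N K src wt P ∅ {src} (fun _ _ => False) (fun _ => 0) org d where
  sub := by simp
  lt := by simpa using hsrc
  ne_top := by simpa [hds] using hwt
  eq_top y hy h := hd y (by simpa using h) hy
  mono := by simp
  relaxed := by simp
  src_mem := by simp
  src_eq := hds
  tree y hy h := absurd (by simpa using hy) h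
  rank := by simp

/-- Distances leave the queue in nondecreasing order, so the extracted node is a farthest finished
one. Its rank was at most the old number of finished nodes, hence lies below the new one; this
leaves room for the ranks of the nodes discovered from it. -/
theorem SearchInv.extract (h : SearchInv N K src wt P E D A ρ org d) {x : ℕ} (hx : x ∈ D)
    (hxE : x ∉ E) (hmin : ∀ y ∈ D, y ∉ E → d x ≤ d y) (hA : ∀ a b, A' a b → A a b) :
    SearchInv N K src wt P (insert x E) D A' ρ org d ∧ (∀ z ∈ insert x E, d z ≤ d x) ∧
      ρ x < (insert x E).card where
  left :=
    { sub := Finset.insert_subset hx h.sub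
      lt := h.lt
      ne_top := h.ne_top
      eq_top := h.eq_top
      mono := by
        intro z hz y hy hyE
        rw [Finset.mem_insert, not_or] at hyE
        rcases Finset.mem_insert.1 hz with rfl | hz
        · exact hmin y hy hyE.2
        · exact h.mono z hz y hy hyE.2
      relaxed := fun a b hab => h.relaxed a b (hA a b hab)
      src_mem := h.src_mem
      src_eq := h.src_eq
      tree := fun y hy hys => by
        obtain ⟨h₁, h₂, h₃⟩ := h.tree y hy hys
        exact ⟨h₁, Finset.mem_insert_of_mem h₂, h₃⟩
      rank := fun y hy => (h.rank y hy).trans (Finset.card_le_card (Finset.subset_insert _ _)) }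
  right := by
    refine ⟨fun z hz => ?_, ?_⟩
    · rcases Finset.mem_insert.1 hz with rfl | hz
      · exact le_rfl
      · exact h.mono z hz x hx hxE
    · rw [Finset.card_insert_of_notMem hxE]
      exact Nat.lt_succ_of_le (h.rank x hx)

/-- This is where vertex weights matter: y was reached earlier from a finished node, which is no
farther than x, at the same price `wt y`. A second arc into y can never improve its distance, and no
decrease-key operation is needed. -/
theorem SearchInv.skip (h : SearchInv N K src wt P E D A ρ org d) {x y : ℕ}
    (hmax : ∀ z ∈ E, d z ≤ d x) (hy : y ∈ D)
    (hA : ∀ a b, A' a b → A a b ∨ (a = x ∧ b = y)) :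
    SearchInv N K src wt P E D A' ρ org d :=
  { h with
    relaxed := fun a b hab => by
      rcases hA a b hab with hab | ⟨rfl, rfl⟩
      · exact h.relaxed a b hab
      · refine ⟨hy, ?_⟩
        rcases eq_or_ne b src with rfl | hne
        · rw [h.src_eq]; exact le_add_self
        · obtain ⟨-, h₂, -, h₄, -⟩ := h.tree b hy hne
          rw [h₄]
          gcongr
          exact hmax _ h₂ }

/-- The new node gets the current number of finished nodes as its rank, which exceeds the rank of x
and of the proper node behind x. Ranks rather than distances order the search tree, because weights
may vanish. -/
theorem SearchInv.discover (h : SearchInv N K src wt P E D A ρ org d) {x y o : ℕ}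
    (hx : x ∈ E) (hmax : ∀ z ∈ E, d z ≤ d x) (hρ : ρ x < E.card) (hy : y ∉ D) (hyK : y < K)
    (hsrc : N ≤ src) (hwt : wt y ≠ ⊤) (hwx : x < N → wt x = 0)
    (ho : o = if x < N then org x else x)
    (hP : N ≤ x → P x y) (hP' : x < N → ∀ o, P o x → P o y)
    (hA : ∀ a b, A' a b → A a b ∨ (a = x ∧ b = y)) :
    SearchInv N K src wt P E (insert y D) A' (Function.update ρ y E.card)
        (Function.update org y o) (Function.update d y (d x + wt y)) ∧
      (∀ z ∈ E, Function.update d y (d x + wt y) z ≤ d x) ∧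
      Function.update ρ y E.card x < E.card ∧ Function.update d y (d x + wt y) x = d x := by
  have hne : ∀ z ∈ D, z ≠ y := fun z hz hzy => hy (hzy ▸ hz)
  have hxD := h.sub hx
  -- If x is internal, its origin stands for it: x has weight zero, so both have the same distance,
  -- and P passes from x down to y.
  have hoo : N ≤ o ∧ o ∈ E ∧ P o y ∧ d x + wt y = d o + wt y ∧ ρ o < E.card := by
    subst ho
    split_ifs with hxN
    · obtain ⟨h₁, h₂, h₃, h₄, h₅⟩ := h.tree x hxD (by omega)
      refine ⟨h₁, h₂, hP' hxN _ h₃, ?_, h₅.trans hρ⟩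
      rw [h₄, hwx hxN, add_zero]
    · exact ⟨by omega, hx, hP (by omega), rfl, hρ⟩
  have hu : ∀ z ∈ D, Function.update d y (d x + wt y) z = d z := fun z hz =>
    Function.update_of_ne (hne z hz) _ _
  refine ⟨⟨h.sub.trans (Finset.subset_insert _ _), ?_, ?_, ?_, ?_, ?_, ?_, ?_, ?_, ?_⟩, ?_, ?_, ?_⟩
  · intro z hz
    rcases Finset.mem_insert.1 hz with rfl | hz
    · exact hyK
    · exact h.lt z hz
  · intro z hz
    rcases Finset.mem_insert.1 hz with rfl | hz
    · rw [Function.update_self]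
      exact ENNReal.add_ne_top.2 ⟨h.ne_top x hxD, hwt⟩
    · rw [hu z hz]; exact h.ne_top z hz
  · intro z hz hzD
    rw [Finset.mem_insert, not_or] at hzD
    rw [Function.update_of_ne hzD.1]
    exact h.eq_top z hz hzD.2
  · intro a ha z hz hzE
    rw [hu a (h.sub ha)]
    rcases Finset.mem_insert.1 hz with rfl | hz
    · rw [Function.update_self]
      exact (hmax a ha).trans le_self_add
    · rw [hu z hz]; exact h.mono a ha z hz hzE
  · intro a b hab
    rcases hA a b hab with hab | ⟨rfl, rfl⟩
    · obtain ⟨hb, hle⟩ := h.relaxed a b hab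
      refine ⟨Finset.mem_insert_of_mem hb, ?_⟩
      rw [hu b hb]
      -- An arc relaxed from y itself was bounded only by +∞, so it is checked anew: its head is the
      -- source, or was reached from a finished node, none of which is farther than x.
      rcases eq_or_ne a y with rfl | ha
      · rw [h.eq_top a hyK hy, top_add] at hle
        rw [Function.update_self]
        obtain ⟨h₁, h₂, h₃⟩ := hoo
        rcases eq_or_ne b src with rfl | hbs
        · rw [h.src_eq]; exact le_add_self
        · obtain ⟨-, h₂, -, h₄, -⟩ := h.tree b hb hbs
          rw [h₄]
          gcongr
          exact (hmax _ h₂).trans le_self_add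
      · rw [Function.update_of_ne ha]; exact hle
    · refine ⟨Finset.mem_insert_self _ _, ?_⟩
      rw [Function.update_self, hu a hxD]
  · exact Finset.mem_insert_of_mem h.src_mem
  · rw [hu _ h.src_mem, h.src_eq]
  · intro z hz hzs
    rcases Finset.mem_insert.1 hz with rfl | hz
    · simp only [Function.update_self]
      rw [hu o (h.sub hoo.2.1), Function.update_of_ne (hne o (h.sub hoo.2.1))]
      exact hoo
    · rw [hu z hz, Function.update_of_ne (hne z hz), Function.update_of_ne (hne z hz)]
      obtain ⟨h₁, h₂, h₃, h₄, h₅⟩ := h.tree z hz hzs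
      rw [hu _ (h.sub h₂), Function.update_of_ne (hne _ (h.sub h₂))]
      exact ⟨h₁, h₂, h₃, h₄, h₅⟩
  · intro z hz
    rcases Finset.mem_insert.1 hz with rfl | hz
    · rw [Function.update_self]
    · rw [Function.update_of_ne (hne z hz)]; exact h.rank z hz
  · intro z hz
    rw [hu z (h.sub hz)]; exact hmax z hz
  · rw [Function.update_of_ne (hne x hxD)]; exact hρ
  · exact hu x hxD

/-- The outcome of a search from `src`. -/
structure SearchResult (N K src : ℕ) (wt : ℕ → ℝ≥0∞) (R P : ℕ → ℕ → Prop) (ρ org : ℕ → ℕ)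
    (d : ℕ → ℝ≥0∞) : Prop where
  src_eq : d src = wt src
  relaxed : ∀ x < K, ∀ y, R x y → d y ≤ d x + wt y
  tree : ∀ y < K, d y ≠ ⊤ → y ≠ src → N ≤ org y ∧ org y < K ∧ P (org y) y ∧
    d (org y) ≠ ⊤ ∧ d y = d (org y) + wt y ∧ ρ (org y) < ρ y

theorem SearchInv.result {R : ℕ → ℕ → Prop}
    (h : SearchInv N K src wt P E D (fun x y => x ∈ E ∧ R x y) ρ org d)
    (hD : ∀ y ∈ D, y ∈ E) : SearchResult N K src wt R P ρ org d where
  src_eq := h.src_eq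
  relaxed x hx y hR := by
    by_cases hxD : x ∈ D
    · exact (h.relaxed x y ⟨hD x hxD, hR⟩).2
    · rw [h.eq_top x hx hxD, top_add]; exact le_top
  tree y hy hyt hys := by
    have hyD : y ∈ D := by
      by_contra hc
      exact hyt (h.eq_top y hy hc)
    obtain ⟨h₁, h₂, h₃, h₄⟩ := h.tree y hyD hys
    exact ⟨h₁, h.lt _ (h.sub h₂), h₃, h.ne_top _ (h.sub h₂), h₄⟩

end Search

/-! ### Dijkstra's algorithm with vertex weights: the program -/

section Dijkstra

variable {n : ℕ} {p : Fin n → Plane} {r : ℝ} {W : ℕ}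

theorem SearchInv.weaken {N K src : ℕ} {wt : ℕ → ℝ≥0∞} {P : ℕ → ℕ → Prop} {E D : Finset ℕ}
    {A A' : ℕ → ℕ → Prop} {ρ org : ℕ → ℕ} {d : ℕ → ℝ≥0∞}
    (h : SearchInv N K src wt P E D A ρ org d) (hA : ∀ a b, A' a b → A a b) :
    SearchInv N K src wt P E D A' ρ org d :=
  { h with relaxed := fun a b hab => h.relaxed a b (hA a b hab) }

/-- Clears the tables of a search; weight register `1` holds `+∞` and word register `20` zero. -/
def clearProg : Prog :=
  .seq (.const 6 0) <| .loop (.less 6 3) <|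
    .seq (.store 11 6 20) <| .seq (.wstore 3 6 1) <| .seq (.wstore 4 6 1) <|
    .seq (.plus 7 3 6) <| .seq (.wstore 4 7 1) (.plus 6 6 1)

theorem clearProg_spec {s : State} {N : ℕ} (hs : Sized n N s) (h20 : s.reg 20 = 0)
    (hw1 : s.wreg 1 = ⊤) (hW : 4 * N + 4 ≤ W) :
    WP p r W clearProg s fun T s' =>
      (∀ y < 2 * N, s'.arr 11 y = 0) ∧ (∀ y < 2 * N, s'.warr 3 y = ⊤) ∧
        (∀ j < 4 * N, s'.warr 4 j = ⊤) ∧ T ≤ 14 * N + 2 := by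
  unfold clearProg
  simp only [wp_seq, wp_const]
  refine ⟨by omega, ?_⟩
  refine (wp_for (m := 2 * N) (i₀ := 0) (B := 6) (fun i s' =>
    (∀ y < i, s'.arr 11 y = 0) ∧ (∀ y < i, s'.warr 3 y = ⊤) ∧ (∀ y < i, s'.warr 4 y = ⊤) ∧
      (∀ y < i, s'.warr 4 (2 * N + y) = ⊤))
    (by decide) (by simp [hs.reg3]) (by simp) (by omega) ?_ ?_).mono ?_
  · rintro i s' - hi ⟨b1, b2, b3, b4⟩ h6 hf
    have h1 : s'.reg 1 = 1 := by rw [hf.reg 1 (by decide)]; simpa using hs.reg1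
    have h3 : s'.reg 3 = 2 * N := by rw [hf.reg 3 (by decide)]; simpa using hs.reg3
    have h20 : s'.reg 20 = 0 := by rw [hf.reg 20 (by decide)]; simpa using h20
    have w1 : s'.wreg 1 = ⊤ := by rw [hf.wreg 1 (by decide)]; simpa using hw1
    norm_num [h1, h3, h6, h20, w1]
    refine ⟨by omega, by omega, ?_, ?_, ?_, ?_⟩ <;> intro y hy <;>
      simp only [Function.update_apply] <;> split_ifs
    all_goals first | rfl | exact b1 y (by omega) | exact b2 y (by omega) | exact b3 y (by omega) |
      exact b4 y (by omega)
  · simp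
  · rintro T s' ⟨⟨b1, b2, b3, b4⟩, -, hT, -⟩
    refine ⟨b1, b2, fun j hj => ?_, by omega⟩
    by_cases h : j < 2 * N
    · exact b3 j h
    · have := b4 (j - 2 * N) (by omega)
      rwa [show 2 * N + (j - 2 * N) = j by omega] at this

/-- Discovers the node in register `8` at the distance in weight register `2`. -/
def discoverProg : Prog :=
  .seq (.store 11 8 1) <| .seq (.wstore 3 8 2) <| .seq (.plus 9 3 8) <| .seq (.wstore 4 9 2) fixProg

theorem log_leaf_le {N g x : ℕ} (hg : 2 * N = 2 ^ g) (hx : x < 2 * N) :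
    Nat.log 2 (2 * N + x) ≤ g := by
  have : Nat.log 2 (2 * N + x) < g + 1 := Nat.log_lt_of_lt_pow (by omega) (by rw [pow_succ]; omega)
  omega

theorem discoverProg_spec {s : State} {N g y : ℕ} {δ : ℝ≥0∞} (hs : Sized n N s)
    (ht : Tables n N s) (hg : 2 * N = 2 ^ g) (h8 : s.reg 8 = y) (hy : y < 2 * N)
    (hw2 : s.wreg 2 = δ) (hH : IsTournament (2 * N) (s.warr 4)) (hW : 4 * N + 4 ≤ W) :
    WP p r W discoverProg s fun T s' =>
      s'.arr 11 = Function.update (s.arr 11) y 1 ∧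
      s'.warr 3 = Function.update (s.warr 3) y δ ∧ IsTournament (2 * N) (s'.warr 4) ∧
      (∀ z, s'.warr 4 (2 * N + z) = if z = y then δ else s.warr 4 (2 * N + z)) ∧
      T ≤ 8 * g + 5 := by
  unfold discoverProg
  norm_num [hs.reg1, hs.reg3, h8, hw2]
  refine ⟨by omega, ?_⟩
  refine (fixProg_spec (N := N) (l := 2 * N + y) ?_ ?_ (by simp) (by omega) (by omega) ?_ hW).frame.mono
    ?_
  · constructor <;> simp [hs.reg0, hs.reg1, hs.reg2, hs.reg3]
  · exact ⟨ht.half, ht.pred, ht.label, ht.mul⟩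
  · simpa using hH.update δ
  · rintro T s' ⟨⟨hI, hJ, hT⟩, hf⟩
    have := log_leaf_le hg hy
    refine ⟨?_, ?_, hI, fun z => ?_, by omega⟩
    · rw [hf.arr 11 (by decide)]; simp
    · rw [hf.warr 3 (by decide)]; simp
    · rw [hJ _ (by omega)]
      simp [Function.update_apply]

/-- The arrays of a search as functions of the finished and the discovered nodes. -/
structure SearchMem (N : ℕ) (E D : Finset ℕ) (s : State) : Prop where
  disc : ∀ y < 2 * N, s.arr 11 y = if y ∈ D then 1 else 0
  heap : IsTournament (2 * N) (s.warr 4)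
  leaf : ∀ y < 2 * N, s.warr 4 (2 * N + y) = if y ∈ D ∧ y ∉ E then s.warr 3 y else ⊤

/-- `y` is the head of an arc of `x`. -/
def IsArc (F hd : ℕ → ℕ) (x y : ℕ) : Prop :=
  ∃ e, F x ≤ e ∧ e < F (x + 1) ∧ hd e = y

/-- A sparse graph whose arcs respect the relation `P`. -/
structure ArcSystem (N : ℕ) (F hd : ℕ → ℕ) (wt : ℕ → ℝ≥0∞) (P : ℕ → ℕ → Prop) : Prop where
  mono : Monotone F
  lt : ∀ x < 2 * N, ∀ y, IsArc F hd x y → y < 2 * N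
  leaf : ∀ x < 2 * N, N ≤ x → ∀ y, IsArc F hd x y → P x y
  internal : ∀ x < N, ∀ y, IsArc F hd x y → ∀ o, P o x → P o y
  wt_ne_top : ∀ x < 2 * N, wt x ≠ ⊤
  wt_internal : ∀ x < N, wt x = 0

/-- The sparse graph and its weights are in memory. -/
structure ArcMem (N : ℕ) (F hd : ℕ → ℕ) (wt : ℕ → ℝ≥0∞) (s : State) : Prop where
  first : ∀ x ≤ 2 * N, s.arr 8 x = F x
  head : s.arr 9 = hd
  weight : s.warr 2 = wt
  infty : s.wreg 1 = ⊤
  zero : s.reg 20 = 0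

theorem ArcMem.frame {N : ℕ} {F hd : ℕ → ℕ} {wt : ℕ → ℝ≥0∞} {s s' : State} {P : Prog}
    (h : ArcMem N F hd wt s) (hf : Frame P s s')
    (hP : P.writesArr 8 = false ∧ P.writesArr 9 = false ∧ P.writesWArr 2 = false ∧
      P.writesWReg 1 = false ∧ P.writesReg 20 = false) : ArcMem N F hd wt s' :=
  ⟨by rw [hf.arr 8 hP.1]; exact h.first, by rw [hf.arr 9 hP.2.1]; exact h.head,
    by rw [hf.warr 2 hP.2.2.1]; exact h.weight, by rw [hf.wreg 1 hP.2.2.2.1]; exact h.infty,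
    by rw [hf.reg 20 hP.2.2.2.2]; exact h.zero⟩

/-- Relaxes the arcs from position `15` up to position `16`; weight register `6` holds the distance
of their tail and register `14` the proper node that stands for it. -/
def relaxProg : Prog :=
  .loop (.less 15 16) <|
    .seq (.load 8 9 15) <| .seq (.load 17 11 8) <|
    .seq (.cond (.less 17 1)
      (.seq (.store 12 8 14) <| .seq (.wload 7 2 8) <| .seq (.wplus 2 6 7) discoverProg)
      (.copy 8 8))
    (.plus 15 15 1)

theorem relaxProg_spec {s : State} {N g src x : ℕ} {F hd : ℕ → ℕ} {wt : ℕ → ℝ≥0∞}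
    {P : ℕ → ℕ → Prop} {E₀ D : Finset ℕ} {ρ : ℕ → ℕ} (hs : Sized n N s) (ht : Tables n N s)
    (hg : 2 * N = 2 ^ g) (hG : ArcSystem N F hd wt P) (hm : ArcMem N F hd wt s)
    (hsrc : N ≤ src) (hx : x < 2 * N)
    (h15 : s.reg 15 = F x) (h16 : s.reg 16 = F (x + 1))
    (h14 : s.reg 14 = if x < N then s.arr 12 x else x) (hw6 : s.wreg 6 = s.warr 3 x)
    (hI : SearchInv N (2 * N) src wt P (insert x E₀) D (fun a b => a ∈ E₀ ∧ IsArc F hd a b) ρ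
      (s.arr 12) (s.warr 3))
    (hmax : ∀ z ∈ insert x E₀, s.warr 3 z ≤ s.warr 3 x) (hρ : ρ x < (insert x E₀).card)
    (hM : SearchMem N (insert x E₀) D s) (hW : 4 * N + 4 ≤ W) (hWF : F (2 * N) < W) :
    WP p r W relaxProg s fun T s' => ∃ D' ρ',
      SearchInv N (2 * N) src wt P (insert x E₀) D'
        (fun a b => a ∈ insert x E₀ ∧ IsArc F hd a b) ρ' (s'.arr 12) (s'.warr 3) ∧
      SearchMem N (insert x E₀) D' s' ∧
      T + (8 * g + 20) * (2 * N - D'.card) ≤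
        10 * (F (x + 1) - F x) + (8 * g + 20) * (2 * N - D.card) + 1 := by
  unfold relaxProg
  refine (wp_loop (α := ℕ × Finset ℕ) (fun a s' => s'.reg 15 = a.1 ∧ F x ≤ a.1 ∧ a.1 ≤ F (x + 1) ∧
      s'.wreg 6 = s'.warr 3 x ∧ (s'.reg 14 = if x < N then s'.arr 12 x else x) ∧
      (∀ z ∈ insert x E₀, s'.warr 3 z ≤ s'.warr 3 x) ∧
      SearchMem N (insert x E₀) a.2 s' ∧
      ∃ ρ : ℕ → ℕ, ρ x < (insert x E₀).card ∧
        SearchInv N (2 * N) src wt P (insert x E₀) a.2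
        (fun u v => (u ∈ E₀ ∧ IsArc F hd u v) ∨ (u = x ∧ ∃ e, F x ≤ e ∧ e < a.1 ∧ hd e = v)) ρ
          (s'.arr 12) (s'.warr 3))
    -- Every remaining arc pays for its inspection, every undiscovered node for its single insertion
    -- into the tournament tree.
    (fun a => 10 * (F (x + 1) - a.1) + (8 * g + 20) * (2 * N - a.2.card)) ?_ (F x, D) ?_).mono ?_
  · rintro ⟨i, D₁⟩ s₁ ⟨r15, hi, hi', w6, r14, hmax₁, hM₁, ρ₁, hρ₁, hI₁⟩ hf hlt
    simp only at r15 hi hi' hI₁ hM₁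
    have r16 : s₁.reg 16 = F (x + 1) := by rw [hf.reg 16 (by decide)]; exact h16
    have hs₁ : Sized n N s₁ := hs.frame hf (by decide)
    have ht₁ : Tables n N s₁ := ht.frame hf (by decide)
    have hm₁ : ArcMem N F hd wt s₁ := hm.frame hf (by decide)
    simp only [Test.Holds, r15, r16] at hlt
    have hFx : F (x + 1) ≤ F (2 * N) := hG.mono (by omega)
    have harc : IsArc F hd x (hd i) := ⟨i, hi, hlt, rfl⟩
    have hy := hG.lt x hx _ harc
    have hA : ∀ a b, (a ∈ E₀ ∧ IsArc F hd a b ∨ a = x ∧ ∃ e, F x ≤ e ∧ e < i + 1 ∧ hd e = b) →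
        (a ∈ E₀ ∧ IsArc F hd a b ∨ a = x ∧ ∃ e, F x ≤ e ∧ e < i ∧ hd e = b) ∨
          (a = x ∧ b = hd i) := by
      rintro a b (h | ⟨rfl, e, he, he', rfl⟩)
      · exact Or.inl (Or.inl h)
      · rcases Nat.lt_or_eq_of_le (Nat.le_of_lt_succ he') with h | rfl
        · exact Or.inl (Or.inr ⟨rfl, e, he, h, rfl⟩)
        · exact Or.inr ⟨rfl, rfl⟩
    have hxD : x ∈ D₁ := hI₁.sub (Finset.mem_insert_self _ _)
    simp only [wp_seq, wp_load, wp_cond]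
    refine ⟨fun hc => ?_, fun hc => ?_⟩
    · have hyD : hd i ∉ D₁ := by
        intro h
        simp [r15, hm₁.head, hM₁.disc _ hy, h, hs₁.reg1] at hc
      have hyx : x ≠ hd i := fun h => hyD (h ▸ hxD)
      obtain ⟨hI₂, hmax₂, hρ₂, hdx⟩ := hI₁.discover (x := x) (y := hd i)
        (o := if x < N then s₁.arr 12 x else x)
        (Finset.mem_insert_self _ _) hmax₁ hρ₁ hyD hy hsrc (hG.wt_ne_top _ hy)
        (hG.wt_internal x) rfl (fun h => hG.leaf x hx h _ harc)
        (fun h => hG.internal x h _ harc) hA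
      simp only [wp_store, wp_wload, wp_wplus]
      refine (discoverProg_spec (N := N) (g := g) (y := hd i) (δ := s₁.warr 3 x + wt (hd i))
        ?_ ?_ hg ?_ hy ?_ ?_ hW).frame.mono ?_
      · constructor <;> simp [hs₁.reg0, hs₁.reg1, hs₁.reg2, hs₁.reg3]
      · exact ⟨ht₁.half, ht₁.pred, ht₁.label, ht₁.mul⟩
      · simp [r15, hm₁.head]
      · simp [r15, hm₁.head, hm₁.weight, w6]
      · exact hM₁.heap
      · rintro T s₂ ⟨⟨a11, w3, hH, hleaf, hT⟩, hf₂⟩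
        have a12 : s₂.arr 12 = Function.update (s₁.arr 12) (hd i)
            (if x < N then s₁.arr 12 x else x) := by
          rw [hf₂.arr 12 (by decide)]; simp [r15, hm₁.head, r14]
        have r1 : s₂.reg 1 = 1 := by rw [hf₂.reg 1 (by decide)]; simp [hs₁.reg1]
        have r15' : s₂.reg 15 = i := by rw [hf₂.reg 15 (by decide)]; simp [r15]
        have r14' : s₂.reg 14 = s₁.reg 14 := by rw [hf₂.reg 14 (by decide)]; simp
        have w6' : s₂.wreg 6 = s₁.warr 3 x := by rw [hf₂.wreg 6 (by decide)]; simp [w6]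
        simp only [setReg_warr, setReg_arr, setWReg_warr, setWReg_arr, setArr_warr, setArr_arr]
          at a11 w3 hleaf
        rw [if_neg (by decide)] at a11
        norm_num [r1, r15']
        refine ⟨by omega, i + 1, insert (hd i) D₁, ⟨rfl, by omega, by omega, ?_, ?_, ?_, ?_,
          Function.update ρ₁ (hd i) (insert x E₀).card, hρ₂, ?_⟩, ?_⟩
        · rw [w6', w3, hdx]
        · rw [r14', r14, a12, Function.update_of_ne hyx]
        · intro z hz
          rw [w3, hdx]
          exact hmax₂ z (Finset.mem_insert_of_mem hz)
        · refine ⟨fun z hz => ?_, hH, fun z hz => ?_⟩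
          · simp only [setReg_arr, a11, Function.update_apply, Finset.mem_insert]
            rcases eq_or_ne z (hd i) with rfl | hne
            · simp
            · simp only [hne, false_or, if_false]
              exact hM₁.disc z hz
          · simp only [setReg_warr, w3, hleaf, Function.update_apply, Finset.mem_insert]
            rcases eq_or_ne z (hd i) with rfl | hne
            · have hz' : hd i ∉ insert x E₀ := fun h => hyD (hI₁.sub h)
              simp only [Finset.mem_insert] at hz'
              simp [hz']
            · have := hM₁.leaf z hz
              simp only [Finset.mem_insert] at this
              simp only [hne, false_or, if_false]
              exact this
        · simp only [w3, a12]
          exact hI₂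
        -- This bound ensures that the truncated difference in the potential really decreases.
        · have hle : (insert (hd i) D₁).card ≤ 2 * N := by
            have : insert (hd i) D₁ ⊆ Finset.range (2 * N) := fun z hz =>
              Finset.mem_range.2 (hI₂.lt z hz)
            simpa using Finset.card_le_card this
          rw [Finset.card_insert_of_notMem hyD] at hle ⊢
          obtain ⟨m, hm⟩ : ∃ m, 2 * N = D₁.card + 1 + m := ⟨2 * N - (D₁.card + 1), by omega⟩
          rw [hm, show D₁.card + 1 + m - (D₁.card + 1) = m by omega,
            show D₁.card + 1 + m - D₁.card = m + 1 by omega, mul_add]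
          omega
    · have hyD : hd i ∈ D₁ := by
        by_contra h
        simp [r15, hm₁.head, hM₁.disc _ hy, h, hs₁.reg1] at hc
      have hI₂ := hI₁.skip hmax₁ hyD hA
      norm_num [r15, hs₁.reg1]
      refine ⟨by omega, i + 1, D₁, ⟨rfl, by omega, by omega, w6, r14,
        fun z hz => hmax₁ z (Finset.mem_insert_of_mem hz),
        ⟨hM₁.disc, hM₁.heap, hM₁.leaf⟩, ρ₁, hρ₁, hI₂⟩, by omega⟩
  · refine ⟨h15, le_rfl, hG.mono (by omega), hw6, h14, hmax, hM, ρ, hρ, hI.weaken ?_⟩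
    rintro a b (h | ⟨rfl, e, he, he', rfl⟩)
    · exact h
    · simp only at he'; omega
  · rintro T s' ⟨⟨i, D'⟩, ⟨r15, hi, hi', -, -, -, hM', ρ', hρ', hI'⟩, hlt, hT, hf⟩
    have r16 : s'.reg 16 = F (x + 1) := by rw [hf.reg 16 (by decide)]; exact h16
    simp only at r15 hi hi' hI' hM' hT
    simp only [Test.Holds, r15, r16] at hlt
    obtain rfl : i = F (x + 1) := by omega
    refine ⟨D', ρ', hI'.weaken ?_, hM', by omega⟩
    rintro a b ⟨ha, e, he, he', rfl⟩
    rcases Finset.mem_insert.1 ha with rfl | ha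
    · exact Or.inr ⟨rfl, e, he, he', rfl⟩
    · exact Or.inl ⟨ha, e, he, he', rfl⟩

end Dijkstra

/-! ### Extractions and the complete single-source search -/

section Dijkstra

variable {n : ℕ} {p : Fin n → Plane} {r : ℝ} {W : ℕ}

/-- Sets register `11` to `1` if the tournament tree is empty and to `0` otherwise. -/
def flagProg : Prog :=
  .seq (.wload 5 4 1) (.cond (.weightLe 1 5) (.copy 11 1) (.copy 11 20))

open Classical in
theorem flagProg_spec {s : State} {N : ℕ} {F hd : ℕ → ℕ} {wt : ℕ → ℝ≥0∞} (hs : Sized n N s)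
    (hm : ArcMem N F hd wt s) :
    WP p r W flagProg s fun T s' =>
      s'.reg 11 = (if s.warr 4 1 = ⊤ then 1 else 0) ∧ T ≤ 3 := by
  unfold flagProg
  norm_num [hs.reg1, hm.infty, hm.zero]
  exact fun h => h.ne

/-- Takes the nearest discovered node out of the tournament tree and relaxes its arcs. -/
def extractProg : Prog :=
  .seq findMinProg <| .seq (.load 6 4 9) <| .seq (.wload 6 4 9) <| .seq (.wstore 4 9 1) <|
  .seq fixProg <| .seq (.cond (.less 6 2) (.load 14 12 6) (.copy 14 6)) <|
  .seq (.load 15 8 6) <| .seq (.plus 7 6 1) <| .seq (.load 16 8 7) <| .seq relaxProg flagProg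

open Classical in
theorem extractProg_spec {s : State} {N g src : ℕ} {F hd : ℕ → ℕ} {wt : ℕ → ℝ≥0∞}
    {P : ℕ → ℕ → Prop} {E D : Finset ℕ} {ρ : ℕ → ℕ} (hs : Sized n N s) (ht : Tables n N s)
    (hg : 2 * N = 2 ^ g) (hG : ArcSystem N F hd wt P) (hm : ArcMem N F hd wt s)
    (hsrc : N ≤ src)
    (hI : SearchInv N (2 * N) src wt P E D (fun a b => a ∈ E ∧ IsArc F hd a b) ρ
      (s.arr 12) (s.warr 3))
    (hM : SearchMem N E D s) (hne : s.warr 4 1 ≠ ⊤) (hW : 4 * N + 4 ≤ W) (hWF : F (2 * N) < W) :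
    WP p r W extractProg s fun T s' => ∃ x D' ρ', x < 2 * N ∧ x ∉ E ∧
      SearchInv N (2 * N) src wt P (insert x E) D'
        (fun a b => a ∈ insert x E ∧ IsArc F hd a b) ρ' (s'.arr 12) (s'.warr 3) ∧
      SearchMem N (insert x E) D' s' ∧ s'.reg 11 = (if s'.warr 4 1 = ⊤ then 1 else 0) ∧
      T + (8 * g + 20) * (2 * N - D'.card) ≤
        10 * (F (x + 1) - F x) + (15 * g + 20) + (8 * g + 20) * (2 * N - D.card) := by
  unfold extractProg
  rw [wp_seq]
  refine (findMinProg_spec hs hg hM.heap hW).frame.mono ?_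
  rintro T₁ s₁ ⟨⟨⟨x, hx, h9, hxmin⟩, hT₁⟩, hf₁⟩
  have hs₁ : Sized n N s₁ := hs.frame hf₁ (by decide)
  have ht₁ : Tables n N s₁ := ht.frame hf₁ (by decide)
  have hm₁ : ArcMem N F hd wt s₁ := hm.frame hf₁ (by decide)
  have w4 : s₁.warr 4 = s.warr 4 := hf₁.warr 4 (by decide)
  have w3 : s₁.warr 3 = s.warr 3 := hf₁.warr 3 (by decide)
  have a11 : s₁.arr 11 = s.arr 11 := hf₁.arr 11 (by decide)
  have a12 : s₁.arr 12 = s.arr 12 := hf₁.arr 12 (by decide)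
  have hx4 := hM.leaf x hx
  rw [hxmin] at hx4
  -- Only discovered unfinished nodes have an entry other than +∞, so a finite root value is
  -- attained at one of them.
  have hxDE : x ∈ D ∧ x ∉ E := by
    by_contra h
    rw [if_neg h] at hx4
    exact hne hx4
  rw [if_pos hxDE] at hx4
  have hmin : ∀ y ∈ D, y ∉ E → s.warr 3 x ≤ s.warr 3 y := by
    intro y hy hyE
    have hyN := hI.lt y hy
    have := hM.heap.root_le (2 * N + y) (by omega) (by omega)
    rwa [hM.leaf y hyN, if_pos ⟨hy, hyE⟩, hx4] at this
  obtain ⟨hI₁, hmax, hρ⟩ := hI.extract hxDE.1 hxDE.2 hmin (A' := fun a b => a ∈ E ∧ IsArc F hd a b)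
    (fun _ _ h => h)
  simp only [wp_seq, wp_load, wp_wload, wp_wstore]
  set s₂ := ((s₁.setReg 6 (s₁.arr 4 (s₁.reg 9))).setWReg 6
    ((s₁.setReg 6 (s₁.arr 4 (s₁.reg 9))).warr 4
      ((s₁.setReg 6 (s₁.arr 4 (s₁.reg 9))).reg 9))) with hs₂
  have h6 : s₂.reg 6 = x := by simp [hs₂, h9, ht₁.label x hx]
  have hw6 : s₂.wreg 6 = s.warr 3 x := by simp [hs₂, h9, w4, hxmin, hx4]
  have h9₂ : s₂.reg 9 = 2 * N + x := by simp [hs₂, h9]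
  have hz₂ : Sized n N s₂ := by
    constructor <;> simp [hs₂, hs₁.reg0, hs₁.reg1, hs₁.reg2, hs₁.reg3]
  have hi₂ : s₂.wreg 1 = ⊤ := by simp [hs₂, hm₁.infty]
  set s₃ := s₂.setWArr 4 (s₂.reg 9) (s₂.wreg 1) with hs₃
  have w4₃ : s₃.warr 4 = Function.update (s.warr 4) (2 * N + x) ⊤ := by
    rw [hs₃, h9₂, hi₂]; simp [hs₂, w4]
  have hz₃ : Sized n N s₃ := ⟨hz₂.reg0, hz₂.reg1, hz₂.reg2, hz₂.reg3⟩
  have ht₃ : Tables n N s₃ := ⟨ht₁.half, ht₁.pred, ht₁.label, ht₁.mul⟩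
  have hm₃ : ArcMem N F hd wt s₃ := by
    refine ⟨hm₁.first, hm₁.head, ?_, hi₂, ?_⟩
    · simpa [hs₃, hs₂] using hm₁.weight
    · simpa [hs₃, hs₂] using hm₁.zero
  refine (fixProg_spec (N := N) (l := 2 * N + x) hz₃ ht₃ h9₂ (by omega) (by omega)
    (by rw [w4₃]; exact hM.heap.update ⊤) hW).frame.mono ?_
  rintro T₄ s₄ ⟨⟨hH, hleaf, hT₄⟩, hf₄⟩
  have hlog := log_leaf_le hg hx
  have hz₄ : Sized n N s₄ := hz₃.frame hf₄ (by decide)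
  have ht₄ : Tables n N s₄ := ht₃.frame hf₄ (by decide)
  have hm₄ : ArcMem N F hd wt s₄ := hm₃.frame hf₄ (by decide)
  have h6₄ : s₄.reg 6 = x := by rw [hf₄.reg 6 (by decide)]; exact h6
  have hw6₄ : s₄.wreg 6 = s.warr 3 x := by rw [hf₄.wreg 6 (by decide)]; exact hw6
  have w3₄ : s₄.warr 3 = s.warr 3 := by rw [hf₄.warr 3 (by decide)]; simp [hs₃, hs₂, w3]
  have a11₄ : s₄.arr 11 = s.arr 11 := by rw [hf₄.arr 11 (by decide)]; simp [hs₃, hs₂, a11]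
  have a12₄ : s₄.arr 12 = s.arr 12 := by rw [hf₄.arr 12 (by decide)]; simp [hs₃, hs₂, a12]
  have hM₄ : ∀ s' : State, s'.arr 11 = s₄.arr 11 → s'.warr 4 = s₄.warr 4 →
      s'.warr 3 = s₄.warr 3 → SearchMem N (insert x E) D s' := by
    intro s' e₁ e₂ e₃
    refine ⟨by rw [e₁, a11₄]; exact hM.disc, by rw [e₂]; exact hH, fun y hy => ?_⟩
    rw [e₂, hleaf _ (by omega), w4₃, e₃, w3₄]
    simp only [Finset.mem_insert]
    rcases eq_or_ne y x with rfl | hyx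
    · simp
    · rw [Function.update_of_ne (by omega), hM.leaf y hy]
      simp [hyx]
  -- The two branches of the test differ only in how they compute the proper node standing for x, so
  -- the rest of the program is treated once for both.
  have rest : ∀ (lab Tc : ℕ), lab = (if x < N then s.arr 12 x else x) → Tc ≤ 2 →
      WP p r W (.seq (.load 15 8 6) <| .seq (.plus 7 6 1) <| .seq (.load 16 8 7) <|
        .seq relaxProg flagProg) (s₄.setReg 14 lab) fun T s' =>
          ∃ x D' ρ', x < 2 * N ∧ x ∉ E ∧
      SearchInv N (2 * N) src wt P (insert x E) D'
        (fun a b => a ∈ insert x E ∧ IsArc F hd a b) ρ' (s'.arr 12) (s'.warr 3) ∧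
      SearchMem N (insert x E) D' s' ∧ s'.reg 11 = (if s'.warr 4 1 = ⊤ then 1 else 0) ∧
      T₁ + (1 + (1 + (1 + (T₄ + (Tc + T))))) + (8 * g + 20) * (2 * N - D'.card) ≤
        10 * (F (x + 1) - F x) + (15 * g + 20) + (8 * g + 20) * (2 * N - D.card) := by
    intro lab Tc hlab hTc
    simp only [wp_seq, wp_load, wp_plus]
    norm_num [h6₄, hz₄.reg1, hm₄.first x hx.le, hm₄.first (x + 1) (by omega)]
    refine ⟨by omega, ?_⟩
    refine (relaxProg_spec (N := N) (g := g) (src := src) (x := x) (F := F) (hd := hd) (wt := wt)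
      (P := P) (E₀ := E) (D := D) (ρ := ρ) ?_ ?_ hg hG ?_ hsrc hx ?_ ?_ ?_ ?_ ?_ ?_ hρ ?_ hW
      hWF).frame.mono ?_
    · constructor <;> simp [hz₄.reg0, hz₄.reg1, hz₄.reg2, hz₄.reg3]
    · exact ⟨ht₄.half, ht₄.pred, ht₄.label, ht₄.mul⟩
    · refine ⟨hm₄.first, hm₄.head, hm₄.weight, hm₄.infty, ?_⟩
      simpa using hm₄.zero
    · simp
    · simp
    · simp [hlab, a12₄]
    · simp [hw6₄, w3₄]
    · simpa [a12₄, w3₄] using hI₁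
    · simp only [setReg_warr, w3₄]; exact hmax
    · exact hM₄ _ rfl rfl rfl
    · rintro T₅ s₅ ⟨⟨D', ρ', hI₅, hM₅, hT₅⟩, hf₅⟩
      have hz₅ : Sized n N s₅ := by
        refine Sized.frame ?_ hf₅ (by decide)
        constructor <;> simp [hz₄.reg0, hz₄.reg1, hz₄.reg2, hz₄.reg3]
      have hm₅ : ArcMem N F hd wt s₅ := by
        refine ArcMem.frame ?_ hf₅ (by decide)
        refine ⟨hm₄.first, hm₄.head, hm₄.weight, hm₄.infty, ?_⟩
        simpa using hm₄.zero
      refine (flagProg_spec hz₅ hm₅).frame.mono ?_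
      rintro T₆ s₆ ⟨⟨h11, hT₆⟩, hf₆⟩
      have w4₆ : s₆.warr 4 = s₅.warr 4 := hf₆.warr 4 (by decide)
      have w3₆ : s₆.warr 3 = s₅.warr 3 := hf₆.warr 3 (by decide)
      have a12₆ : s₆.arr 12 = s₅.arr 12 := hf₆.arr 12 (by decide)
      have a11₆ : s₆.arr 11 = s₅.arr 11 := hf₆.arr 11 (by decide)
      refine ⟨x, hx, hxDE.2, D', ⟨ρ', ?_⟩, ?_, ?_, by omega⟩
      · rw [w3₆, a12₆]; simpa using hI₅
      · exact ⟨by rw [a11₆]; exact hM₅.disc, by rw [w4₆]; exact hM₅.heap,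
          by rw [w4₆, w3₆]; exact hM₅.leaf⟩
      · rw [h11, w4₆]
  rw [wp_cond]
  refine ⟨fun hc => ?_, fun hc => ?_⟩
  · have hxN : x < N := by simpa [h6₄, hz₄.reg2] using hc
    have h := rest (s₄.arr 12 (s₄.reg 6)) (1 + 1) (by simp [h6₄, a12₄, hxN]) le_rfl
    simpa only [wp_seq, wp_load, wp_copy] using h
  · have hxN : ¬ x < N := by simpa [h6₄, hz₄.reg2] using hc
    have h := rest (s₄.reg 6) (1 + 1) (by simp [h6₄, hxN]) le_rfl
    simpa only [wp_seq, wp_load, wp_copy] using h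

/-- Single-source distances from the node in register `5`. -/
def searchProg : Prog :=
  .seq clearProg <| .seq (.copy 8 5) <| .seq (.wload 2 2 8) <| .seq discoverProg <|
  .seq flagProg (.loop (.less 11 1) extractProg)

theorem searchProg_spec {s : State} {N g src : ℕ} {F hd : ℕ → ℕ} {wt : ℕ → ℝ≥0∞}
    {P : ℕ → ℕ → Prop} (hs : Sized n N s) (ht : Tables n N s)
    (hg : 2 * N = 2 ^ g) (hG : ArcSystem N F hd wt P) (hm : ArcMem N F hd wt s)
    (hsrc : N ≤ src) (hsrc' : src < 2 * N) (h5 : s.reg 5 = src)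
    (hW : 4 * N + 4 ≤ W) (hWF : F (2 * N) < W) :
    WP p r W searchProg s fun T s' =>
      (∃ ρ, SearchResult N (2 * N) src wt (IsArc F hd) P ρ (s'.arr 12) (s'.warr 3)) ∧
      T ≤ 10 * F (2 * N) + 2 * N * (23 * g + 48) + 8 * g + 14 := by
  unfold searchProg
  rw [wp_seq]
  refine (clearProg_spec hs hm.zero hm.infty hW).frame.mono ?_
  rintro T₁ s₁ ⟨⟨a11, w3, w4, hT₁⟩, hf₁⟩
  have hs₁ : Sized n N s₁ := hs.frame hf₁ (by decide)
  have ht₁ : Tables n N s₁ := ht.frame hf₁ (by decide)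
  have hm₁ : ArcMem N F hd wt s₁ := hm.frame hf₁ (by decide)
  have h5₁ : s₁.reg 5 = src := by rw [hf₁.reg 5 (by decide)]; exact h5
  simp only [wp_seq, wp_copy, wp_wload]
  refine (discoverProg_spec (N := N) (g := g) (y := src) (δ := wt src) ?_ ?_ hg ?_ hsrc' ?_ ?_
    hW).frame.mono ?_
  · constructor <;> simp [hs₁.reg0, hs₁.reg1, hs₁.reg2, hs₁.reg3]
  · exact ⟨ht₁.half, ht₁.pred, ht₁.label, ht₁.mul⟩
  · simp [h5₁]
  · simp [h5₁, hm₁.weight]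
  · intro j hj hjN
    simp [w4 j (by omega), w4 (2 * j) (by omega), w4 (2 * j + 1) (by omega)]
  rintro T₂ s₂ ⟨⟨b11, x3, hH, x4, hT₂⟩, hf₂⟩
  have hs₂ : Sized n N s₂ := by
    refine Sized.frame ?_ hf₂ (by decide)
    constructor <;> simp [hs₁.reg0, hs₁.reg1, hs₁.reg2, hs₁.reg3]
  have ht₂ : Tables n N s₂ := by
    refine Tables.frame ?_ hf₂ (by decide)
    exact ⟨ht₁.half, ht₁.pred, ht₁.label, ht₁.mul⟩
  have hm₂ : ArcMem N F hd wt s₂ := by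
    refine ArcMem.frame ?_ hf₂ (by decide)
    exact ⟨hm₁.first, hm₁.head, hm₁.weight, by simpa using hm₁.infty, by simpa using hm₁.zero⟩
  simp only [setWReg_arr, setReg_arr, setWReg_warr, setReg_warr] at b11 x3 x4
  refine (flagProg_spec hs₂ hm₂).frame.mono ?_
  rintro T₃ s₃ ⟨⟨h11, hT₃⟩, hf₃⟩
  have hs₃ : Sized n N s₃ := hs₂.frame hf₃ (by decide)
  have ht₃ : Tables n N s₃ := ht₂.frame hf₃ (by decide)
  have hm₃ : ArcMem N F hd wt s₃ := hm₂.frame hf₃ (by decide)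
  have y4 : s₃.warr 4 = s₂.warr 4 := hf₃.warr 4 (by decide)
  have y3 : s₃.warr 3 = s₂.warr 3 := hf₃.warr 3 (by decide)
  have c11 : s₃.arr 11 = s₂.arr 11 := hf₃.arr 11 (by decide)
  have hI : SearchInv N (2 * N) src wt P ∅ {src} (fun a b => a ∈ (∅ : Finset ℕ) ∧ IsArc F hd a b)
      (fun _ => 0) (s₃.arr 12) (s₃.warr 3) := by
    refine (SearchInv.start hsrc' (hG.wt_ne_top _ hsrc') ?_ ?_).weaken ?_
    · intro y hy hyN
      rw [y3, x3, Function.update_of_ne hy, w3 y hyN]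
    · rw [y3, x3, Function.update_self]
    · rintro a b ⟨h, -⟩
      simp at h
  have hM : SearchMem N ∅ {src} s₃ := by
    refine ⟨fun y hy => ?_, by rw [y4]; exact hH, fun y hy => ?_⟩
    · simp [c11, b11, Function.update_apply, a11 y hy]
    · rw [y4, y3, x4, x3, w4 _ (by omega), Function.update_apply]
      simp only [Finset.mem_singleton, Finset.notMem_empty, not_false_eq_true, and_true]
      split_ifs <;> rfl
  classical
  refine (wp_loop (α := Finset ℕ × Finset ℕ) (fun a s' => a.1 ⊆ Finset.range (2 * N) ∧
    SearchMem N a.1 a.2 s' ∧ (s'.reg 11 = if s'.warr 4 1 = ⊤ then 1 else 0) ∧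
      ∃ ρ, SearchInv N (2 * N) src wt P a.1 a.2 (fun u v => u ∈ a.1 ∧ IsArc F hd u v) ρ
        (s'.arr 12) (s'.warr 3))
    -- A node is extracted at most once, so its extraction and its arcs are paid for in advance; 21
    -- instead of 20 covers the loop test. Over all nodes the arc counts telescope.
    (fun a => ∑ x ∈ Finset.range (2 * N) \ a.1, (10 * (F (x + 1) - F x) + (15 * g + 21)) +
      (8 * g + 20) * (2 * N - a.2.card)) ?_ (∅, {src}) ?_).mono ?_
  · rintro ⟨E, D⟩ s' ⟨hE, hM', h11', ρ, hI'⟩ hf hlt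
    simp only at hE hM' hI'
    have hz : Sized n N s' := hs₃.frame hf (by decide)
    have hne : s'.warr 4 1 ≠ ⊤ := by
      intro h
      simp [h11', h, hz.reg1] at hlt
    refine (extractProg_spec hz (ht₃.frame hf (by decide)) hg hG (hm₃.frame hf (by decide))
      hsrc hI' hM' hne hW hWF).mono ?_
    rintro T s'' ⟨x, D', ρ', hx, hxE, hI'', hM'', h11'', hT⟩
    refine ⟨(insert x E, D'), ⟨?_, hM'', h11'', ρ', hI''⟩, ?_⟩
    · exact Finset.insert_subset (Finset.mem_range.2 hx) hE
    · have hsum : ∑ x ∈ Finset.range (2 * N) \ E, (10 * (F (x + 1) - F x) + (15 * g + 21)) =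
          (10 * (F (x + 1) - F x) + (15 * g + 21)) +
          ∑ x ∈ Finset.range (2 * N) \ insert x E, (10 * (F (x + 1) - F x) + (15 * g + 21)) := by
        rw [Finset.sdiff_insert]
        exact (Finset.add_sum_erase _ _ (by simp [hx, hxE])).symm
      simp only [hsum]
      omega
  · refine ⟨by simp, hM, by rw [h11, y4], _, hI⟩
  · rintro T s' ⟨⟨E, D⟩, ⟨hE, hM', h11', ρ, hI'⟩, hlt, hT, hf⟩
    simp only at hE hM' hI' hT
    have hz : Sized n N s' := hs₃.frame hf (by decide)
    have htop : s'.warr 4 1 = ⊤ := by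
      by_contra h
      simp [h11', h, hz.reg1] at hlt
    refine ⟨⟨ρ, hI'.result fun y hy => ?_⟩, ?_⟩
    -- A discovered unfinished node would have a finite entry, although the root holds +∞.
    · by_contra hyE
      have hyN := hI'.lt y hy
      have := hM'.heap.root_le (2 * N + y) (by omega) (by omega)
      rw [htop, top_le_iff, hM'.leaf y hyN, if_pos ⟨hy, hyE⟩] at this
      exact hI'.ne_top y hy this
    · have htel : ∑ x ∈ Finset.range (2 * N), (F (x + 1) - F x) = F (2 * N) - F 0 :=
        Finset.sum_range_tsub hG.mono _
      have hsum : ∑ x ∈ Finset.range (2 * N), (10 * (F (x + 1) - F x) + (15 * g + 21)) =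
          10 * (F (2 * N) - F 0) + 2 * N * (15 * g + 21) := by
        rw [Finset.sum_add_distrib, ← Finset.mul_sum, htel]
        simp
      rw [Finset.sdiff_empty, hsum] at hT
      rw [Finset.card_singleton] at hT
      have e₁ : (8 * g + 20) * (2 * N - 1) ≤ (8 * g + 20) * (2 * N) := by gcongr; omega
      have e₂ : 2 * N * (23 * g + 48) =
        2 * N * (15 * g + 21) + (8 * g + 20) * (2 * N) + 2 * N * 7 := by ring
      generalize (8 * g + 20) * (2 * N - 1) = z₁ at *
      generalize (8 * g + 20) * (2 * N) = z₂ at *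
      omega

end Dijkstra

/-! ### From searches in the sparse graph to distances in the disk graph -/

section Correctness

variable {n : ℕ} {p : Fin n → Plane} {r : ℝ}

/-- Climb from the leaf as long as the ancestors are full; the climb ends because repeated halving
reaches 0. -/
theorem exists_canon {N m : ℕ} {f : ℕ → Prop} (hm : m < N) (hf : f m) :
    ∃ i, Canon N f ((N + m) / 2 ^ i) := by
  classical
  have hex : ∃ i, ¬ Full N f ((N + m) / 2 ^ i) := by
    refine ⟨N + m, ?_⟩
    rw [Nat.div_eq_of_lt Nat.lt_two_pow_self]
    exact not_full_zero
  have h := Nat.find_spec hex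
  have hmin := @Nat.find_min _ _ hex
  rcases hk : Nat.find hex with _ | i
  · rw [hk] at h
    simp only [pow_zero, Nat.div_one] at h
    exact absurd ((full_leaf hm).2 hf) h
  · refine ⟨i, not_not.1 (hmin (by omega)), ?_⟩
    rw [hk, pow_succ, ← Nat.div_div_eq_div_mul] at h
    exact h

/-- Weights of the input vertices, by index. -/
def inputWeight (w : Fin n → ℝ≥0) (v : ℕ) : ℝ≥0∞ := (initState w).warr 0 v

theorem inputWeight_fin (w : Fin n → ℝ≥0) (v : Fin n) : inputWeight w v = w v := by
  simp [inputWeight, initState]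

theorem inputWeight_ne_top (w : Fin n → ℝ≥0) (v : ℕ) : inputWeight w v ≠ ⊤ := by
  simp only [inputWeight, initState]
  split_ifs <;> simp

/-- All leaves below `y` are close to the leaf `o`. -/
def Covers (p : Fin n → Plane) (r : ℝ) (N : ℕ) (π : ℕ → ℕ) (o y : ℕ) : Prop :=
  Full N (closeTo p r π (o - N)) y

theorem SparseGraph.isArc_internal {N : ℕ} {π : ℕ → ℕ} {s : State} (h : SparseGraph p r N π s)
    {x y : ℕ} (hx : x < N) :
    IsArc (firstArc N (leafArcs p r N π)) (s.arr 9) x y ↔ y = 2 * x ∨ y = 2 * x + 1 := by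
  rw [IsArc, firstArc_internal hx.le, firstArc_internal hx]
  constructor
  · rintro ⟨e, he, he', rfl⟩
    rw [h.internal e (by omega)]
    omega
  · intro hy
    exact ⟨y, by omega, by omega, h.internal y (by omega)⟩

theorem SparseGraph.arcSystem {N : ℕ} {π : ℕ → ℕ} {s : State} {w : Fin n → ℝ≥0}
    (h : SparseGraph p r N π s) (hl : Leaves N (inputWeight w) π s) :
    ArcSystem N (firstArc N (leafArcs p r N π)) (s.arr 9) (s.warr 2) (Covers p r N π) where
  mono := firstArc_mono _ _
  lt x hx y hy := by
    by_cases hxN : x < N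
    · have := (h.isArc_internal hxN).1 hy
      omega
    · obtain ⟨k, rfl⟩ : ∃ k, x = N + k := ⟨x - N, by omega⟩
      exact ((h.leaf k (by omega) y).1 hy).1
  leaf x hx hxN y hy := by
    obtain ⟨k, rfl⟩ : ∃ k, x = N + k := ⟨x - N, by omega⟩
    have := ((h.leaf k (by omega) y).1 hy).2.1
    rwa [Covers, Nat.add_sub_cancel_left]
  internal x hx y hy o ho := by
    have hx0 : 1 ≤ x := Nat.one_le_iff_ne_zero.2 ho.1
    have := (full_node hx0 hx).1 ho
    rcases (h.isArc_internal hx).1 hy with rfl | rfl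
    · exact this.1
    · exact this.2
  wt_ne_top x hx := by
    by_cases hxN : x < N
    · rw [hl.weight_internal x hxN]; simp
    · obtain ⟨k, rfl⟩ : ∃ k, x = N + k := ⟨x - N, by omega⟩
      rw [hl.weight k (by omega)]
      exact inputWeight_ne_top _ _
  wt_internal := hl.weight_internal

variable {N src : ℕ} {π org ρ : ℕ → ℕ} {s : State} {w : Fin n → ℝ≥0} {d : ℕ → ℝ≥0∞}

/-- Relaxed arcs of the sparse graph give relaxed edges of the disk graph. -/
theorem SearchResult.le_of_closeTo (hg : SparseGraph p r N π s)
    (hl : Leaves N (inputWeight w) π s)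
    (h : SearchResult N (2 * N) src (s.warr 2) (IsArc (firstArc N (leafArcs p r N π)) (s.arr 9))
      (Covers p r N π) ρ org d) {k m : ℕ} (hk : k < N) (hm : m < N) (hkm : closeTo p r π k m) :
    d (N + m) ≤ d (N + k) + inputWeight w (π m) := by
  obtain ⟨i, hi⟩ := exists_canon (N := N) hm hkm
  have hlt : ∀ t, (N + m) / 2 ^ t < 2 * N := fun t => (Nat.div_le_self _ _).trans_lt (by omega)
  -- Enter the canonical node above m by an arc of the leaf k and descend to m. The nodes passed on
  -- the way are internal and free, so only the weight of m itself is paid.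
  have step : ∀ t ≤ i, d ((N + m) / 2 ^ (i - t)) ≤ d (N + k) + s.warr 2 ((N + m) / 2 ^ (i - t)) := by
    intro t
    induction t with
    | zero =>
      intro _
      exact h.relaxed (N + k) (by omega) _ ((hg.leaf k hk _).2 ⟨hlt _, hi⟩)
    | succ t ih =>
      intro ht
      have ih := ih (by omega)
      set a := (N + m) / 2 ^ (i - (t + 1)) with ha
      have hpar : (N + m) / 2 ^ (i - t) = a / 2 := by
        rw [ha, Nat.div_div_eq_div_mul, ← pow_succ, show i - (t + 1) + 1 = i - t by omega]
      have haN : a / 2 < N := by have := hlt (i - (t + 1)); omega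
      rw [hpar, hl.weight_internal _ haN, add_zero] at ih
      refine (h.relaxed (a / 2) (by omega) a ((hg.isArc_internal haN).2 (by omega))).trans ?_
      gcongr
  have := step i le_rfl
  rwa [Nat.sub_self, pow_zero, Nat.div_one, hl.weight m hm] at this

theorem walkWeight_cons {G : SimpleGraph (Fin n)} {v v' u : Fin n} (h : G.Adj v v')
    (q : G.Walk v' u) : walkWeight w (SimpleGraph.Walk.cons h q) = w v + walkWeight w q := by
  simp [walkWeight]

theorem NearestOrder.exists_eq (hπ : NearestOrder p N π) (v : Fin n) : ∃ k < n, π k = v := by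
  have hmaps : ∀ k ∈ Finset.range n, π k ∈ Finset.range n := fun k hk =>
    Finset.mem_range.2 (hπ.lt k (Finset.mem_range.1 hk))
  have hinj : ∀ a (_ : a ∈ Finset.range n) b (_ : b ∈ Finset.range n), π a = π b → a = b :=
    fun a ha b hb => hπ.inj a (Finset.mem_range.1 ha) b (Finset.mem_range.1 hb)
  obtain ⟨k, hk, hkv⟩ := Finset.surj_on_of_inj_on_of_card_le (fun k _ => π k) hmaps
    (fun a b ha hb => hinj a ha b hb) le_rfl v (Finset.mem_range.2 v.2)
  exact ⟨k, Finset.mem_range.1 hk, hkv.symm⟩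

/-- The search starts at the target u, and adjacency is symmetric. So an edge from v to v' bounds
the value at v by that at v' plus the weight of v, and both ends are counted because the source
starts with its own weight. -/
theorem SearchResult.le_walkWeight (hg : SparseGraph p r N π s)
    (hl : Leaves N (inputWeight w) π s) (hπ : NearestOrder p N π) (hnN : n ≤ N)
    {ks : ℕ} (hks : ks < n)
    (h : SearchResult N (2 * N) (N + ks) (s.warr 2)
      (IsArc (firstArc N (leafArcs p r N π)) (s.arr 9)) (Covers p r N π) ρ org d)
    {v u : Fin n} (hu : π ks = u) (q : (diskGraph p r).Walk v u) :
    ∀ k < n, π k = v → d (N + k) ≤ walkWeight w q := by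
  induction q with
  | nil =>
    intro k hk hkv
    obtain rfl : k = ks := hπ.inj k hk ks hks (by rw [hkv, hu])
    rw [h.src_eq, hl.weight k (by omega), hkv, inputWeight_fin]
    simp [walkWeight]
  | @cons v v' u hadj q ih =>
    intro k hk hkv
    obtain ⟨k', hk', hkv'⟩ := hπ.exists_eq v'
    have hclose : closeTo p r π k' k := ⟨v', v, hkv', hkv, by rw [dist_comm]; exact hadj.2⟩
    refine (h.le_of_closeTo hg hl (by omega) (by omega) hclose).trans ?_
    rw [walkWeight_cons, ENNReal.coe_add, hkv, inputWeight_fin, add_comm]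
    gcongr
    exact ih hu k' hk' hkv'

/-- The paths along which the search discovered the vertices. -/
theorem SearchResult.exists_path (hl : Leaves N (inputWeight w) π s) (hπ : NearestOrder p N π)
    (hnN : n ≤ N) {ks : ℕ} (hks : ks < n) {R : ℕ → ℕ → Prop}
    (h : SearchResult N (2 * N) (N + ks) (s.warr 2) R (Covers p r N π) ρ org d)
    {u : Fin n} (hu : π ks = u) (m : ℕ) :
    ∀ k < n, ∀ v : Fin n, π k = v → ρ (N + k) = m → d (N + k) ≠ ⊤ →
      ∃ q : (diskGraph p r).Path v u, (walkWeight w q.1 : ℝ≥0∞) = d (N + k) ∧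
        (∀ x ∈ q.1.support, ∀ k' < n, π k' = x → ρ (N + k') ≤ m) ∧
        ∀ e ∈ q.1.darts, ∀ k' < n, π k' = e.fst → s.arr 7 (org (N + k')) = e.snd := by
  -- Induction on the rank, which drops strictly along `org`. The rank bound on the support of the
  -- path from the origin shows that v does not recur, so the extended walk is again a path.
  induction m using Nat.strong_induction_on with
  | _ m ih =>
    intro k hk v hkv hm hd
    rcases eq_or_ne k ks with rfl | hne
    · obtain rfl : v = u := Fin.ext (hkv.symm.trans hu)
      refine ⟨SimpleGraph.Path.nil, ?_, ?_, ?_⟩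
      · rw [h.src_eq, hl.weight k (by omega), hkv, inputWeight_fin]
        simp [walkWeight]
      · intro x hx k' hk' hkx
        obtain rfl : x = v := by simpa using hx
        obtain rfl : k = k' := hπ.inj k hk k' hk' (hkv.trans hkx.symm)
        exact hm.le
      · simp
    · obtain ⟨h₁, h₂, h₃, h₄, h₅, h₆⟩ := h.tree (N + k) (by omega) hd (by omega)
      obtain ⟨k', hk'⟩ : ∃ k', org (N + k) = N + k' := ⟨org (N + k) - N, by omega⟩
      rw [hk'] at h₂ h₃ h₄ h₅ h₆
      rw [Covers, Nat.add_sub_cancel_left, full_leaf (by omega)] at h₃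
      obtain ⟨v', v'', hv', hv'', hdist⟩ := h₃
      obtain rfl : v = v'' := Fin.ext (hkv.symm.trans hv'')
      -- The origin is close to v and hence an input point, while padding positions carry indices
      -- from n on.
      have hk'n : k' < n := by
        by_contra hge
        have := hπ.pad k' (not_lt.1 hge) (by omega)
        have := v'.2
        omega
      have hvv' : v ≠ v' := by
        rintro rfl
        obtain rfl : k = k' := hπ.inj k hk k' hk'n (hkv.trans hv'.symm)
        exact lt_irrefl _ h₆
      have hadj : (diskGraph p r).Adj v v' := ⟨hvv', by rw [dist_comm]; exact hdist⟩
      obtain ⟨q, hq, hsupp, hdarts⟩ := ih (ρ (N + k')) (hm ▸ h₆) k' hk'n v' hv' rfl h₄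
      have hnot : v ∉ q.1.support := fun hv => by
        have := hsupp v hv k hk hkv
        omega
      refine ⟨⟨SimpleGraph.Walk.cons hadj q.1, q.2.cons hnot⟩, ?_, ?_, ?_⟩
      · rw [walkWeight_cons, ENNReal.coe_add, hq, h₅, hl.weight k (by omega), hkv, inputWeight_fin,
          add_comm]
      · intro x hx j hj hjx
        rw [SimpleGraph.Walk.support_cons, List.mem_cons] at hx
        rcases hx with rfl | hx
        · obtain rfl : k = j := hπ.inj k hk j hj (hkv.trans hjx.symm)
          exact hm.le
        · exact (hsupp x hx j hj hjx).trans (by omega)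
      · intro e he j hj hje
        rw [SimpleGraph.Walk.darts_cons, List.mem_cons] at he
        rcases he with rfl | he
        · obtain rfl : k = j := hπ.inj k hk j hj (hkv.trans hje.symm)
          rw [hk', hl.vertex k' (by omega), hv']
        · exact hdarts e he j hj hje

/-- The column of `u` of the distance and the successor matrix is correct. -/
def ColumnSolved (G : SimpleGraph (Fin n)) (w : Fin n → ℝ≥0) (s : State) (u : Fin n) : Prop :=
  (∀ v : Fin n, s.warr 1 ((v : ℕ) * n + u) = vdist G w v u) ∧
  ∀ v : Fin n, v ≠ u → G.Reachable v u →
    ∃ q : G.Path v u, (walkWeight w q.1 : ℝ≥0∞) = vdist G w v u ∧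
      ∀ d ∈ q.1.darts, s.arr 1 ((d.fst : ℕ) * n + u) = d.snd

/-- A search from u fills the column of u: the origin of v in the search tree is the next vertex on
the way from v to u. The discovered path bounds the distance from above, the estimate for arbitrary
walks from below. For unreachable v the successor entry may be anything. -/
theorem SearchResult.columnSolved (hg : SparseGraph p r N π s)
    (hl : Leaves N (inputWeight w) π s) (hπ : NearestOrder p N π) (hnN : n ≤ N)
    {ks : ℕ} (hks : ks < n)
    (h : SearchResult N (2 * N) (N + ks) (s.warr 2)
      (IsArc (firstArc N (leafArcs p r N π)) (s.arr 9)) (Covers p r N π) ρ org d)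
    {u : Fin n} (hu : π ks = u) {s' : State}
    (hdist : ∀ k < n, s'.warr 1 (π k * n + u) = if k = ks then 0 else d (N + k))
    (hsucc : ∀ k < n, s'.arr 1 (π k * n + u) = s.arr 7 (org (N + k))) :
    ColumnSolved (diskGraph p r) w s' u := by
  have key : ∀ (v : Fin n), ∀ k < n, π k = v → v ≠ u → vdist (diskGraph p r) w v u = d (N + k) := by
    intro v k hk hkv hvu
    rw [vdist, if_neg hvu]
    apply le_antisymm
    · by_cases hd : d (N + k) = ⊤
      · rw [hd]; exact le_top
      · obtain ⟨q, hq, -⟩ := h.exists_path hl hπ hnN hks hu _ k hk v hkv rfl hd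
        rw [← hq]
        exact iInf_le _ q
    · exact le_iInf fun q => h.le_walkWeight hg hl hπ hnN hks hu q.1 k hk hkv
  refine ⟨fun v => ?_, fun v hvu hreach => ?_⟩
  · obtain ⟨k, hk, hkv⟩ := hπ.exists_eq v
    rw [← hkv, hdist k hk]
    rcases eq_or_ne v u with rfl | hvu
    · obtain rfl : k = ks := hπ.inj k hk ks hks (hkv.trans hu.symm)
      simp [vdist]
    · rw [key v k hk hkv hvu, if_neg]
      rintro rfl
      exact hvu (Fin.ext (hkv.symm.trans hu))
  · obtain ⟨k, hk, hkv⟩ := hπ.exists_eq v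
    obtain ⟨q₀⟩ := hreach
    have hd : d (N + k) ≠ ⊤ :=
      ne_top_of_le_ne_top ENNReal.coe_ne_top (h.le_walkWeight hg hl hπ hnN hks hu q₀ k hk hkv)
    obtain ⟨q, hq, -, hdarts⟩ := h.exists_path hl hπ hnN hks hu _ k hk v hkv rfl hd
    refine ⟨q, by rw [hq, key v k hk hkv hvu], fun e he => ?_⟩
    obtain ⟨k', hk', hkv'⟩ := hπ.exists_eq e.fst
    rw [← hkv', hsucc k' hk', hdarts e he k' hk' hkv']

end Correctness

/-! ### The whole program -/

section Main

variable {n : ℕ} {p : Fin n → Plane} {r : ℝ} {W : ℕ}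

/-- Writes the outcome of the search from the leaf in register `5` to the output matrices; register
`19` holds `N + n`. -/
def outputProg : Prog :=
  .seq (.load 22 7 5) <| .seq (.copy 18 2) <| .seq
    (.loop (.less 18 19) <|
      .seq (.load 20 7 18) <| .seq (.load 21 6 20) <| .seq (.plus 21 21 22) <|
      .seq (.wload 8 3 18) <| .seq (.wstore 1 21 8) <| .seq (.load 23 12 18) <|
      .seq (.load 23 7 23) <| .seq (.store 1 21 23) (.plus 18 18 1)) <|
  .seq (.load 21 6 22) <| .seq (.plus 21 21 22) <| .seq (.wzero 8) (.wstore 1 21 8)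

theorem index_inj {n v v' u u' : ℕ} (hu : u < n) (hu' : u' < n) (h : v * n + u = v' * n + u') :
    v = v' ∧ u = u' := by
  have hn : 0 < n := by omega
  have h₁ : (v * n + u) / n = v := by
    rw [mul_comm, Nat.mul_add_div hn, Nat.div_eq_of_lt hu, add_zero]
  have h₂ : (v' * n + u') / n = v' := by
    rw [mul_comm, Nat.mul_add_div hn, Nat.div_eq_of_lt hu', add_zero]
  have : v = v' := by rw [← h₁, ← h₂, h]
  subst this
  exact ⟨rfl, by omega⟩

/-- The clause on the other indices protects the columns of earlier searches. The diagonal is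
written separately, since the search counts the weight of its source, whereas the matrix has 0
there. -/
theorem outputProg_spec {s : State} {N ks : ℕ} {π : ℕ → ℕ} {ω : ℕ → ℝ≥0∞} (hs : Sized n N s)
    (ht : Tables n N s) (hl : Leaves N ω π s) (hπ : NearestOrder p N π) (hnN : n ≤ N)
    (h19 : s.reg 19 = N + n) (hks : ks < n) (h5 : s.reg 5 = N + ks)
    (hN : N < 2 * n) (hW : 16 * (n * n) + 64 * n + 64 ≤ W) :
    WP p r W outputProg s fun T s' =>
      (∀ k < n, s'.warr 1 (π k * n + π ks) = if k = ks then 0 else s.warr 3 (N + k)) ∧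
      (∀ k < n, s'.arr 1 (π k * n + π ks) = s.arr 7 (s.arr 12 (N + k))) ∧
      (∀ i, (∀ v < n, i ≠ v * n + π ks) → s'.warr 1 i = s.warr 1 i ∧ s'.arr 1 i = s.arr 1 i) ∧
      T ≤ 10 * n + 10 := by
  have hidx : ∀ v < n, v * n + π ks < 16 * (n * n) + 64 * n + 64 := by
    intro v hv
    have := hπ.lt ks hks
    have : v * n ≤ n * n := by gcongr
    omega
  unfold outputProg
  simp only [wp_seq, wp_load, wp_copy]
  refine (wp_for (m := N + n) (i₀ := N) (B := 9) (fun i s' =>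
    (∀ k, N + k < i → s'.warr 1 (π k * n + π ks) = s.warr 3 (N + k)) ∧
    (∀ k, N + k < i → s'.arr 1 (π k * n + π ks) = s.arr 7 (s.arr 12 (N + k))) ∧
    (∀ i, (∀ v < n, i ≠ v * n + π ks) → s'.warr 1 i = s.warr 1 i ∧ s'.arr 1 i = s.arr 1 i))
    (by decide) ?_ ?_ (by omega) ?_ ?_).mono ?_
  · simp [h19]
  · simp [hs.reg2]
  · rintro i s₁ hi hi' ⟨b1, b2, b3⟩ h18 hf
    obtain ⟨k, rfl⟩ : ∃ k, i = N + k := ⟨i - N, by omega⟩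
    have hk : k < n := by omega
    have r1 : s₁.reg 1 = 1 := by rw [hf.reg 1 (by decide)]; simp [hs.reg1]
    have r22 : s₁.reg 22 = π ks := by
      rw [hf.reg 22 (by decide)]; simp [h5, hl.vertex ks (by omega)]
    have a6 : s₁.arr 6 (π k) = π k * n := by
      rw [hf.arr 6 (by decide)]
      exact ht.mul _ (by have := hπ.lt k hk; omega)
    have a7 : s₁.arr 7 = s.arr 7 := by rw [hf.arr 7 (by decide)]; rfl
    have a12 : s₁.arr 12 = s.arr 12 := by rw [hf.arr 12 (by decide)]; rfl
    have w3 : s₁.warr 3 = s.warr 3 := by rw [hf.warr 3 (by decide)]; rfl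
    have hb := hidx (π k) (hπ.lt k hk)
    have hne : ∀ k', N + k' < N + k → π k' * n + π ks ≠ π k * n + π ks := by
      intro k' hk' h
      have := hπ.inj k' (by omega) k hk (index_inj (hπ.lt ks hks) (hπ.lt ks hks) h).1
      omega
    norm_num [h18, r1, r22, a7, a12, w3, hl.vertex k (by omega), a6]
    refine ⟨by omega, by omega, ?_, ?_, ?_⟩
    · intro k' hk'
      rcases Nat.lt_or_eq_of_le (Nat.le_of_lt_succ (show k' < k + 1 by omega)) with h | rfl
      · rw [Function.update_of_ne (hne k' (by omega))]; exact b1 k' (by omega)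
      · simp
    · intro k' hk'
      rcases Nat.lt_or_eq_of_le (Nat.le_of_lt_succ (show k' < k + 1 by omega)) with h | rfl
      · rw [Function.update_of_ne (hne k' (by omega))]; exact b2 k' (by omega)
      · simp
    · intro i hi
      have := hi (π k) (hπ.lt k hk)
      rw [Function.update_of_ne this, Function.update_of_ne this]
      exact b3 i hi
  · refine ⟨fun k hk => by omega, fun k hk => by omega, fun i hi => by simp⟩
  · rintro T s₁ ⟨⟨b1, b2, b3⟩, h18, hT, hf⟩
    have r22 : s₁.reg 22 = π ks := by
      rw [hf.reg 22 (by decide)]; simp [h5, hl.vertex ks (by omega)]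
    have a6 : s₁.arr 6 (π ks) = π ks * n := by
      rw [hf.arr 6 (by decide)]
      exact ht.mul _ (by have := hπ.lt ks hks; omega)
    have hb := hidx (π ks) (hπ.lt ks hks)
    norm_num [r22, a6]
    refine ⟨by omega, ?_, ?_, ?_, by omega⟩
    · intro k hk
      rcases eq_or_ne k ks with rfl | hne
      · simp
      · rw [if_neg hne, Function.update_of_ne]
        · exact b1 k (by omega)
        · intro h
          exact hne (hπ.inj k hk ks hks (index_inj (hπ.lt ks hks) (hπ.lt ks hks) h).1)
    · exact fun k hk => b2 k (by omega)
    · intro i hi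
      rw [Function.update_of_ne (hi _ (hπ.lt ks hks))]
      exact b3 i hi

/-- All searches, one after the other. -/
def allSearchesProg : Prog :=
  .loop (.less 5 19) <| .seq searchProg <| .seq outputProg (.seq (.const 20 0) (.plus 5 5 1))

theorem allSearchesProg_spec {s : State} {N g : ℕ} {π : ℕ → ℕ} {w : Fin n → ℝ≥0}
    (hs : Sized n N s) (ht : Tables n N s) (hl : Leaves N (inputWeight w) π s)
    (hπ : NearestOrder p N π) (hG : SparseGraph p r N π s) (hnN : n ≤ N) (hN : N < 2 * n)
    (hg : 2 * N = 2 ^ g) (h5 : s.reg 5 = N) (h19 : s.reg 19 = N + n)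
    (hw1 : s.wreg 1 = ⊤) (h20 : s.reg 20 = 0) (hW : 16 * (n * n) + 64 * n + 64 ≤ W)
    (hWF : firstArc N (leafArcs p r N π) (2 * N) < W) :
    WP p r W allSearchesProg s fun T s' =>
      SolvesAPSP (diskGraph p r) w s' ∧
      T ≤ n * (10 * firstArc N (leafArcs p r N π) (2 * N) + 2 * N * (23 * g + 48) + 8 * g +
        10 * n + 27) + 1 := by
  unfold allSearchesProg
  refine (wp_for (m := N + n) (i₀ := N)
    (B := 10 * firstArc N (leafArcs p r N π) (2 * N) + 2 * N * (23 * g + 48) + 8 * g + 10 * n + 26)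
    (fun i s' => s'.reg 20 = 0 ∧ ∀ k, N + k < i → ∀ u : Fin n, π k = u →
      ColumnSolved (diskGraph p r) w s' u)
    (by decide) h19 h5 (by omega) ?_ ?_).mono ?_
  · rintro i s₁ hi hi' ⟨h20, hI⟩ h5 hf
    obtain ⟨ks, rfl⟩ : ∃ k, i = N + k := ⟨i - N, by omega⟩
    have hks : ks < n := by omega
    have hs₁ : Sized n N s₁ := hs.frame hf (by decide)
    have ht₁ : Tables n N s₁ := ht.frame hf (by decide)
    have hl₁ : Leaves N (inputWeight w) π s₁ := hl.frame hf (by decide)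
    have hG₁ : SparseGraph p r N π s₁ := hG.frame hf (by decide)
    have h19₁ : s₁.reg 19 = N + n := by rw [hf.reg 19 (by decide)]; exact h19
    have hm₁ : ArcMem N (firstArc N (leafArcs p r N π)) (s₁.arr 9) (s₁.warr 2) s₁ :=
      ⟨hG₁.first, rfl, rfl, by rw [hf.wreg 1 (by decide)]; exact hw1, h20⟩
    simp only [wp_seq]
    refine (searchProg_spec hs₁ ht₁ hg (hG₁.arcSystem hl₁) hm₁ (by omega) (by omega) h5
      (by omega) hWF).frame.mono ?_
    rintro T₂ s₂ ⟨⟨⟨ρ, hres⟩, hT₂⟩, hf₂⟩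
    have hs₂ : Sized n N s₂ := hs₁.frame hf₂ (by decide)
    have ht₂ : Tables n N s₂ := ht₁.frame hf₂ (by decide)
    have hl₂ : Leaves N (inputWeight w) π s₂ := hl₁.frame hf₂ (by decide)
    have hG₂ : SparseGraph p r N π s₂ := hG₁.frame hf₂ (by decide)
    refine (outputProg_spec hs₂ ht₂ hl₂ hπ hnN (by rw [hf₂.reg 19 (by decide)]; exact h19₁) hks
      (by rw [hf₂.reg 5 (by decide)]; exact h5) hN hW).frame.mono ?_
    rintro T₃ s₃ ⟨⟨hdist, hsucc, hold, hT₃⟩, hf₃⟩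
    have hs₃ : Sized n N s₃ := hs₂.frame hf₃ (by decide)
    have h5₃ : s₃.reg 5 = N + ks := by
      rw [hf₃.reg 5 (by decide), hf₂.reg 5 (by decide)]; exact h5
    -- Register 20 served as scratch space for the output; the program resets it to zero, as the
    -- next search requires.
    norm_num [h5₃, hs₃.reg1]
    refine ⟨by omega, by omega, ?_, by omega⟩
    · intro k hk u hu
      suffices ColumnSolved (diskGraph p r) w s₃ u from this
      rcases Nat.lt_or_eq_of_le (hk) with h | rfl
      · have hold' : ∀ v : Fin n, s₃.warr 1 ((v : ℕ) * n + u) = s₁.warr 1 ((v : ℕ) * n + u) ∧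
            s₃.arr 1 ((v : ℕ) * n + u) = s₁.arr 1 ((v : ℕ) * n + u) := by
          intro v
          have := hold ((v : ℕ) * n + u) (fun v' hv' he => by
            have := (index_inj u.2 (hπ.lt ks hks) he).2
            rw [← hu] at this
            have := hπ.inj k (by omega) ks hks this
            omega)
          rw [this.1, this.2, hf₂.warr 1 (by decide), hf₂.arr 1 (by decide)]
          exact ⟨rfl, rfl⟩
        obtain ⟨c₁, c₂⟩ := hI k (by omega) u hu
        refine ⟨fun v => by rw [(hold' v).1]; exact c₁ v, fun v hv hr => ?_⟩
        obtain ⟨q, hq, hq'⟩ := c₂ v hv hr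
        exact ⟨q, hq, fun e he => by rw [(hold' e.fst).2]; exact hq' e he⟩
      · rw [hu] at hdist hsucc
        have h9 : s₂.arr 9 = s₁.arr 9 := hf₂.arr 9 (by decide)
        have hw2 : s₂.warr 2 = s₁.warr 2 := hf₂.warr 2 (by decide)
        rw [← h9, ← hw2] at hres
        exact hres.columnSolved hG₂ hl₂ hπ hnN hks hu hdist hsucc
  · exact ⟨h20, fun k hk => by omega⟩
  · rintro T s' ⟨⟨-, hI⟩, -, hT, -⟩
    refine ⟨⟨fun v u => ?_, fun v u hvu hr => ?_⟩, ?_⟩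
    · obtain ⟨k, hk, hku⟩ := hπ.exists_eq u
      exact (hI k (by omega) u hku).1 v
    · obtain ⟨k, hk, hku⟩ := hπ.exists_eq u
      exact (hI k (by omega) u hku).2 v hvu hr
    · rwa [Nat.add_sub_cancel_left] at hT

/-- All-pairs shortest paths for nonempty inputs. -/
def nonemptyProg : Prog :=
  .seq sizeProg <| .seq tableProg <| .seq orderProg <| .seq leafProg <| .seq graphProg <|
  .seq (.winfty 1) <| .seq (.const 20 0) <| .seq (.plus 19 2 0) <| .seq (.copy 5 2) allSearchesProg

/-- All-pairs shortest paths in uniform disk graphs. -/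
def apspProg : Prog :=
  .cond (.less 20 0) nonemptyProg (.const 20 0)

theorem nonemptyProg_spec {w : Fin n → ℝ≥0} (hn : 1 ≤ n)
    (hW : 16 * (n * n) + 64 * n + 64 ≤ W) :
    WP p r W nonemptyProg (initState w) fun T s' =>
      SolvesAPSP (diskGraph p r) w s' ∧ ∃ h π, n ≤ 2 ^ h ∧ 2 ^ h < 2 * n ∧
        NearestOrder p (2 ^ h) π ∧
        T ≤ n * (10 * firstArc (2 ^ h) (leafArcs p r (2 ^ h) π) (2 * 2 ^ h) +
          2 * 2 ^ h * (23 * (h + 1) + 48) + 8 * (h + 1) + 134 * n + 300) + 100 := by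
  unfold nonemptyProg
  rw [wp_seq]
  refine (sizeProg_spec (s := initState w) hn (by simp [initState]) (by omega)).frame.mono ?_
  rintro T₁ s₁ ⟨⟨⟨h, hnN, hN, hs₁⟩, hT₁⟩, hf₁⟩
  have hg : 2 * 2 ^ h = 2 ^ (h + 1) := by rw [pow_succ]; ring
  generalize hNdef : 2 ^ h = N at *
  have hN1 : 1 ≤ N := by omega
  rw [wp_seq]
  refine (tableProg_spec hs₁ hN hW).frame.mono ?_
  rintro T₂ s₂ ⟨⟨ht₂, hid, hT₂⟩, hf₂⟩
  have hs₂ : Sized n N s₂ := hs₁.frame hf₂ (by decide)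
  rw [wp_seq]
  refine (orderProg_spec (p := p) hs₂ hid hnN (by omega)).frame.mono ?_
  rintro T₃ s₃ ⟨⟨hπ, hT₃⟩, hf₃⟩
  have hs₃ : Sized n N s₃ := hs₂.frame hf₃ (by decide)
  have ht₃ : Tables n N s₃ := ht₂.frame hf₃ (by decide)
  have hw2 : ∀ x, s₃.warr 2 x = 0 := by
    intro x
    rw [hf₃.warr 2 (by decide), hf₂.warr 2 (by decide), hf₁.warr 2 (by decide)]
    simp [initState]
  have hw0 : s₃.warr 0 = inputWeight w := by
    rw [hf₃.warr 0 (by decide), hf₂.warr 0 (by decide), hf₁.warr 0 (by decide)]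
    rfl
  rw [wp_seq]
  refine (leafProg_spec hs₃ hN hw2 (by omega)).frame.mono ?_
  rintro T₄ s₄ ⟨⟨hl₄, hT₄⟩, hf₄⟩
  rw [hw0] at hl₄
  generalize s₃.arr 5 = π at *
  have hs₄ : Sized n N s₄ := hs₃.frame hf₄ (by decide)
  have ht₄ : Tables n N s₄ := ht₃.frame hf₄ (by decide)
  have ha10 : s₄.arr 10 0 = 0 := by
    rw [hf₄.arr 10 (by decide), hf₃.arr 10 (by decide), hf₂.arr 10 (by decide),
      hf₁.arr 10 (by decide)]
    simp [initState]
  rw [wp_seq]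
  refine (graphProg_spec (p := p) (r := r) hs₄ ht₄ hl₄ hN hN1 ha10 hW).frame.mono ?_
  rintro T₅ s₅ ⟨⟨hG₅, hT₅⟩, hf₅⟩
  have hs₅ : Sized n N s₅ := hs₄.frame hf₅ (by decide)
  have ht₅ : Tables n N s₅ := ht₄.frame hf₅ (by decide)
  have hl₅ : Leaves N (inputWeight w) π s₅ := hl₄.frame hf₅ (by decide)
  have hWF : firstArc N (leafArcs p r N π) (2 * N) < W := by
    rw [two_mul, firstArc_leaf]
    have : ∑ k ∈ Finset.range N, leafArcs p r N π k ≤ ∑ k ∈ Finset.range N, 2 * N :=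
      Finset.sum_le_sum fun k _ => canonCount_le _
    rw [Finset.sum_const, Finset.card_range, smul_eq_mul] at this
    have : N * (2 * N) ≤ (2 * n) * (2 * (2 * n)) := by gcongr
    nlinarith
  simp only [wp_seq, wp_winfty, wp_const, wp_plus, wp_copy]
  refine ⟨by omega, ?_, ?_⟩
  · simp [hs₅.reg0, hs₅.reg2]; omega
  refine (allSearchesProg_spec (p := p) (r := r) (N := N) (g := h + 1) (π := π) (w := w)
    ?_ ?_ ?_ hπ ?_ hnN hN hg ?_ ?_ ?_ ?_ hW hWF).mono ?_
  · constructor <;> simp [hs₅.reg0, hs₅.reg1, hs₅.reg2, hs₅.reg3]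
  · exact ⟨ht₅.half, ht₅.pred, ht₅.label, ht₅.mul⟩
  · exact ⟨hl₅.vertex, hl₅.weight, hl₅.weight_internal⟩
  · exact ⟨hG₅.first, hG₅.internal, hG₅.leaf⟩
  · simp [hs₅.reg2]
  · simp [hs₅.reg0, hs₅.reg2]
  · simp
  · simp
  · rintro T₆ s₆ ⟨hsol, hT₆⟩
    refine ⟨hsol, h, π, by omega, by omega, hNdef ▸ hπ, ?_⟩
    rw [hNdef]
    have e₁ : N * (29 * N + 17) ≤ (2 * n) * (29 * (2 * n) + 17) := by gcongr
    have e₂ : (2 * n) * (29 * (2 * n) + 17) = n * (116 * n + 34) := by ring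
    generalize 10 * firstArc N (leafArcs p r N π) (2 * N) + 2 * N * (23 * (h + 1) + 48) +
      8 * (h + 1) = X at *
    have e₃ : n * (X + 134 * n + 300) = n * (X + 10 * n + 27) + n * (116 * n + 34) +
      n * (8 * n + 6) + 233 * n := by ring
    omega

/-- Empty inputs are set apart because no power of two lies below 2 n when n = 0. -/
theorem apspProg_spec {w : Fin n → ℝ≥0} (hW : 16 * (n * n) + 64 * n + 64 ≤ W) :
    WP p r W apspProg (initState w) fun T s' =>
      SolvesAPSP (diskGraph p r) w s' ∧ (1 ≤ n → ∃ h π, n ≤ 2 ^ h ∧ 2 ^ h < 2 * n ∧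
        NearestOrder p (2 ^ h) π ∧
        T ≤ n * (10 * firstArc (2 ^ h) (leafArcs p r (2 ^ h) π) (2 * 2 ^ h) +
          2 * 2 ^ h * (23 * (h + 1) + 48) + 8 * (h + 1) + 134 * n + 300) + 101) := by
  unfold apspProg
  rw [wp_cond]
  refine ⟨fun hc => ?_, fun hc => ?_⟩
  · have hn : 0 < n := by simpa [initState] using hc
    refine (nonemptyProg_spec (p := p) hn hW).mono ?_
    rintro T s' ⟨hsol, h, π, h₁, h₂, h₃, h₄⟩
    exact ⟨hsol, fun _ => ⟨h, π, h₁, h₂, h₃, by omega⟩⟩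
  · have hn : n = 0 := by simpa [initState] using hc
    subst hn
    rw [wp_const]
    exact ⟨by omega, ⟨fun v => v.elim0, fun v => v.elim0⟩, fun h => by omega⟩

end Main

/-! ### The number of arcs of the sparse graph -/

section Counting

open Classical in
/-- The positions after which `f` changes. -/
noncomputable def crossings (N : ℕ) (f : ℕ → Prop) : Finset ℕ :=
  (Finset.range (N - 1)).filter fun m => ¬ (f m ↔ f (m + 1))

theorem exists_crossing {f : ℕ → Prop} {a b : ℕ} (hab : a ≤ b) (h : ¬ (f a ↔ f b)) :
    ∃ m, a ≤ m ∧ m < b ∧ ¬ (f m ↔ f (m + 1)) := by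
  induction b, hab using Nat.le_induction with
  | base => exact absurd Iff.rfl h
  | succ b hab ih =>
    by_cases hb : f a ↔ f b
    · exact ⟨b, hab, by omega, fun h' => h (hb.trans h')⟩
    · obtain ⟨m, h₁, h₂, h₃⟩ := ih hb
      exact ⟨m, h₁, by omega, h₃⟩

/-- With 2 ^ h leaves, all leaves have the same depth. Applied in both directions, this says that a
common ancestor has the same height above both leaves. -/
theorem depth_le {h a b i j : ℕ} (ha : 2 ^ h ≤ a) (hb : b < 2 ^ (h + 1)) (hpos : 1 ≤ a / 2 ^ i)
    (ha' : a < 2 ^ (h + 1)) (he : a / 2 ^ i = b / 2 ^ j) : j ≤ i := by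
  by_contra hij
  rw [not_le] at hij
  have hih : i ≤ h := by
    by_contra hc
    have : a / 2 ^ i = 0 :=
      Nat.div_eq_of_lt (ha'.trans_le (Nat.pow_le_pow_right (by omega) (by omega)))
    omega
  have h₁ : 2 ^ (h - i) ≤ a / 2 ^ i := by
    rw [Nat.le_div_iff_mul_le (by positivity), ← pow_add, Nat.sub_add_cancel hih]
    exact ha
  have h₂ : b / 2 ^ j < 2 ^ (h - i) := by
    rw [Nat.div_lt_iff_lt_mul (by positivity), ← pow_add]
    exact hb.trans_le (Nat.pow_le_pow_right (by omega) (by omega))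
  omega

theorem exists_leaf_below {h j : ℕ} (hj : 1 ≤ j) (hjN : j < 2 * 2 ^ h) :
    ∃ i k, k < 2 ^ h ∧ (2 ^ h + k) / 2 ^ i = j := by
  have hlog : Nat.log 2 j ≤ h := by
    have := Nat.log_lt_of_lt_pow (b := 2) (x := h + 1) (y := j) (by omega) (by rw [pow_succ]; omega)
    omega
  have h₁ : 2 ^ Nat.log 2 j ≤ j := Nat.pow_log_le_self 2 (by omega)
  have h₂ : j < 2 ^ (Nat.log 2 j + 1) := Nat.lt_pow_succ_log_self (by omega) j
  have h₃ : 2 ^ Nat.log 2 j * 2 ^ (h - Nat.log 2 j) = 2 ^ h := by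
    rw [← pow_add, Nat.add_sub_cancel' hlog]
  have h₄ : 2 ^ h ≤ j * 2 ^ (h - Nat.log 2 j) := by
    rw [← h₃]; gcongr
  have h₅ : j * 2 ^ (h - Nat.log 2 j) < 2 * 2 ^ h := by
    calc j * 2 ^ (h - Nat.log 2 j) < 2 ^ (Nat.log 2 j + 1) * 2 ^ (h - Nat.log 2 j) := by gcongr
      _ = 2 * 2 ^ h := by rw [← h₃, pow_succ]; ring
  refine ⟨h - Nat.log 2 j, j * 2 ^ (h - Nat.log 2 j) - 2 ^ h, by omega, ?_⟩
  rw [Nat.add_sub_cancel' h₄, Nat.mul_div_cancel _ (by positivity)]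

/-- Let j be canonical and not the root. Some leaf below its parent violates f, whereas the leaves
below j satisfy it, so f changes between two consecutive positions below the parent. The parent is
determined by such a position and its own height, and j by the parent and a parity, which gives at
most 2 (h + 1) nodes per crossing. The additional 1 is the root. -/
theorem canonCount_le_crossings (h : ℕ) (f : ℕ → Prop) :
    canonCount (2 ^ h) f (2 * 2 ^ h) ≤ 1 + 2 * (h + 1) * (crossings (2 ^ h) f).card := by
  classical
  set N := 2 ^ h with hN
  have hN2 : 2 ^ (h + 1) = 2 * N := by rw [pow_succ, mul_comm]
  have hsub : (Finset.range (2 * N)).filter (Canon N f) ⊆ insert 1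
      (((Finset.range (h + 1) ×ˢ crossings N f) ×ˢ Finset.range 2).image
        fun a => 2 * ((N + a.1.2) / 2 ^ a.1.1) + a.2) := by
    intro j hj
    rw [Finset.mem_filter, Finset.mem_range] at hj
    obtain ⟨hjN, hfull, hnot⟩ := hj
    rw [Finset.mem_insert, or_iff_not_imp_left]
    intro hj1
    have hj0 : j ≠ 0 := hfull.1
    obtain ⟨i', k', hk', hi'⟩ := exists_leaf_below (h := h) (j := j) (by omega) hjN
    have hfk' := hfull.2 i' k' hk' hi'
    obtain ⟨i, k, hk, hi, hfk⟩ : ∃ i k, k < N ∧ (N + k) / 2 ^ i = j / 2 ∧ ¬ f k := by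
      by_contra hc
      push Not at hc
      exact hnot ⟨by omega, hc⟩
    have hi'' : (N + k') / 2 ^ (i' + 1) = j / 2 := by
      rw [pow_succ, ← Nat.div_div_eq_div_mul, hi']
    obtain rfl : i = i' + 1 := by
      apply le_antisymm
      · exact depth_le (h := h) (a := N + k') (b := N + k) (by omega) (by omega) (by omega)
          (by omega) (by omega)
      · exact depth_le (h := h) (a := N + k) (b := N + k') (by omega) (by omega) (by omega)
          (by omega) (by omega)
    obtain ⟨m, hm, hmN, hmq⟩ : ∃ m, ¬ (f m ↔ f (m + 1)) ∧ m + 1 < N ∧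
        (N + m) / 2 ^ (i' + 1) = j / 2 := by
      rcases le_total k k' with hle | hle
      · obtain ⟨m, h₁, h₂, h₃⟩ := exists_crossing hle (fun hc => hfk (hc.2 hfk'))
        refine ⟨m, h₃, by omega, le_antisymm ?_ ?_⟩
        · rw [← hi'']; exact Nat.div_le_div_right (by omega)
        · rw [← hi]; exact Nat.div_le_div_right (by omega)
      · obtain ⟨m, h₁, h₂, h₃⟩ := exists_crossing hle (fun hc => hfk (hc.1 hfk'))
        refine ⟨m, h₃, by omega, le_antisymm ?_ ?_⟩
        · rw [← hi]; exact Nat.div_le_div_right (by omega)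
        · rw [← hi'']; exact Nat.div_le_div_right (by omega)
    have hih : i' + 1 < h + 1 := by
      by_contra hc
      have : (N + m) / 2 ^ (i' + 1) = 0 :=
        Nat.div_eq_of_lt (lt_of_lt_of_le (by omega) (Nat.pow_le_pow_right (by omega) (not_lt.1 hc)))
      omega
    rw [Finset.mem_image]
    refine ⟨((i' + 1, m), j % 2), ?_, ?_⟩
    · simp only [Finset.mem_product, Finset.mem_range, crossings, Finset.mem_filter]
      exact ⟨⟨hih, by omega, hm⟩, Nat.mod_lt _ (by omega)⟩
    · simp only [hmq]
      omega
  calc canonCount N f (2 * N) ≤ _ := Finset.card_le_card hsub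
    _ ≤ _ := Finset.card_insert_le _ _
    _ ≤ ((Finset.range (h + 1) ×ˢ crossings N f) ×ˢ Finset.range 2).card + 1 := by
        gcongr; exact Finset.card_image_le
    _ = 1 + 2 * (h + 1) * (crossings N f).card := by
        simp only [Finset.card_product, Finset.card_range]; ring

variable {n : ℕ} {p : Fin n → Plane} {r : ℝ}

open Classical in
/-- The points that are close to exactly one of the points with indices `a` and `b`. -/
noncomputable def flips (p : Fin n → Plane) (r : ℝ) (a b : ℕ) : Finset (Fin n) :=
  Finset.univ.filter fun v : Fin n => ¬ (nearIdx p r v a ↔ nearIdx p r v b)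

theorem card_flips_le (a b : ℕ) : (flips p r a b).card ≤ n := by
  simpa using Finset.card_le_univ (flips p r a b)

/-- The sum of the numbers of flips between consecutive points. -/
noncomputable def totalFlips (p : Fin n → Plane) (r : ℝ) (π : ℕ → ℕ) : ℕ :=
  ∑ m ∈ Finset.range (n - 1), (flips p r (π m) (π (m + 1))).card

theorem totalFlips_le (π : ℕ → ℕ) : totalFlips p r π ≤ n * n := by
  calc totalFlips p r π ≤ ∑ m ∈ Finset.range (n - 1), n :=
        Finset.sum_le_sum fun _ _ => card_flips_le _ _
    _ = (n - 1) * n := by simp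
    _ ≤ n * n := by gcongr; omega

/-- Double counting of pairs (k, m) for which closeness to the point in position k changes after
position m: for fixed m, the map π sends these k injectively to points close to exactly one of the
two consecutive points. Padding positions are close to nothing. -/
theorem NearestOrder.sum_crossings_le {N : ℕ} {π : ℕ → ℕ} (hπ : NearestOrder p N π) (hn : 1 ≤ n) :
    ∑ k ∈ Finset.range N, (crossings N (closeTo p r π k)).card ≤ n + totalFlips p r π := by
  classical
  have hlt : ∀ k < N, ∀ m, closeTo p r π k m → k < n := by
    rintro k hk m ⟨v, u, hv, -⟩
    by_contra hge
    have := hπ.pad k (not_lt.1 hge) (by omega)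
    have := v.2
    omega
  have hcol : ∀ m, ((Finset.range N).filter fun k =>
      ¬ (closeTo p r π k m ↔ closeTo p r π k (m + 1))).card ≤
        (flips p r (π m) (π (m + 1))).card := by
    intro m
    rw [← Finset.card_image_of_injective _ (Fin.val_injective)]
    have hkn : ∀ k < N, ¬ (closeTo p r π k m ↔ closeTo p r π k (m + 1)) → k < n := by
      intro k hk h
      by_contra hge
      exact h ⟨fun h' => absurd (hlt k hk _ h') hge, fun h' => absurd (hlt k hk _ h') hge⟩
    refine Finset.card_le_card_of_injOn π ?_ ?_
    · intro k hk
      simp only [Finset.coe_filter, Finset.mem_range, Set.mem_ofPred_eq] at hk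
      simp only [Finset.coe_image, Set.mem_image, Finset.mem_coe]
      exact ⟨⟨π k, hπ.lt k (hkn k hk.1 hk.2)⟩, by simpa [flips, closeTo] using hk.2, rfl⟩
    · intro k hk k' hk' hkk
      simp only [Finset.coe_filter, Finset.mem_range, Set.mem_ofPred_eq] at hk hk'
      exact hπ.inj k (hkn k hk.1 hk.2) k' (hkn k' hk'.1 hk'.2) hkk
  have hzero : ∀ m, n ≤ m → m + 1 < N → (flips p r (π m) (π (m + 1))).card = 0 := by
    intro m hm hmN
    rw [Finset.card_eq_zero, flips, Finset.filter_eq_empty_iff]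
    intro v _
    rw [not_not, hπ.pad m hm (by omega), hπ.pad (m + 1) (by omega) (by omega)]
    constructor
    · rintro ⟨-, u, -, hu, -⟩; have := u.2; omega
    · rintro ⟨-, u, -, hu, -⟩; have := u.2; omega
  calc ∑ k ∈ Finset.range N, (crossings N (closeTo p r π k)).card
      = ∑ m ∈ Finset.range (N - 1), ((Finset.range N).filter fun k =>
          ¬ (closeTo p r π k m ↔ closeTo p r π k (m + 1))).card := by
        simp only [crossings, Finset.card_filter]
        exact Finset.sum_comm
    _ ≤ ∑ m ∈ Finset.range (N - 1), (flips p r (π m) (π (m + 1))).card :=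
        Finset.sum_le_sum fun m _ => hcol m
    _ = ∑ m ∈ (Finset.range (N - 1)).filter (· < n), (flips p r (π m) (π (m + 1))).card := by
        rw [Finset.sum_filter]
        refine Finset.sum_congr rfl fun m hm => ?_
        rw [Finset.mem_range] at hm
        split_ifs with h
        · rfl
        · exact hzero m (not_lt.1 h) (by omega)
    _ ≤ ∑ m ∈ Finset.range n, (flips p r (π m) (π (m + 1))).card := by
        refine Finset.sum_le_sum_of_subset fun m hm => ?_
        rw [Finset.mem_filter] at hm
        exact Finset.mem_range.2 hm.2
    -- The term n pays for m = n - 1, where the input points may give way to padding.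
    _ ≤ n + totalFlips p r π := by
        obtain ⟨n', rfl⟩ : ∃ n', n = n' + 1 := ⟨n - 1, by omega⟩
        rw [Finset.sum_range_succ, totalFlips, Nat.add_sub_cancel, add_comm]
        gcongr
        exact card_flips_le _ _

theorem NearestOrder.firstArc_le {h : ℕ} {π : ℕ → ℕ} (hπ : NearestOrder p (2 ^ h) π) (hn : 1 ≤ n) :
    firstArc (2 ^ h) (leafArcs p r (2 ^ h) π) (2 * 2 ^ h) ≤
      3 * 2 ^ h + 2 * (h + 1) * (n + totalFlips p r π) := by
  have h₁ : ∑ k ∈ Finset.range (2 ^ h), leafArcs p r (2 ^ h) π k ≤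
      ∑ k ∈ Finset.range (2 ^ h), (1 + 2 * (h + 1) * (crossings (2 ^ h) (closeTo p r π k)).card) :=
    Finset.sum_le_sum fun k _ => canonCount_le_crossings h _
  rw [Finset.sum_add_distrib, ← Finset.mul_sum] at h₁
  have h₂ := Nat.mul_le_mul_left (2 * (h + 1)) (hπ.sum_crossings_le (r := r) hn)
  have h₃ : ∑ k ∈ Finset.range (2 ^ h), 1 = 2 ^ h := by simp
  have h₄ : firstArc (2 ^ h) (leafArcs p r (2 ^ h) π) (2 * 2 ^ h) =
      2 * 2 ^ h + ∑ k ∈ Finset.range (2 ^ h), leafArcs p r (2 ^ h) π k := by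
    rw [← firstArc_leaf, two_mul]
  omega

end Counting

/-! ### Counting points by areas -/

section Geometry

open MeasureTheory

variable {n : ℕ} {p : Fin n → Plane} {r : ℝ}

/-- Each coordinate differs by less than 1 / a; the constant 2 replaces √2. The lemma serves both
the density grid and the packing argument. -/
theorem dist_lt_of_floor_eq {a : ℝ} (ha : 0 < a) {x y : Plane} (h0 : ⌊x 0 * a⌋ = ⌊y 0 * a⌋)
    (h1 : ⌊x 1 * a⌋ = ⌊y 1 * a⌋) : dist x y < 2 / a := by
  have h0' := Int.abs_sub_lt_one_of_floor_eq_floor h0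
  have h1' := Int.abs_sub_lt_one_of_floor_eq_floor h1
  rw [← sub_mul] at h0' h1'
  have e0 : ((x 0 - y 0) * a) ^ 2 < 1 := by rw [← sq_abs]; nlinarith [abs_nonneg ((x 0 - y 0) * a)]
  have e1 : ((x 1 - y 1) * a) ^ 2 < 1 := by rw [← sq_abs]; nlinarith [abs_nonneg ((x 1 - y 1) * a)]
  rw [EuclideanSpace.dist_eq, Fin.sum_univ_two, Real.sqrt_lt' (by positivity), div_pow,
    lt_div_iff₀ (by positivity), Real.dist_eq, Real.dist_eq, sq_abs, sq_abs]
  nlinarith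

theorem volume_gridCell (hn : 1 ≤ n) (c : ℤ × ℤ) :
    MeasurableSet {z : Plane | gridCell n z = c} ∧
      volume {z : Plane | gridCell n z = c} = ENNReal.ofReal (1 / n) := by
  have hs : 0 < √(n : ℝ) := Real.sqrt_pos.2 (by exact_mod_cast hn)
  set cc : Fin 2 → ℝ := ![(c.1 : ℝ), (c.2 : ℝ)] with hcc
  have hset : {z : Plane | gridCell n z = c} = (WithLp.ofLp : Plane → Fin 2 → ℝ) ⁻¹'
      (Set.pi Set.univ fun i => Set.Ico (cc i / √(n : ℝ)) ((cc i + 1) / √(n : ℝ))) := by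
    ext z
    have hz : z ∈ {z : Plane | gridCell n z = c} ↔ gridCell n z = c := Iff.rfl
    rw [hz, gridCell, Prod.ext_iff]
    simp only [Int.floor_eq_iff, Set.mem_preimage, Set.mem_univ_pi, Fin.forall_fin_two, hcc,
      Set.mem_Ico, div_le_iff₀ hs, lt_div_iff₀ hs]
    simp
  have hm : MeasurableSet (Set.pi Set.univ fun i =>
      Set.Ico (cc i / √(n : ℝ)) ((cc i + 1) / √(n : ℝ))) :=
    MeasurableSet.univ_pi fun i => measurableSet_Ico
  rw [hset]
  refine ⟨(PiLp.volume_preserving_ofLp (Fin 2)).measurable hm, ?_⟩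
  rw [(PiLp.volume_preserving_ofLp (Fin 2)).measure_preimage hm.nullMeasurableSet, Real.volume_pi_Ico,
    Fin.prod_univ_two, ← ENNReal.ofReal_mul]
  · congr 1
    have : √(n : ℝ) * √(n : ℝ) = n := Real.mul_self_sqrt (by positivity)
    rw [← sub_div, ← sub_div, add_sub_cancel_left, add_sub_cancel_left, div_mul_div_comm, this,
      one_mul]
  · rw [← sub_div, add_sub_cancel_left]; positivity

/-- Points whose grid cells lie in a set of area `c` are at most `β n c` in number. -/
theorem IsDense.card_le {β : ℕ} (hβ : IsDense β p) (hn : 1 ≤ n) (F : Finset (Fin n))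
    {A : Set Plane} (hA : ∀ v ∈ F, ∀ z, gridCell n z = gridCell n (p v) → z ∈ A) {c : ℝ}
    (hc : 0 ≤ c) (hvol : volume A ≤ ENNReal.ofReal c) : (F.card : ℝ) ≤ β * (n * c) := by
  classical
  set cells := F.image fun v => gridCell n (p v) with hcells
  have h₁ : F.card ≤ β * cells.card := by
    refine Finset.card_le_mul_card_image F β fun b _ => ?_
    refine le_trans ?_ (hβ b)
    rw [← Set.ncard_coe_finset]
    refine Set.ncard_le_ncard ?_ (Set.toFinite _)
    intro v hv
    simp only [Finset.coe_filter] at hv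
    exact hv.2
  -- The occupied cells are disjoint parts of A of area 1 / n each.
  have hvolA : (cells.card : ℝ≥0∞) * ENNReal.ofReal (1 / n) ≤ ENNReal.ofReal c := by
    calc (cells.card : ℝ≥0∞) * ENNReal.ofReal (1 / n)
        = ∑ c ∈ cells, volume {z : Plane | gridCell n z = c} := by
          rw [Finset.sum_congr rfl fun c _ => (volume_gridCell hn c).2, Finset.sum_const,
            nsmul_eq_mul]
      _ = volume (⋃ c ∈ cells, {z : Plane | gridCell n z = c}) := by
          refine (measure_biUnion_finset ?_ fun c _ => (volume_gridCell hn c).1).symm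
          intro c _ c' _ hcc
          rw [Function.onFun, Set.disjoint_left]
          intro z hz hz'
          exact hcc (Eq.trans (Eq.symm hz) hz')
      _ ≤ volume A := by
          refine measure_mono ?_
          intro z hz
          simp only [Set.mem_iUnion] at hz
          obtain ⟨c, hc, hz⟩ := hz
          obtain ⟨v, hv, rfl⟩ := Finset.mem_image.1 hc
          exact hA v hv z hz
      _ ≤ ENNReal.ofReal c := hvol
  have hn0 : (0 : ℝ) < n := by exact_mod_cast hn
  have h₂ : (cells.card : ℝ) ≤ n * c := by
    rw [← ENNReal.ofReal_natCast, ← ENNReal.ofReal_mul (by positivity),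
      ENNReal.ofReal_le_ofReal_iff hc, mul_one_div, div_le_iff₀ hn0] at hvolA
    linarith
  calc (F.card : ℝ) ≤ ((β * cells.card : ℕ) : ℝ) := by exact_mod_cast h₁
    _ = β * cells.card := by push_cast; rfl
    _ ≤ β * (n * c) := by gcongr

theorem volume_closedBall_eq (x : Plane) {R : ℝ} (hR : 0 ≤ R) :
    volume (Metric.closedBall x R) = ENNReal.ofReal (Real.pi * R ^ 2) := by
  rw [EuclideanSpace.volume_closedBall_fin_two, ← ENNReal.ofReal_pow hR, ← ENNReal.ofReal_mul (by positivity),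
    mul_comm]

theorem volume_annulus (x : Plane) {r e : ℝ} (he : 0 ≤ e) (her : e ≤ r) :
    volume (Metric.closedBall x (r + e) \ Metric.closedBall x (r - e)) =
      ENNReal.ofReal (4 * Real.pi * (r * e)) := by
  rw [measure_sdiff (Metric.closedBall_subset_closedBall (by linarith))
    measurableSet_closedBall.nullMeasurableSet
    (by rw [volume_closedBall_eq x (by linarith)]; exact ENNReal.ofReal_ne_top),
    volume_closedBall_eq x (by linarith), volume_closedBall_eq x (by linarith),
    ← ENNReal.ofReal_sub _ (by have := Real.pi_pos; positivity)]
  congr 1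
  ring

theorem mem_flips {a b : Fin n} {v : Fin n} :
    v ∈ flips p r a b ↔ ¬ (dist (p v) (p a) ≤ r ↔ dist (p v) (p b) ≤ r) := by
  have h : ∀ c : Fin n, nearIdx p r v c ↔ dist (p v) (p c) ≤ r := by
    intro c
    constructor
    · rintro ⟨v', c', hv, hc, hd⟩
      obtain rfl := Fin.ext hv
      obtain rfl := Fin.ext hc
      exact hd
    · intro hd
      exact ⟨v, c, rfl, rfl, hd⟩
  simp [flips, h]

/-- Few points are close to exactly one of two nearby points. -/
theorem IsDense.card_flips_le {β : ℕ} (hβ : IsDense β p) (hn : 1 ≤ n) (hr : 1 ≤ r * √(n : ℝ))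
    (a b : Fin n) :
    ((flips p r a b).card : ℝ) ≤ 60 * (β * (n * (r * (dist (p a) (p b) + 2 / √(n : ℝ))))) := by
  have hs : 0 < √(n : ℝ) := Real.sqrt_pos.2 (by exact_mod_cast hn)
  have hr0 : 0 < r := by by_contra h; nlinarith [not_lt.1 h]
  have hpi := Real.pi_pos
  have hpi' := Real.pi_lt_d2
  have hδr : 1 / √(n : ℝ) ≤ r := by rw [div_le_iff₀ hs]; exact hr
  set d := dist (p a) (p b) with hd
  have hd0 : 0 ≤ d := dist_nonneg
  set δ := 2 / √(n : ℝ) with hδ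
  have hδ0 : 0 < δ := by positivity
  have hδr' : δ ≤ 2 * r := by rw [hδ, show 2 / √(n : ℝ) = 2 * (1 / √(n : ℝ)) by ring]; linarith
  have hcell : ∀ v z, gridCell n z = gridCell n (p v) → dist z (p v) < δ := by
    intro v z h
    rw [gridCell, gridCell, Prod.ext_iff] at h
    exact dist_lt_of_floor_eq hs h.1 h.2
  have hpos : 0 ≤ r * (d + δ) := by positivity
  -- The region has to contain the whole cell of every counted point, hence the margin δ. If d + δ ≤
  -- r, it is an annulus of area 4 π r (d + δ). Otherwise two disks of radius 3 r ≥ r + δ suffice,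
  -- and their area 18 π r² is at most 18 π r (d + δ). Finally 18 π < 60.
  have key : ((flips p r a b).card : ℝ) ≤ β * (n * (18 * Real.pi * (r * (d + δ)))) := by
    by_cases her : d + δ ≤ r
    · refine hβ.card_le hn _
        (A := Metric.closedBall (p a) (r + (d + δ)) \ Metric.closedBall (p a) (r - (d + δ)))
        ?_ (by positivity) ?_
      · intro v hv z hz
        rw [mem_flips] at hv
        have hzv := hcell v z hz
        have t₁ := dist_triangle z (p v) (p a)
        have t₂ := dist_triangle (p v) z (p a)
        have t₃ := dist_triangle (p v) (p a) (p b)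
        have t₄ := dist_triangle (p v) (p b) (p a)
        rw [dist_comm (p v) z] at t₂
        rw [dist_comm (p b) (p a)] at t₄
        rw [Set.mem_sdiff, Metric.mem_closedBall, Metric.mem_closedBall]
        by_cases h : dist (p v) (p a) ≤ r
        · have h' : r < dist (p v) (p b) := by
            by_contra hc
            exact hv ⟨fun _ => not_lt.1 hc, fun _ => h⟩
          constructor <;> linarith
        · have h' : dist (p v) (p b) ≤ r := by
            by_contra hc
            exact hv ⟨fun h'' => absurd h'' h, fun h'' => absurd h'' hc⟩
          constructor <;> linarith
      · rw [volume_annulus _ (by positivity) her]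
        apply ENNReal.ofReal_le_ofReal
        nlinarith [mul_nonneg hpi.le hpos]
    · refine hβ.card_le hn _
        (A := Metric.closedBall (p a) (3 * r) ∪ Metric.closedBall (p b) (3 * r)) ?_ (by positivity) ?_
      · intro v hv z hz
        rw [mem_flips] at hv
        have hzv := hcell v z hz
        have t₁ := dist_triangle z (p v) (p a)
        have t₂ := dist_triangle z (p v) (p b)
        rw [Set.mem_union, Metric.mem_closedBall, Metric.mem_closedBall]
        by_cases h : dist (p v) (p a) ≤ r
        · left; linarith
        · have h' : dist (p v) (p b) ≤ r := by
            by_contra hc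
            exact hv ⟨fun h'' => absurd h'' h, fun h'' => absurd h'' hc⟩
          right; linarith
      · refine (measure_union_le _ _).trans ?_
        rw [volume_closedBall_eq _ (by positivity), volume_closedBall_eq _ (by positivity),
          ← ENNReal.ofReal_add (by positivity) (by positivity)]
        apply ENNReal.ofReal_le_ofReal
        have : r * r ≤ r * (d + δ) := by gcongr; exact (not_le.1 her).le
        nlinarith [mul_le_mul_of_nonneg_left this hpi.le]
  refine key.trans ?_
  have : (β : ℝ) * (n * (18 * Real.pi * (r * (d + δ)))) =
      (18 * Real.pi) * (β * (n * (r * (d + δ)))) := by ring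
  rw [this]
  gcongr
  linarith

/-! ### The length of the nearest neighbour order -/

theorem idist_fin (a b : Fin n) : idist p a b = dist (p a) (p b) := by
  simp [idist]

theorem InUnitSquare.dist_le (hp : InUnitSquare p) (a b : Fin n) : dist (p a) (p b) ≤ 2 := by
  rw [EuclideanSpace.dist_eq, Fin.sum_univ_two, Real.sqrt_le_iff, Real.dist_eq, Real.dist_eq, sq_abs,
    sq_abs]
  have a0 := hp a 0
  have a1 := hp a 1
  have b0 := hp b 0
  have b1 := hp b 1
  constructor
  · norm_num
  · nlinarith

/-- The rounded length of a step of the order, in units of `1 / √n`. -/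
noncomputable def stepLength (p : Fin n → Plane) (π : ℕ → ℕ) (m : ℕ) : ℕ :=
  ⌊idist p (π m) (π (m + 1)) * √(n : ℝ)⌋₊

theorem InUnitSquare.idist_le (hp : InUnitSquare p) (a b : ℕ) : idist p a b ≤ 2 := by
  unfold idist
  split_ifs
  · exact hp.dist_le _ _
  · norm_num

theorem idist_nonneg (a b : ℕ) : 0 ≤ idist p a b := by
  unfold idist
  split_ifs
  · exact dist_nonneg
  · exact le_rfl

theorem InUnitSquare.stepLength_le (hp : InUnitSquare p) (π : ℕ → ℕ) (m : ℕ) :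
    stepLength p π m ≤ 2 * n := by
  refine Nat.floor_le_of_le ?_
  push_cast
  have h : √(n : ℝ) ≤ n := by
    rcases Nat.eq_zero_or_pos n with rfl | h
    · simp
    · rw [Real.sqrt_le_left (by positivity)]
      have : (1 : ℝ) ≤ n := by exact_mod_cast h
      nlinarith
  have := hp.idist_le (π m) (π (m + 1))
  gcongr

/-- Long steps of the nearest neighbour order start at points that are far apart from each other. -/
theorem NearestOrder.card_long_steps_le {N : ℕ} {π : ℕ → ℕ} (hπ : NearestOrder p N π)
    (hp : InUnitSquare p) (hn : 1 ≤ n) {j : ℕ} (hj : 1 ≤ j) :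
    (((Finset.range (n - 1)).filter fun m => j ≤ stepLength p π m).card : ℝ) ≤
      16 * n * ((j : ℝ) ^ 2)⁻¹ := by
  set S := (Finset.range (n - 1)).filter fun m => j ≤ stepLength p π m with hS
  have hs : 0 < √(n : ℝ) := Real.sqrt_pos.2 (by exact_mod_cast hn)
  have hj0 : (0 : ℝ) < j := by exact_mod_cast hj
  have hmem : ∀ m ∈ S, m + 1 < n ∧ (j : ℝ) ≤ idist p (π m) (π (m + 1)) * √(n : ℝ) := by
    intro m hm
    rw [hS, Finset.mem_filter, Finset.mem_range, stepLength, Nat.le_floor_iff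
      (mul_nonneg (idist_nonneg _ _) hs.le)] at hm
    exact ⟨by omega, hm.2⟩
  rcases S.eq_empty_or_nonempty with he | ⟨m₀, hm₀⟩
  · rw [he]; simp only [Finset.card_empty, Nat.cast_zero]; positivity
  -- A long step exists and has length at most 2. This makes a ≥ 1 below, so that ⌊a⌋ + 1 ≤ 2 a.
  have hj2 : (j : ℝ) ≤ 2 * √(n : ℝ) := by
    refine (hmem m₀ hm₀).2.trans ?_
    gcongr
    exact hp.idist_le _ _
  -- Cells of side 1 / a are chosen so that two points in one cell are closer than 2 / a = j / √n.
  set a : ℝ := 2 * √(n : ℝ) / j with ha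
  have ha1 : 1 ≤ a := by rw [ha, le_div_iff₀ hj0]; linarith
  have ha0 : 0 < a := by linarith
  set pt : ℕ → Plane := fun m => if h : π m < n then p ⟨π m, h⟩ else 0 with hpt
  have hptv : ∀ m (h : m < n), pt m = p ⟨π m, hπ.lt m h⟩ := fun m h => by
    simp only [hpt, hπ.lt m h, dite_true]
  have hid : ∀ m m', m < n → m' < n → idist p (π m) (π m') = dist (pt m) (pt m') := by
    intro m m' hm hm'
    rw [hptv m hm, hptv m' hm', ← idist_fin]
  set box := Finset.range (⌊a⌋₊ + 1) ×ˢ Finset.range (⌊a⌋₊ + 1) with hbox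
  have hcard : S.card ≤ box.card := by
    refine Finset.card_le_card_of_injOn (fun m => (⌊pt m 0 * a⌋₊, ⌊pt m 1 * a⌋₊)) ?_ ?_
    · intro m hm
      have hmn : m < n := by have := (hmem m hm).1; omega
      have h0 := hp ⟨π m, hπ.lt m hmn⟩ 0
      have h1 := hp ⟨π m, hπ.lt m hmn⟩ 1
      rw [← hptv m hmn] at h0 h1
      simp only [hbox, Finset.coe_product, Set.mem_prod, Finset.mem_coe, Finset.mem_range,
        Nat.lt_succ_iff]
      constructor <;> apply Nat.floor_le_floor <;> nlinarith
    -- If two long steps started in one cell, the greedy choice at the earlier start could not have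
    -- been worse than the later start, which is less than j / √n away.
    · have hlt : ∀ m ∈ S, ∀ m' ∈ S, m < m' →
          (⌊pt m 0 * a⌋₊, ⌊pt m 1 * a⌋₊) ≠ (⌊pt m' 0 * a⌋₊, ⌊pt m' 1 * a⌋₊) := by
        intro m hm m' hm' hmm he
        have hmn : m < n := by have := (hmem m hm).1; omega
        have hmn' : m' < n := by have := (hmem m' hm').1; omega
        have q := hp ⟨π m, hπ.lt m hmn⟩
        have q' := hp ⟨π m', hπ.lt m' hmn'⟩
        rw [← hptv m hmn] at q
        rw [← hptv m' hmn'] at q'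
        rw [Prod.ext_iff] at he
        have hfl : ∀ i : Fin 2, ⌊pt m i * a⌋₊ = ⌊pt m' i * a⌋₊ → ⌊pt m i * a⌋ = ⌊pt m' i * a⌋ := by
          intro i hi
          rw [← Int.natCast_floor_eq_floor (mul_nonneg (q i).1 ha0.le),
            ← Int.natCast_floor_eq_floor (mul_nonneg (q' i).1 ha0.le), hi]
        have hd := dist_lt_of_floor_eq ha0 (hfl 0 he.1) (hfl 1 he.2)
        have hnear := hπ.nearest m m' hmm hmn'
        rw [hid m m' hmn hmn'] at hnear
        have hstep := (hmem m hm).2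
        have h2a : 2 / a * √(n : ℝ) = j := by rw [ha]; field_simp
        have : (j : ℝ) < j := by
          calc (j : ℝ) ≤ idist p (π m) (π (m + 1)) * √(n : ℝ) := hstep
            _ ≤ dist (pt m) (pt m') * √(n : ℝ) := by gcongr
            _ < 2 / a * √(n : ℝ) := by gcongr
            _ = j := h2a
        exact lt_irrefl _ this
      intro m hm m' hm' he
      rcases lt_trichotomy m m' with h | h | h
      · exact absurd he (hlt m hm m' hm' h)
      · exact h
      · exact absurd he.symm (hlt m' hm' m hm h)
  have hfl : (⌊a⌋₊ : ℝ) ≤ a := Nat.floor_le ha0.le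
  have hnn : √(n : ℝ) ^ 2 = n := Real.sq_sqrt (by positivity)
  have hbox' : ∀ σ J : ℝ, J ≠ 0 →
      (2 * (2 * σ / J)) * (2 * (2 * σ / J)) = 16 * σ ^ 2 * (J ^ 2)⁻¹ := by
    intro σ J hJ
    field_simp
    ring
  calc (S.card : ℝ) ≤ (box.card : ℝ) := by exact_mod_cast hcard
    _ = ((⌊a⌋₊ : ℝ) + 1) * ((⌊a⌋₊ : ℝ) + 1) := by simp [hbox]
    _ ≤ (2 * a) * (2 * a) := by gcongr <;> linarith
    _ = 16 * n * ((j : ℝ) ^ 2)⁻¹ := by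
        rw [ha, hbox' _ _ hj0.ne', hnn]

/-- Each length is summed layer by layer, as the number of thresholds j ≥ 1 that it reaches.
Exchanging the sums leaves 16 n / j² per threshold, and the sum of 1 / j² is at most 2. -/
theorem NearestOrder.sum_stepLength_le {N : ℕ} {π : ℕ → ℕ} (hπ : NearestOrder p N π)
    (hp : InUnitSquare p) (hn : 1 ≤ n) :
    ((∑ m ∈ Finset.range (n - 1), stepLength p π m : ℕ) : ℝ) ≤ 32 * n := by
  have hlayer : ∀ m, stepLength p π m =
      ∑ j ∈ Finset.Ioo 0 (2 * n + 1), if j ≤ stepLength p π m then 1 else 0 := by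
    intro m
    have hle := hp.stepLength_le π m
    rw [← Finset.card_filter]
    have : (Finset.Ioo 0 (2 * n + 1)).filter (fun j => j ≤ stepLength p π m) =
        Finset.Icc 1 (stepLength p π m) := by
      ext j
      simp only [Finset.mem_filter, Finset.mem_Ioo, Finset.mem_Icc]
      omega
    rw [this]
    simp
  have hsum : ∑ m ∈ Finset.range (n - 1), stepLength p π m = ∑ j ∈ Finset.Ioo 0 (2 * n + 1),
      ((Finset.range (n - 1)).filter fun m => j ≤ stepLength p π m).card := by
    rw [Finset.sum_congr rfl fun m _ => hlayer m, Finset.sum_comm]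
    refine Finset.sum_congr rfl fun j _ => ?_
    rw [Finset.card_filter]
  rw [hsum, Nat.cast_sum]
  calc _ ≤ ∑ j ∈ Finset.Ioo 0 (2 * n + 1), 16 * (n : ℝ) * ((j : ℝ) ^ 2)⁻¹ :=
        Finset.sum_le_sum fun j hj =>
          hπ.card_long_steps_le hp hn (Finset.mem_Ioo.1 hj).1
    _ = 16 * n * ∑ j ∈ Finset.Ioo 0 (2 * n + 1), ((j : ℝ) ^ 2)⁻¹ := by rw [Finset.mul_sum]
    _ ≤ 16 * n * (2 / ((0 : ℕ) + 1)) := by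
        gcongr
        exact sum_Ioo_inv_sq_le 0 (2 * n + 1)
    _ = 32 * n := by norm_num; ring

theorem NearestOrder.totalFlips_le {N β : ℕ} {π : ℕ → ℕ} (hπ : NearestOrder p N π)
    (hp : InUnitSquare p) (hβ : IsDense β p) (hn : 1 ≤ n) (hr : 1 ≤ r * √(n : ℝ)) :
    (totalFlips p r π : ℝ) ≤ 2100 * (β * (r * (√(n : ℝ) * n))) := by
  have hs : 0 < √(n : ℝ) := Real.sqrt_pos.2 (by exact_mod_cast hn)
  have hr0 : 0 < r := by by_contra h; nlinarith [not_lt.1 h]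
  have hnn : √(n : ℝ) * √(n : ℝ) = n := Real.mul_self_sqrt (by positivity)
  -- In units of 1 / √n, the 3 consists of 2 for the cell diameter and 1 for rounding the step down.
  -- Summation then yields 60 · (32 + 3) = 2100.
  have hstep : ∀ m ∈ Finset.range (n - 1), ((flips p r (π m) (π (m + 1))).card : ℝ) ≤
      60 * (β * (r * √(n : ℝ))) * (stepLength p π m + 3) := by
    intro m hm
    rw [Finset.mem_range] at hm
    have h := hβ.card_flips_le hn hr ⟨π m, hπ.lt m (by omega)⟩ ⟨π (m + 1), hπ.lt _ (by omega)⟩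
    rw [← idist_fin] at h
    refine h.trans ?_
    have hfl : idist p (π m) (π (m + 1)) * √(n : ℝ) ≤ stepLength p π m + 1 :=
      (Nat.lt_floor_add_one _).le
    have e : ∀ σ i : ℝ, 0 < σ → σ * σ * (r * (i + 2 / σ)) = r * σ * (i * σ + 2) := by
      intro σ i hσ
      field_simp
    have e' := e √(n : ℝ) (idist p (π m) (π (m + 1))) hs
    rw [hnn] at e'
    have hassoc : 60 * (β * (r * √(n : ℝ))) * ((stepLength p π m : ℝ) + 3) =
        60 * (β * (r * √(n : ℝ) * (stepLength p π m + 3))) := by ring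
    rw [hassoc, e']
    gcongr 60 * (_ * (_ * ?_))
    linarith
  have hlen := hπ.sum_stepLength_le hp hn
  push_cast at hlen
  rw [totalFlips, Nat.cast_sum]
  calc _ ≤ ∑ m ∈ Finset.range (n - 1),
          60 * (β * (r * √(n : ℝ))) * ((stepLength p π m : ℝ) + 3) := Finset.sum_le_sum hstep
    _ = 60 * (β * (r * √(n : ℝ))) *
          (∑ m ∈ Finset.range (n - 1), (stepLength p π m : ℝ) + 3 * ((n - 1 : ℕ) : ℝ)) := by
        rw [← Finset.mul_sum, Finset.sum_add_distrib]; simp [mul_comm]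
    _ ≤ 60 * (β * (r * √(n : ℝ))) * (32 * n + 3 * n) := by
        gcongr
        omega
    _ = 2100 * (β * (r * (√(n : ℝ) * n))) := by ring

end Geometry

/-! ### Arithmetic of the running time -/

section Bound

theorem time_le {n h Y T F : ℕ} (hn : 1 ≤ n) (hN : 2 ^ h < 2 * n)
    (hF : F ≤ 3 * 2 ^ h + 2 * (h + 1) * (n + Y))
    (hT : T ≤ n * (10 * F + 2 * 2 ^ h * (23 * (h + 1) + 48) + 8 * (h + 1) + 134 * n + 300) + 101) :
    T ≤ 1000 * (n * ((h + 1) * (n + Y))) := by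
  have e₁ : 1 ≤ (h + 1) * (n + Y) := Nat.mul_pos (by omega) (by omega)
  have e₂ : n ≤ (h + 1) * (n + Y) := by nlinarith
  have e₃ : 2 * 2 ^ h * (23 * (h + 1) + 48) ≤ 4 * n * (71 * (h + 1)) :=
    Nat.mul_le_mul (by omega) (by omega)
  have e₄ : 4 * n * (71 * (h + 1)) ≤ 284 * ((h + 1) * (n + Y)) := by nlinarith
  have e₅ : h + 1 ≤ (h + 1) * (n + Y) := Nat.le_mul_of_pos_right _ (by omega)
  have e₆ : 10 * F + 2 * 2 ^ h * (23 * (h + 1) + 48) + 8 * (h + 1) + 134 * n + 300 ≤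
      899 * ((h + 1) * (n + Y)) := by
    have : 2 * (h + 1) * (n + Y) = 2 * ((h + 1) * (n + Y)) := by ring
    omega
  have e₇ := Nat.mul_le_mul_left n e₆
  have e₈ : 1 ≤ n * ((h + 1) * (n + Y)) := Nat.mul_pos (by omega) (by omega)
  have e₉ : n * (899 * ((h + 1) * (n + Y))) = 899 * (n * ((h + 1) * (n + Y))) := by ring
  omega

/-- From 2 ^ (h + 1) ≤ 4 n ≤ (n + 2)² and log 2 > 1/2. -/
theorem depth_le_log {n h : ℕ} (hn : 1 ≤ n) (hN : 2 ^ h < 2 * n) :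
    ((h : ℝ) + 1) ≤ 4 * Real.log ((n : ℝ) + 2) := by
  have hn' : (1 : ℝ) ≤ n := by exact_mod_cast hn
  have h₁ : (2 : ℝ) ^ (h + 1) ≤ 4 * n := by
    have : 2 ^ (h + 1) ≤ 4 * n := by rw [pow_succ]; omega
    exact_mod_cast this
  have h₂ : ((h : ℝ) + 1) * Real.log 2 ≤ Real.log (4 * n) := by
    have := Real.log_le_log (by positivity) h₁
    rwa [Real.log_pow, Nat.cast_add, Nat.cast_one] at this
  have h₃ : Real.log (4 * n) ≤ Real.log (((n : ℝ) + 2) ^ 2) :=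
    Real.log_le_log (by positivity) (by nlinarith)
  rw [Real.log_pow] at h₃
  push_cast at h₃
  have := Real.log_two_gt_d9
  have h₄ : 0 ≤ (h : ℝ) := by positivity
  nlinarith

/-- The running time is at most the geometric mean of the bounds from the two estimates of `Y`. -/
theorem geometric_mean_bound {n Y β : ℕ} {r : ℝ} (hn : 1 ≤ n) (hβ : 1 ≤ β)
    (hr : 1 ≤ r * √(n : ℝ)) (hY : Y ≤ n * n) (hY' : (Y : ℝ) ≤ 2100 * (β * (r * (√(n : ℝ) * n)))) :
    (n : ℝ) * (n + Y) ≤ 47 * (√r * (n : ℝ) ^ (2.75 : ℝ) * √(β : ℝ)) := by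
  have hn' : (1 : ℝ) ≤ n := by exact_mod_cast hn
  have hβ' : (1 : ℝ) ≤ β := by exact_mod_cast hβ
  have hn0 : (0 : ℝ) < n := by linarith
  have hs : 0 < √(n : ℝ) := Real.sqrt_pos.2 hn0
  have hr0 : 0 < r := by by_contra h; nlinarith [not_lt.1 h]
  set Z : ℝ := β * (r * (√(n : ℝ) * n)) with hZ
  have hZ0 : 0 ≤ Z := by positivity
  have hpow : √r * (n : ℝ) ^ (2.75 : ℝ) * √(β : ℝ) = n * n * √Z := by
    have h₁ : (n : ℝ) ^ (2.75 : ℝ) = n * n * √(√(n : ℝ) * n) := by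
      have : √(n : ℝ) * n = (n : ℝ) ^ (1.5 : ℝ) := by
        rw [Real.sqrt_eq_rpow]
        nth_rewrite 2 [← Real.rpow_one (n : ℝ)]
        rw [← Real.rpow_add hn0]
        norm_num
      rw [this, Real.sqrt_eq_rpow, ← Real.rpow_mul hn0.le]
      nth_rewrite 2 [← Real.rpow_one (n : ℝ)]
      nth_rewrite 3 [← Real.rpow_one (n : ℝ)]
      rw [← Real.rpow_add hn0, ← Real.rpow_add hn0]
      norm_num
    rw [h₁, hZ, Real.sqrt_mul (Nat.cast_nonneg β), Real.sqrt_mul hr0.le]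
    ring
  rw [hpow]
  -- This is where β ≥ 1 and r √n ≥ 1 enter; it makes √Z ≥ 1, so that n · n is absorbed as well.
  have hZn : (n : ℝ) ≤ Z := by
    calc (n : ℝ) = 1 * (1 * n) := by ring
      _ ≤ β * (r * √(n : ℝ) * n) := by gcongr
      _ = Z := by rw [hZ]; ring
  have hZ1 : 1 ≤ √Z := Real.one_le_sqrt.2 (hn'.trans hZn)
  have hY0 : (0 : ℝ) ≤ Y := by positivity
  -- Multiply the two bounds for Y and take the root; 46² = 2116 exceeds 2100.
  have hYs : (Y : ℝ) ≤ 46 * (n * √Z) := by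
    refine abs_le_of_sq_le_sq' ?_ (by positivity) |>.2
    have hYn : (Y : ℝ) ≤ n * n := by exact_mod_cast hY
    have hsq : √Z ^ 2 = Z := Real.sq_sqrt hZ0
    calc (Y : ℝ) ^ 2 = Y * Y := sq _
      _ ≤ (n * n) * (2100 * Z) := by gcongr
      _ ≤ (46 * (n * √Z)) ^ 2 := by
        rw [mul_pow, mul_pow, hsq]
        nlinarith [mul_nonneg (mul_nonneg hn0.le hn0.le) hZ0]
  have h₂ : (n : ℝ) * n ≤ n * n * √Z := le_mul_of_one_le_right (by positivity) hZ1
  have h₃ : (n : ℝ) * Y ≤ n * (46 * (n * √Z)) := by gcongr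
  nlinarith

theorem IsDense.one_le {n β : ℕ} {p : Fin n → Plane} (h : IsDense β p) (hn : 1 ≤ n) : 1 ≤ β := by
  refine le_trans ?_ (h (gridCell n (p ⟨0, hn⟩)))
  exact (Set.ncard_pos (Set.toFinite _)).2 ⟨⟨0, hn⟩, rfl⟩

end Bound

end DiskAPSP

theorem mainTheorem4 :
    ∃ (P : DiskAPSP.Prog) (c k : ℕ) (C : ℝ),
      ∀ (b : ℕ → ℕ) (n : ℕ) (p : Fin n → DiskAPSP.Plane) (r : ℝ) (w : Fin n → NNReal),
        Function.Injective p →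
        DiskAPSP.InUnitSquare p →
        DiskAPSP.IsDense (b n) p →
        0 < r → r ≤ 1 →
        ∃ (T : ℕ) (s : DiskAPSP.State),
          DiskAPSP.Exec p r ((n + 2) ^ c) P (DiskAPSP.initState w) T s ∧
          DiskAPSP.SolvesAPSP (DiskAPSP.diskGraph p r) w s ∧
          (1 ≤ r * √(n : ℝ) →
            (T : ℝ) ≤ C * √r * (n : ℝ) ^ (2.75 : ℝ) * √(b n : ℝ) *
              Real.log ((n : ℝ) + 2) ^ k) := by
  -- The exponent 6 comes from 16 (n + 2)² ≤ (n + 2)⁶, as 16 ≤ (n + 2)⁴. The constant is 1000 · 4 ·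
  -- 47: step count, logarithm, geometric mean.
  refine ⟨DiskAPSP.apspProg, 6, 1, 188000, ?_⟩
  intro b n p r w _ hp hb _ _
  have hW : 16 * (n * n) + 64 * n + 64 ≤ (n + 2) ^ 6 := by
    have h₁ : 2 ^ 4 ≤ (n + 2) ^ 4 := Nat.pow_le_pow_left (by omega) 4
    calc 16 * (n * n) + 64 * n + 64 = 2 ^ 4 * (n + 2) ^ 2 := by ring
      _ ≤ (n + 2) ^ 4 * (n + 2) ^ 2 := by gcongr
      _ = (n + 2) ^ 6 := by ring
  obtain ⟨T, s, hexec, hsol, hT⟩ := DiskAPSP.apspProg_spec (p := p) (r := r) (w := w) hW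
  refine ⟨T, s, hexec, hsol, fun hr => ?_⟩
  have hn : 1 ≤ n := by
    rcases Nat.eq_zero_or_pos n with rfl | h
    · norm_num at hr
    · exact h
  obtain ⟨h, π, hnN, hN, hπ, hT⟩ := hT hn
  have h₁ := DiskAPSP.time_le hn hN (hπ.firstArc_le (r := r) hn) hT
  have h₂ := DiskAPSP.geometric_mean_bound hn (hb.one_le hn) hr
    (DiskAPSP.totalFlips_le (p := p) (r := r) π) (hπ.totalFlips_le hp hb hn hr)
  have h₃ := DiskAPSP.depth_le_log hn hN
  have hlog : 0 ≤ Real.log ((n : ℝ) + 2) :=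
    Real.log_nonneg (by have : (0 : ℝ) ≤ n := by positivity
                        linarith)
  set Y := DiskAPSP.totalFlips p r π
  calc (T : ℝ) ≤ ((1000 * (n * ((h + 1) * (n + Y))) : ℕ) : ℝ) := by exact_mod_cast h₁
    _ = 1000 * (((h : ℝ) + 1) * (n * (n + Y))) := by push_cast; ring
    _ ≤ 1000 * ((4 * Real.log ((n : ℝ) + 2)) *
          (47 * (√r * (n : ℝ) ^ (2.75 : ℝ) * √(b n : ℝ)))) := by gcongr
    _ = 188000 * √r * (n : ℝ) ^ (2.75 : ℝ) * √(b n : ℝ) * Real.log ((n : ℝ) + 2) ^ 1 := by ring
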